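/- **Setting.** Let $d=d_x+d_y$ with $d_x\ge 1$. In each round $t=1,\dots,T$, contexts $x_{t,k}\in\mathcal X\subset\mathbb R^{d_x}$ of the arms $k\in[K]$ are revealed, a learner plays a pair $(a_t,b_t)$ and then sees the post-serving contexts $y_{t,k}\in\mathbb R^{d_y}$ of the two arms played. Here $y_{t,k}=\phi_*(x_{t,k})+\epsilon_{t,k}$ with $\epsilon_{t,k}$ centred conditionally on everything known when the arms of round $t$ are chosen. Put $z_{t,k}=(x_{t,k},y_{t,k})$, $z^*_{t,k}=(x_{t,k},\phi_*(x_{t,k}))$ and $\Delta z_t=z_{t,a_t}-z_{t,b_t}$. The true outcome $l_t\in\{0,1\}$ satisfies $\mathbb E[l_t\mid\text{past},\,x_t,a_t,b_t,y_t]=g(\langle\Theta_*,\Delta z_t\rangle)$ for a link $g:\mathbb R\to[0,1]$. An adversary replaces $l_t$ by $o_t\in\{0,1\}$ with $\sum_{t\le T}|l_t-o_t|\le C$, and $o_t$ is revealed after a delay $\tau_t\in\mathbb N$. Either the delays are stochastic (independent, sub-Gaussian with some variance proxy $\sigma^2$, mean $\mu_\tau$) or adversarial (arbitrary with $\sum_{t\le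 T}\tau_t\le\Lambda$). Let $\mathcal D=\max(\sqrt\Lambda,\mu_\tau)$ with $\Lambda,\mu_\tau\ge0$ (a quantity that does not belong to the regime in force may be put to $0$), and suppose $C\ge 0$ and $C+\mathcal D>0$. The regret is $$R_T=\sum_{t=1}^T\tfrac12\Big(2\max_k\langle\Theta_*,z^*_{t,k}\rangle-\langle\Theta_*,z^*_{t,a_t}\rangle-\langle\Theta_*,z^*_{t,b_t}\rangle\Big).$$ **Algorithm (RCDP-UCB).** Fix $\lambda>0$, a threshold $\alpha>0$ and widths $c_t$. Let $\widetilde V_0=\lambda I$, $\omega_t=\min(1,\alpha/\|\Delta z_t\|_{\widetilde V_{t-1}^{-1}})$ and $\widetilde V_t=\widetilde V_{t-1}+\kappa\,\omega_t\,\Delta z_t\Delta z_t^\top$. Let $\Theta_0=0$, and let $\Theta_t$ minimize $$\tfrac\lambda2\|\Theta\|^2+\sum_{s\ge 1,\ s+\tau_s\le t-1}\omega_s\,\ell(o_s,\langle\Theta,\Delta z_s\rangle),\qquad \ell(o,v)=\int_0^v g-o\,v,$$ where $\ell$ is the negative log-likelihood of the exponential family with mean function $g$ (for the logistic link this is $-\log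 g((-1)^{1-o}v)$ up to an additive constant). Let $\widehat\phi_t$ be an approximator of $\phi_*$ trained on the pairs $(x_{s,a_s},y_{s,a_s}),(x_{s,b_s},y_{s,b_s})$, $s\le t$, and put $\widehat z_{t,k}=(x_{t,k},\widehat\phi_{t-1}(x_{t,k}))$. In round $t$ play $a_t\in\arg\max_k\langle\Theta_{t-1},\widehat z_{t,k}\rangle$ and $b_t\in\arg\max_k\{\langle\Theta_{t-1},\widehat z_{t,k}\rangle+c_t\|\widehat z_{t,k}-\widehat z_{t,a_t}\|_{\widetilde V_{t-1}^{-1}}\}$. **Assumptions.** (1) $g$ is continuously differentiable, and $\dot g\ge\kappa>0$ on an interval (the domain of interest) that almost surely contains $\langle\Theta_*,\Delta z_s\rangle$ and $\langle\Theta_t,\Delta z_s\rangle$ for the rounds $s\le t$ of the run. (2) $\|\Theta_*\|\le M$. (3) For constants $C_0>0$, $a\in(0,1/2]$ and $r\in\{1/2,a\}$, for every $t\le T$ and $\delta'\in(0,1)$, with probability at least $1-\delta'$, $\sup_{x\in\mathcal X}\|\widehat\phi_t(x)-\phi_*(x)\|\le C_0\,d_x^{\,r}\,t^{-a}\log(t/\delta')$.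 (4) Almost surely $\|z_{t,k}\|\le 1/2$ for all $t,k$. **Theorem.** Let $\delta\in(0,1)$, $\alpha=\sqrt d/(C+\mathcal D)$ and $c_t=2\beta_t$, where $$\beta_t=\nu\,\big(1+\log\tfrac t\delta\big)\Big(\tfrac12\sqrt{d\log\tfrac{1+t/(d\lambda)}{\delta}}+\sqrt\lambda M+\alpha C+\alpha\mathcal D\Big).$$ There are an absolute $p\in\mathbb N$ and a $\nu_0=\nu_0(\kappa,\lambda)>0$ such that for every $\nu\ge\nu_0$ there is a constant $c$, depending only on $\kappa,\lambda,\nu,M,C_0,a,r$, such that, with probability at least $1-\delta$, $$R_T\le c\,\big(1+\log\tfrac T\delta\big)^p\Big(d(\sqrt T+C+\mathcal D)+T^{1-a}d_x^{\,r}(1+\sqrt d)\Big),$$ that is, $R_T=\widetilde O\big(d(\sqrt T+C+\mathcal D)+T^{1-a}d_x^{\,r}(1+\sqrt d)\big)$. If $a=1/2$, then also, with probability at least $1-\delta$, $R_T\le c\,(1+\log\frac T\delta)^p\,d(\sqrt T+C+\mathcal D)$. -/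

import Mathlib

open MeasureTheory ProbabilityTheory
open scoped Matrix NNReal

namespace RCDP

/-- `ℝⁿ` with its Euclidean norm. -/
abbrev Vec (n : ℕ) := EuclideanSpace ℝ (Fin n)

/-- The joint feature space `ℝ^{d_x + d_y}` with its Euclidean norm. -/
abbrev Feature (dx dy : ℕ) := EuclideanSpace ℝ (Fin dx ⊕ Fin dy)

/-- Concatenation `(x, y)` of a pre-serving and a post-serving context. -/
def joint {dx dy : ℕ} (x : Vec dx) (y : Vec dy) : Feature dx dy :=
  WithLp.toLp 2 (Sum.elim (fun i => x i) (fun j => y j))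

/-- The weighted norm `‖v‖_A = √(vᵀ A v)`. -/
noncomputable def matNorm {ι : Type*} [Fintype ι] (A : Matrix ι ι ℝ) (v : EuclideanSpace ℝ ι) : ℝ :=
  Real.sqrt (v.ofLp ⬝ᵥ (A *ᵥ v.ofLp))

/-- `min (1, α / n)` for `n ≥ 0` and `α > 0`, with `α / 0 = ∞`. -/
noncomputable def clip (α n : ℝ) : ℝ := if n ≤ α then 1 else α / n

/-- The design matrices `V₀ = λ I`, `V_{t+1} = V_t + κ ω_{t+1} Δ_{t+1} Δ_{t+1}ᵀ` with the weights
`ω_{t+1} = min (1, α / ‖Δ_{t+1}‖_{V_t⁻¹})`. The entry `Δ 0` is not used: rounds start at `1`. -/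
noncomputable def designMatrix {ι : Type*} [Fintype ι] [DecidableEq ι] (lam κ α : ℝ)
    (Δ : ℕ → EuclideanSpace ℝ ι) : ℕ → Matrix ι ι ℝ
  | 0 => lam • (1 : Matrix ι ι ℝ)
  | t + 1 => designMatrix lam κ α Δ t +
      (κ * clip α (matNorm (designMatrix lam κ α Δ t)⁻¹ (Δ (t + 1)))) •
        Matrix.vecMulVec (Δ (t + 1)).ofLp (Δ (t + 1)).ofLp

/-- Negative log-likelihood of an outcome `o` at natural parameter `v`, up to an additive constant,
in the exponential family with mean function `g`: the density is `exp (o v - A v)` with `A' = g`.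
For the logistic link this is `-log g (± v)`, see `expFamilyNLL_sigmoid`. -/
noncomputable def expFamilyNLL (g : ℝ → ℝ) (o v : ℝ) : ℝ := (∫ u in (0 : ℝ)..v, g u) - o * v

/-- In the Bradley-Terry-Luce model the loss is `-log g ((-1)^{1-o} v)` up to a constant. -/
theorem expFamilyNLL_sigmoid (v : ℝ) :
    expFamilyNLL Real.sigmoid 1 v = -Real.log (Real.sigmoid v) - Real.log 2 ∧
    expFamilyNLL Real.sigmoid 0 v = -Real.log (Real.sigmoid (-v)) - Real.log 2 := by
  have hA : ∫ u in (0 : ℝ)..v, Real.sigmoid u = Real.log (1 + Real.exp v) - Real.log 2 := by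
    have h : ∀ u ∈ Set.uIcc 0 v,
        HasDerivAt (fun u => Real.log (1 + Real.exp u)) (Real.sigmoid u) u := by
      intro u _
      have h1 : HasDerivAt (fun u => 1 + Real.exp u) (Real.exp u) u :=
        (Real.hasDerivAt_exp u).const_add 1
      have h2 := h1.log (by positivity)
      convert h2 using 1
      rw [Real.sigmoid_def, Real.exp_neg]
      have := Real.exp_pos u
      field_simp
      rw [add_comm]
    rw [intervalIntegral.integral_eq_sub_of_hasDerivAt h
      (continuous_sigmoid.intervalIntegrable _ _)]
    norm_num
  have hs : ∀ w : ℝ, Real.log (Real.sigmoid w) = -Real.log (1 + Real.exp (-w)) := by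
    intro w
    rw [Real.sigmoid_def, Real.log_inv]
  have h3 : Real.log (1 + Real.exp v) = v + Real.log (1 + Real.exp (-v)) := by
    have : 1 + Real.exp v = Real.exp v * (1 + Real.exp (-v)) := by
      rw [mul_add, ← Real.exp_add]; simp [add_comm]
    rw [this, Real.log_mul (by positivity) (by positivity), Real.log_exp]
  constructor
  · rw [expFamilyNLL, hA, hs, h3]; linarith
  · rw [expFamilyNLL, hA, hs, neg_neg, neg_neg, zero_mul, sub_zero]

/-- All random quantities produced while a learner interacts with the environment. Rounds are
`t = 1, 2, …`; index `0` is used for `Θ` only. -/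
structure Run (Ω : Type*) (dx dy K : ℕ) where
  /-- pre-serving contexts `x_{t,k}` -/
  x : ℕ → Fin K → Ω → Vec dx
  /-- post-serving contexts `y_{t,k}` -/
  y : ℕ → Fin K → Ω → Vec dy
  /-- true binary outcomes `l_t` -/
  l : ℕ → Ω → ℝ
  /-- possibly corrupted binary outcomes `o_t` that reach the learner -/
  o : ℕ → Ω → ℝ
  /-- delays `τ_t` -/
  τ : ℕ → Ω → ℕ
  /-- first arm `a_t` -/
  a : ℕ → Ω → Fin K
  /-- second arm `b_t` -/
  b : ℕ → Ω → Fin K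
  /-- parameter estimates `Θ_t` -/
  Θ : ℕ → Ω → Feature dx dy
  /-- procedure that trains the approximator on a data set; it may be randomized -/
  train : Ω → List (Vec dx × Vec dy) → Vec dx → Vec dy

namespace Run

variable {Ω : Type*} {dx dy K : ℕ} (R : Run Ω dx dy K)

/-- Features `z_{t,k} = (x_{t,k}, y_{t,k})`. -/
def z (t : ℕ) (k : Fin K) (ω : Ω) : Feature dx dy := joint (R.x t k ω) (R.y t k ω)

/-- Observed feature differences `Δz_t = z_{t,a_t} - z_{t,b_t}`. -/
noncomputable def dz (t : ℕ) (ω : Ω) : Feature dx dy := R.z t (R.a t ω) ω - R.z t (R.b t ω) ω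

/-- Noise-free features `z*_{t,k} = (x_{t,k}, φ_*(x_{t,k}))`. -/
def zstar (φ : Vec dx → Vec dy) (t : ℕ) (k : Fin K) (ω : Ω) : Feature dx dy :=
  joint (R.x t k ω) (φ (R.x t k ω))

/-- The context pairs of the arms played in rounds `1, …, t`. -/
def buffer : ℕ → Ω → List (Vec dx × Vec dy)
  | 0, _ => []
  | t + 1, ω => buffer t ω ++
      [(R.x (t + 1) (R.a (t + 1) ω) ω, R.y (t + 1) (R.a (t + 1) ω) ω),
       (R.x (t + 1) (R.b (t + 1) ω) ω, R.y (t + 1) (R.b (t + 1) ω) ω)]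

/-- The approximator of `φ_*` trained at the end of round `t`. -/
def phiHat (t : ℕ) (ω : Ω) : Vec dx → Vec dy := R.train ω (R.buffer t ω)

/-- Estimated features in round `t`; the approximator of the previous round is used. -/
def zhat (t : ℕ) (k : Fin K) (ω : Ω) : Feature dx dy :=
  joint (R.x t k ω) (R.phiHat (t - 1) ω (R.x t k ω))

/-- `Ṽ_t = λ I + κ ∑_{s ≤ t} ω_s Δz_s Δz_sᵀ`. -/
noncomputable def V (lam κ α : ℝ) (t : ℕ) (ω : Ω) : Matrix (Fin dx ⊕ Fin dy) (Fin dx ⊕ Fin dy) ℝ :=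
  designMatrix lam κ α (fun s => R.dz s ω) t

/-- `ω_s = min (1, α / ‖Δz_s‖_{Ṽ_{s-1}⁻¹})`. -/
noncomputable def weight (lam κ α : ℝ) (s : ℕ) (ω : Ω) : ℝ :=
  clip α (matNorm (R.V lam κ α (s - 1) ω)⁻¹ (R.dz s ω))

/-- Rounds whose outcome has arrived by the end of round `t`. -/
def hist (t : ℕ) (ω : Ω) : Finset ℕ := {s ∈ Finset.Icc 1 t | s + R.τ s ω ≤ t}

/-- The weighted, regularized negative log-likelihood `ℒ_t`. -/
noncomputable def loss (g : ℝ → ℝ) (lam κ α : ℝ) (t : ℕ) (ω : Ω) (θ : Feature dx dy) : ℝ :=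
  lam / 2 * ‖θ‖ ^ 2 + ∑ s ∈ R.hist (t - 1) ω,
    R.weight lam κ α s ω * expFamilyNLL g (R.o s ω) (inner ℝ θ (R.dz s ω))

/-- The cumulative regret over `T` rounds:
`R_T = ∑ t, ½ (max_k u*_{t,k} - u*_{t,a_t} + max_k u*_{t,k} - u*_{t,b_t})`, `u* = ⟨Θ_*, z*⟩`. -/
noncomputable def regret (φ : Vec dx → Vec dy) (θs : Feature dx dy) (T : ℕ) (ω : Ω) : ℝ :=
  ∑ t ∈ Finset.Icc 1 T, (1 / 2 : ℝ) *
    (((⨆ k, inner ℝ θs (R.zstar φ t k ω)) - inner ℝ θs (R.zstar φ t (R.a t ω) ω)) +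
      ((⨆ k, inner ℝ θs (R.zstar φ t k ω)) - inner ℝ θs (R.zstar φ t (R.b t ω) ω)))

/-- During the first `T` rounds the learner follows RCDP-UCB with regularization `λ`, derivative
bound `κ`, clipping threshold `α` and exploration widths `c_t`; ties are broken arbitrarily. -/
structure IsRCDPUCB (g : ℝ → ℝ) (lam κ α : ℝ) (c : ℕ → ℝ) (T : ℕ) : Prop where
  theta_zero : ∀ ω, R.Θ 0 ω = 0
  theta_min : ∀ t ∈ Finset.Icc 1 T, ∀ ω, IsMinOn (R.loss g lam κ α t ω) Set.univ (R.Θ t ω)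
  first_arm : ∀ t ∈ Finset.Icc 1 T, ∀ ω k,
    (inner ℝ (R.Θ (t - 1) ω) (R.zhat t k ω) : ℝ) ≤
      inner ℝ (R.Θ (t - 1) ω) (R.zhat t (R.a t ω) ω)
  second_arm : ∀ t ∈ Finset.Icc 1 T, ∀ ω k,
    inner ℝ (R.Θ (t - 1) ω) (R.zhat t k ω) +
        c t * matNorm (R.V lam κ α (t - 1) ω)⁻¹ (R.zhat t k ω - R.zhat t (R.a t ω) ω) ≤
      inner ℝ (R.Θ (t - 1) ω) (R.zhat t (R.b t ω) ω) +
        c t * matNorm (R.V lam κ α (t - 1) ω)⁻¹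
          (R.zhat t (R.b t ω) ω - R.zhat t (R.a t ω) ω)

variable [MeasurableSpace Ω]

/-- The interaction protocol. `pre t` is the information available when the arms of round `t` are
chosen (everything before round `t`, and the contexts `x_{t,k}`); `mid t` contains in addition
the post-serving contexts of round `t`, but not the outcome `l_t`. -/
structure IsEnvironment (P : Measure Ω) (g : ℝ → ℝ) (φ : Vec dx → Vec dy) (θs : Feature dx dy)
    (T : ℕ) (pre mid : ℕ → MeasurableSpace Ω) : Prop where
  pre_le_mid : ∀ t, pre t ≤ mid t
  mid_le_pre : ∀ t, mid t ≤ pre (t + 1)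
  pre_le : ∀ t, pre t ≤ ‹MeasurableSpace Ω›
  measurable_x : ∀ t ∈ Finset.Icc 1 T, ∀ k, Measurable[pre t] (R.x t k)
  measurable_a : ∀ t ∈ Finset.Icc 1 T, Measurable[pre t] (R.a t)
  measurable_b : ∀ t ∈ Finset.Icc 1 T, Measurable[pre t] (R.b t)
  measurable_y : ∀ t ∈ Finset.Icc 1 T, ∀ k, Measurable[mid t] (R.y t k)
  measurable_l : ∀ t ∈ Finset.Icc 1 T, Measurable[pre (t + 1)] (R.l t)
  measurable_o : ∀ t ∈ Finset.Icc 1 T, Measurable (R.o t)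
  measurable_τ : ∀ t ∈ Finset.Icc 1 T, Measurable (R.τ t)
  /-- `y_{t,k} = φ_*(x_{t,k}) + ε_{t,k}` with conditionally centred noise -/
  condExp_y : ∀ t ∈ Finset.Icc 1 T, ∀ k, P[R.y t k | pre t] =ᵐ[P] fun ω => φ (R.x t k ω)
  binary_l : ∀ t ∈ Finset.Icc 1 T, ∀ ω, R.l t ω = 0 ∨ R.l t ω = 1
  binary_o : ∀ t ∈ Finset.Icc 1 T, ∀ ω, R.o t ω = 0 ∨ R.o t ω = 1
  /-- the preference model -/
  condExp_l : ∀ t ∈ Finset.Icc 1 T, P[R.l t | mid t] =ᵐ[P] fun ω => g (inner ℝ θs (R.dz t ω))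

/-- The adversary alters at most a total amount `C` of the outcomes. -/
def CorruptionBudget (P : Measure Ω) (C : ℝ) (T : ℕ) : Prop :=
  ∀ᵐ ω ∂P, ∑ t ∈ Finset.Icc 1 T, |R.l t ω - R.o t ω| ≤ C

/-- Independent `σ²`-sub-Gaussian delays with mean `μ_τ`. -/
def StochasticDelays (P : Measure Ω) (muτ : ℝ) (σ : ℝ≥0) (T : ℕ) : Prop :=
  iIndepFun (fun (t : Finset.Icc 1 T) => R.τ t.1) P ∧
    ∀ t ∈ Finset.Icc 1 T, (∫ ω, (R.τ t ω : ℝ) ∂P) = muτ ∧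
      HasSubgaussianMGF (fun ω => (R.τ t ω : ℝ) - muτ) (σ ^ 2) P

/-- Arbitrary (adaptively chosen) delays with total budget `Λ`. -/
def AdversarialDelays (P : Measure Ω) (Lam : ℝ) (T : ℕ) : Prop :=
  ∀ᵐ ω ∂P, ∑ t ∈ Finset.Icc 1 T, (R.τ t ω : ℝ) ≤ Lam

/-- `ġ ≥ κ` on an interval `J` (the domain of interest), which contains the arguments at which
the link is evaluated: at the true parameter, and at the estimates. -/
structure LinkAssumption (P : Measure Ω) (g : ℝ → ℝ) (κ : ℝ) (θs : Feature dx dy) (T : ℕ)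
    (J : Set ℝ) : Prop where
  contDiff : ContDiff ℝ 1 g
  range : ∀ u, g u ∈ Set.Icc (0 : ℝ) 1
  ordConnected : J.OrdConnected
  deriv_ge : ∀ u ∈ J, κ ≤ deriv g u
  true_mem : ∀ᵐ ω ∂P, ∀ s ∈ Finset.Icc 1 T, (inner ℝ θs (R.dz s ω) : ℝ) ∈ J
  estimate_mem : ∀ᵐ ω ∂P, ∀ t < T, ∀ s ∈ Finset.Icc 1 t,
    (inner ℝ (R.Θ t ω) (R.dz s ω) : ℝ) ∈ J

/-- For each round `t` and each `δ`, with probability at least `1 - δ`, uniformly over the context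
set `𝒳`, `‖φ̂_t(x) - φ_*(x)‖ ≤ C₀ d_x^r t^{-a} log (t / δ)`. -/
def Learnability (P : Measure Ω) (φ : Vec dx → Vec dy) (𝒳 : Set (Vec dx)) (C₀ a r : ℝ) (T : ℕ) :
    Prop :=
  ∀ t ∈ Finset.Icc 1 T, ∀ δ ∈ Set.Ioo (0 : ℝ) 1,
    P {ω | ∃ x ∈ 𝒳, C₀ * (dx : ℝ) ^ r / (t : ℝ) ^ a * Real.log (t / δ) <
      ‖R.phiHat t ω x - φ x‖} ≤ ENNReal.ofReal δ

/-- All joint feature vectors lie in the ball of radius `1 / 2`. -/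
def BoundedFeatures (P : Measure Ω) (T : ℕ) : Prop :=
  ∀ᵐ ω ∂P, ∀ t ∈ Finset.Icc 1 T, ∀ k, ‖R.z t k ω‖ ≤ 1 / 2

end Run

/-- The delay complexity `𝒟 = max (√Λ, μ_τ)`. -/
noncomputable def delayComplexity (Lam muτ : ℝ) : ℝ := max (Real.sqrt Lam) muτ

/-- The clipping threshold `α = √d / (C + 𝒟)`. -/
noncomputable def threshold (d : ℕ) (C D : ℝ) : ℝ := Real.sqrt d / (C + D)

/-- The confidence radius
`β_t = ν (1 + log (t/δ)) (½ √(d log ((1 + t/(dλ)) / δ)) + √λ M + α C + α 𝒟)`. -/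
noncomputable def confRadius (ν lam M δ : ℝ) (d : ℕ) (C D : ℝ) (t : ℕ) : ℝ :=
  ν * (1 + Real.log (t / δ)) *
    (1 / 2 * Real.sqrt (d * Real.log ((1 + t / (d * lam)) / δ)) + Real.sqrt lam * M +
      threshold d C D * C + threshold d C D * D)

end RCDP

/-! The proof combines a confidence set for the estimator with an optimism argument for duelling
arms. Four failure events receive probability `δ / 4` each.

Confidence set. Test the first order condition for `Θ_t` with `Θ_t - Θ_*`. Since `g' ≥ κ`, the
squared `V_t`-norm of the error is at most a sum of four terms: regularization, corruption, noise
and missing outcomes (`matNorm_estimate_sub_le`). Clipping makes every weighted feature difference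
have dual norm at most `α`, so corruption costs at most `α C` and each missing outcome at most `min
α (1 / √λ)`. The outcomes that have not arrived are added and subtracted with their true values. The
noise sum thus runs over all rounds and is a martingale whatever the delays and the adversary do.
Its self-normalized norm is controlled by an exponential supermartingale (`selfNormalized_step`,
`integral_exp_potential_le`), whose compensator is bounded by `log det`.

Missing outcomes. Pending rounds have distinct ages, each at most the delay of the round. A total
budget `Λ` therefore allows only `O(√Λ)` of them. For independent delays Markov's inequality bounds
the probability that round `s` is still pending by `μ_τ / (t - s)`, which sums to `μ_τ` times a
harmonic number, and independence gives an exponential tail.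

Regret. With exploration width `2 β`, the choice of the two arms bounds the regret of a round by `3
/ 2 * β` times the width of the difference played, plus approximation errors
(`roundRegret_le_width`). This width is first measured at the noise-free difference `Δz*_t`, while
the design matrices are built from the observed `Δz_t`. Pairing both with the `V`-unit vector dual
to `Δz*_t`, which is known before the noise is drawn, shows that the widths differ by at most a
bounded martingale difference, so Azuma's inequality costs `√T` up to logarithms. The observed
widths are summed with the elliptical potential lemma: unclipped rounds give `√(d T)` and clipped
ones `d / α = √d (C + 𝒟)`. As `β` is of order `√d`, this produces `d (√T + C + 𝒟)`. The
approximation errors sum to `T^{1-a} d_x^r` and are multiplied by `1 + √d`. -/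

namespace RCDP

/-! ### Quadratic forms, dual norms and rank one updates of positive definite matrices -/

section LinearAlgebra

variable {ι : Type*} [Fintype ι]

/-- The bilinear form `uᵀ A v`. -/
noncomputable def bil (A : Matrix ι ι ℝ) (u v : EuclideanSpace ℝ ι) : ℝ :=
  u.ofLp ⬝ᵥ (A *ᵥ v.ofLp)

theorem matNorm_eq_sqrt_bil (A : Matrix ι ι ℝ) (v : EuclideanSpace ℝ ι) :
    matNorm A v = Real.sqrt (bil A v v) := rfl

theorem matNorm_nonneg (A : Matrix ι ι ℝ) (v : EuclideanSpace ℝ ι) : 0 ≤ matNorm A v :=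
  Real.sqrt_nonneg _

theorem inner_eq_dotProduct (u v : EuclideanSpace ℝ ι) :
    (inner ℝ u v : ℝ) = u.ofLp ⬝ᵥ v.ofLp := by
  rw [EuclideanSpace.inner_eq_star_dotProduct, star_trivial, dotProduct_comm]

theorem bil_add_left (A : Matrix ι ι ℝ) (u v w : EuclideanSpace ℝ ι) :
    bil A (u + v) w = bil A u w + bil A v w := by simp [bil, add_dotProduct]

theorem bil_add_right (A : Matrix ι ι ℝ) (u v w : EuclideanSpace ℝ ι) :
    bil A u (v + w) = bil A u v + bil A u w := by
  simp [bil, Matrix.mulVec_add, dotProduct_add]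

theorem bil_smul_left (A : Matrix ι ι ℝ) (c : ℝ) (u v : EuclideanSpace ℝ ι) :
    bil A (c • u) v = c * bil A u v := by simp [bil]

theorem bil_smul_right (A : Matrix ι ι ℝ) (c : ℝ) (u v : EuclideanSpace ℝ ι) :
    bil A u (c • v) = c * bil A u v := by simp [bil, Matrix.mulVec_smul]

theorem bil_neg_right (A : Matrix ι ι ℝ) (u v : EuclideanSpace ℝ ι) :
    bil A u (-v) = - bil A u v := by simp [bil, Matrix.mulVec_neg]

theorem bil_neg_left (A : Matrix ι ι ℝ) (u v : EuclideanSpace ℝ ι) :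
    bil A (-u) v = - bil A u v := by simp [bil]

theorem bil_comm {A : Matrix ι ι ℝ} (hA : A.IsHermitian) (u v : EuclideanSpace ℝ ι) :
    bil A u v = bil A v u := by
  have h : Aᵀ = A := by rw [← Matrix.conjTranspose_eq_transpose_of_trivial]; exact hA
  rw [bil, bil, Matrix.dotProduct_mulVec, ← Matrix.mulVec_transpose, h, dotProduct_comm]

theorem bil_self_nonneg {A : Matrix ι ι ℝ} (hA : A.PosSemidef) (u : EuclideanSpace ℝ ι) :
    0 ≤ bil A u u := by
  have := hA.dotProduct_mulVec_nonneg u.ofLp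
  rwa [star_trivial] at this

theorem sq_matNorm {A : Matrix ι ι ℝ} (hA : A.PosSemidef) (u : EuclideanSpace ℝ ι) :
    matNorm A u ^ 2 = bil A u u := Real.sq_sqrt (bil_self_nonneg hA u)

/-- The quadratic polynomial `x ↦ bil A (u + x • v) (u + x • v)` is nonnegative, so its discriminant
is not positive. -/
theorem bil_sq_le {A : Matrix ι ι ℝ} (hA : A.PosSemidef) (u v : EuclideanSpace ℝ ι) :
    bil A u v ^ 2 ≤ bil A u u * bil A v v := by
  have h : ∀ x : ℝ, 0 ≤ bil A v v * (x * x) + 2 * bil A u v * x + bil A u u := by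
    intro x
    have := bil_self_nonneg hA (u + x • v)
    simp only [bil_add_left, bil_add_right, bil_smul_left, bil_smul_right] at this
    rw [bil_comm hA.isHermitian v u] at this
    linarith
  have := discrim_le_zero h
  rw [discrim] at this
  nlinarith

theorem abs_bil_le {A : Matrix ι ι ℝ} (hA : A.PosSemidef) (u v : EuclideanSpace ℝ ι) :
    |bil A u v| ≤ matNorm A u * matNorm A v := by
  rw [matNorm_eq_sqrt_bil, matNorm_eq_sqrt_bil, ← Real.sqrt_mul (bil_self_nonneg hA u)]
  exact Real.abs_le_sqrt (bil_sq_le hA u v)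

theorem matNorm_add_le {A : Matrix ι ι ℝ} (hA : A.PosSemidef) (u v : EuclideanSpace ℝ ι) :
    matNorm A (u + v) ≤ matNorm A u + matNorm A v := by
  refine abs_le_of_sq_le_sq' ?_ (add_nonneg (matNorm_nonneg _ _) (matNorm_nonneg _ _)) |>.2
  have h := (le_abs_self _).trans (abs_bil_le hA u v)
  have h1 : matNorm A (u + v) ^ 2 = bil A u u + 2 * bil A u v + bil A v v := by
    rw [sq_matNorm hA]
    simp only [bil_add_left, bil_add_right]
    rw [bil_comm hA.isHermitian v u]
    ring
  rw [h1, add_sq, sq_matNorm hA, sq_matNorm hA]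
  linarith

theorem matNorm_neg (A : Matrix ι ι ℝ) (u : EuclideanSpace ℝ ι) :
    matNorm A (-u) = matNorm A u := by
  rw [matNorm_eq_sqrt_bil, matNorm_eq_sqrt_bil, bil_neg_left, bil_neg_right, neg_neg]

theorem matNorm_sub_le {A : Matrix ι ι ℝ} (hA : A.PosSemidef) (u v : EuclideanSpace ℝ ι) :
    matNorm A (u - v) ≤ matNorm A u + matNorm A v := by
  rw [sub_eq_add_neg, ← matNorm_neg A v]
  exact matNorm_add_le hA _ _

/-- `A v` for a matrix `A` acting on a Euclidean space. -/
noncomputable def act (A : Matrix ι ι ℝ) (v : EuclideanSpace ℝ ι) : EuclideanSpace ℝ ι :=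
  WithLp.toLp 2 (A *ᵥ v.ofLp)

theorem bil_eq_inner (A : Matrix ι ι ℝ) (u v : EuclideanSpace ℝ ι) :
    bil A u v = inner ℝ u (act A v) := by
  rw [inner_eq_dotProduct]; rfl

/-- The rank one update `V + c x xᵀ`. -/
noncomputable def rankOne (V : Matrix ι ι ℝ) (c : ℝ) (x : EuclideanSpace ℝ ι) : Matrix ι ι ℝ :=
  V + c • Matrix.vecMulVec x.ofLp x.ofLp

theorem bil_rankOne (V : Matrix ι ι ℝ) (c : ℝ) (x u v : EuclideanSpace ℝ ι) :
    bil (rankOne V c x) u v = bil V u v + c * (inner ℝ u x * inner ℝ v x) := by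
  simp only [bil, rankOne, Matrix.add_mulVec, Matrix.smul_mulVec, dotProduct_add, dotProduct_smul,
    Matrix.vecMulVec_mulVec, inner_eq_dotProduct, smul_eq_mul]
  simp [dotProduct_comm v.ofLp x.ofLp]

theorem rankOne_posDef {V : Matrix ι ι ℝ} (hV : V.PosDef) {c : ℝ} (hc : 0 ≤ c)
    (x : EuclideanSpace ℝ ι) : (rankOne V c x).PosDef := by
  refine hV.add_posSemidef (Matrix.PosSemidef.smul ?_ hc)
  simpa using Matrix.posSemidef_vecMulVec_self_star x.ofLp

theorem trace_rankOne (V : Matrix ι ι ℝ) (c : ℝ) (x : EuclideanSpace ℝ ι) :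
    (rankOne V c x).trace = V.trace + c * ‖x‖ ^ 2 := by
  rw [rankOne, Matrix.trace_add, Matrix.trace_smul, Matrix.trace_vecMulVec, ← inner_eq_dotProduct,
    real_inner_self_eq_norm_sq, smul_eq_mul]

variable [DecidableEq ι]

/-- Rewriting the Euclidean pairing as a `V`-pairing makes Cauchy-Schwarz yield the duality between
the norms of `V` and `V⁻¹`. -/
theorem inner_eq_bil_act_inv {V : Matrix ι ι ℝ} (hV : V.PosDef) (u v : EuclideanSpace ℝ ι) :
    (inner ℝ u v : ℝ) = bil V u (act V⁻¹ v) := by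
  have hu : IsUnit V.det := (Matrix.isUnit_iff_isUnit_det V).1 hV.isUnit
  rw [inner_eq_dotProduct, bil, act, Matrix.mulVec_mulVec, Matrix.mul_nonsing_inv _ hu,
    Matrix.one_mulVec]

theorem matNorm_act_inv {V : Matrix ι ι ℝ} (hV : V.PosDef) (v : EuclideanSpace ℝ ι) :
    matNorm V (act V⁻¹ v) = matNorm V⁻¹ v := by
  rw [matNorm_eq_sqrt_bil, matNorm_eq_sqrt_bil, ← inner_eq_bil_act_inv hV, real_inner_comm,
    ← bil_eq_inner]

theorem abs_inner_le_matNorm {V : Matrix ι ι ℝ} (hV : V.PosDef) (u v : EuclideanSpace ℝ ι) :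
    |(inner ℝ u v : ℝ)| ≤ matNorm V u * matNorm V⁻¹ v := by
  rw [inner_eq_bil_act_inv hV, ← matNorm_act_inv hV v]
  exact abs_bil_le hV.posSemidef _ _

theorem inner_le_matNorm {V : Matrix ι ι ℝ} (hV : V.PosDef) (u v : EuclideanSpace ℝ ι) :
    (inner ℝ u v : ℝ) ≤ matNorm V u * matNorm V⁻¹ v :=
  (le_abs_self _).trans (abs_inner_le_matNorm hV u v)

theorem bil_inv_self_nonneg {V : Matrix ι ι ℝ} (hV : V.PosDef) (u : EuclideanSpace ℝ ι) :
    0 ≤ bil V⁻¹ u u := bil_self_nonneg hV.inv.posSemidef u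

/-- The Sherman-Morrison formula, as an identity of quadratic forms. -/
theorem bil_inv_rankOne {V : Matrix ι ι ℝ} (hV : V.PosDef) {c : ℝ} (hc : 0 ≤ c)
    (x u v : EuclideanSpace ℝ ι) :
    bil (rankOne V c x)⁻¹ u v =
      bil V⁻¹ u v - c * (bil V⁻¹ u x * bil V⁻¹ v x) / (1 + c * bil V⁻¹ x x) := by
  have hW := rankOne_posDef hV hc x
  have hq : 0 < 1 + c * bil V⁻¹ x x := by
    have := mul_nonneg hc (bil_inv_self_nonneg hV x); linarith
  set W := rankOne V c x with hWdef
  -- This is the candidate for `W⁻¹ v`; `key` verifies it by applying `W`.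
  set y : EuclideanSpace ℝ ι :=
    act V⁻¹ v - (c * bil V⁻¹ v x / (1 + c * bil V⁻¹ x x)) • act V⁻¹ x with hy
  have hu : IsUnit V.det := (Matrix.isUnit_iff_isUnit_det V).1 hV.isUnit
  have hWu : IsUnit W.det := (Matrix.isUnit_iff_isUnit_det W).1 hW.isUnit
  have hVV : ∀ w : EuclideanSpace ℝ ι, V *ᵥ (V⁻¹ *ᵥ w.ofLp) = w.ofLp := fun w => by
    rw [Matrix.mulVec_mulVec, Matrix.mul_nonsing_inv _ hu, Matrix.one_mulVec]
  have hsymm : x.ofLp ⬝ᵥ (V⁻¹ *ᵥ v.ofLp) = bil V⁻¹ v x := bil_comm hV.inv.isHermitian x v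
  have key : W *ᵥ y.ofLp = v.ofLp := by
    have hxy : x.ofLp ⬝ᵥ y.ofLp = bil V⁻¹ v x / (1 + c * bil V⁻¹ x x) := by
      have : x.ofLp ⬝ᵥ y.ofLp = bil V⁻¹ v x -
          (c * bil V⁻¹ v x / (1 + c * bil V⁻¹ x x)) * bil V⁻¹ x x := by
        rw [hy]
        simp only [WithLp.ofLp_sub, WithLp.ofLp_smul, dotProduct_sub, dotProduct_smul, act, hsymm,
          smul_eq_mul]
        rfl
      rw [this]; field_simp; ring
    rw [hWdef, rankOne, Matrix.add_mulVec, Matrix.smul_mulVec, Matrix.vecMulVec_mulVec, hxy, hy]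
    simp only [WithLp.ofLp_sub, WithLp.ofLp_smul, act, Matrix.mulVec_sub, Matrix.mulVec_smul, hVV]
    ext i
    simp
    ring
  have hinv : W⁻¹ *ᵥ v.ofLp = y.ofLp := by
    rw [← key, Matrix.mulVec_mulVec, Matrix.nonsing_inv_mul _ hWu, Matrix.one_mulVec]
  rw [bil, hinv, hy]
  simp only [WithLp.ofLp_sub, WithLp.ofLp_smul, act, dotProduct_sub, dotProduct_smul, smul_eq_mul]
  change bil V⁻¹ u v - _ * bil V⁻¹ u x = _
  ring

theorem bil_inv_rankOne_self_le {V : Matrix ι ι ℝ} (hV : V.PosDef) {c : ℝ} (hc : 0 ≤ c)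
    (x u : EuclideanSpace ℝ ι) : bil (rankOne V c x)⁻¹ u u ≤ bil V⁻¹ u u := by
  rw [bil_inv_rankOne hV hc]
  have := mul_nonneg hc (bil_inv_self_nonneg hV x)
  have : 0 ≤ c * (bil V⁻¹ u x * bil V⁻¹ u x) / (1 + c * bil V⁻¹ x x) :=
    div_nonneg (mul_nonneg hc (mul_self_nonneg _)) (by linarith)
  linarith

theorem matNorm_inv_rankOne_le {V : Matrix ι ι ℝ} (hV : V.PosDef) {c : ℝ} (hc : 0 ≤ c)
    (x u : EuclideanSpace ℝ ι) : matNorm (rankOne V c x)⁻¹ u ≤ matNorm V⁻¹ u :=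
  Real.sqrt_le_sqrt (bil_inv_rankOne_self_le hV hc x u)

/-- The matrix determinant lemma: it makes the sum of `log (1 + gain)` telescope to a ratio of
determinants. -/
theorem det_rankOne {V : Matrix ι ι ℝ} (hV : V.PosDef) (c : ℝ) (x : EuclideanSpace ℝ ι) :
    (rankOne V c x).det = V.det * (1 + c * bil V⁻¹ x x) := by
  have hu : IsUnit V.det := (Matrix.isUnit_iff_isUnit_det V).1 hV.isUnit
  have h : c • Matrix.vecMulVec x.ofLp x.ofLp =
      Matrix.replicateCol Unit (c • x.ofLp) * Matrix.replicateRow Unit x.ofLp := by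
    ext i j
    simp [Matrix.vecMulVec_apply, Matrix.mul_apply, mul_assoc]
  rw [rankOne, h, Matrix.det_add_replicateCol_mul_replicateRow hu]
  congr 1
  rw [Matrix.det_unique]
  simp [Matrix.mul_assoc, Matrix.mul_apply, bil, dotProduct, Matrix.mulVec, Finset.mul_sum]

/-- The arithmetic-geometric mean inequality for the eigenvalues. -/
theorem log_det_le [Nonempty ι] {V : Matrix ι ι ℝ} (hV : V.PosDef) :
    Real.log V.det ≤ Fintype.card ι * Real.log (V.trace / Fintype.card ι) := by
  have hd : (0 : ℝ) < Fintype.card ι := by exact_mod_cast Fintype.card_pos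
  have hpos := hV.eigenvalues_pos
  have hdet : V.det = ∏ i, hV.1.eigenvalues i := by
    simpa using hV.1.det_eq_prod_eigenvalues
  have htr : V.trace = ∑ i, hV.1.eigenvalues i := by
    simpa using hV.1.trace_eq_sum_eigenvalues
  have hconc := strictConcaveOn_log_Ioi.concaveOn.le_map_sum (t := Finset.univ)
    (w := fun _ : ι => (Fintype.card ι : ℝ)⁻¹) (p := hV.1.eigenvalues)
    (fun _ _ => by positivity) (by simp) (fun i _ => hpos i)
  rw [hdet, htr, Real.log_prod (fun i _ => (hpos i).ne')]
  simp only [smul_eq_mul, ← Finset.mul_sum] at hconc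
  rw [div_eq_inv_mul]
  calc _ = Fintype.card ι * ((Fintype.card ι : ℝ)⁻¹ * ∑ i, Real.log (hV.1.eigenvalues i)) := by
        field_simp
    _ ≤ _ := by gcongr

end LinearAlgebra

/-! ### Clipped weights -/

theorem clip_nonneg {α n : ℝ} (hα : 0 ≤ α) (hn : 0 ≤ n) : 0 ≤ clip α n := by
  rw [clip]; split_ifs
  · exact zero_le_one
  · exact div_nonneg hα hn

theorem clip_le_one {α n : ℝ} (hα : 0 ≤ α) : clip α n ≤ 1 := by
  rw [clip]; split_ifs with h
  · exact le_rfl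
  · exact div_le_one_of_le₀ (not_le.1 h).le (hα.trans (not_le.1 h).le)

/-- The purpose of clipping: no single outcome moves the estimator by more than `α` in the dual
norm. -/
theorem clip_mul_le {α n : ℝ} (hα : 0 ≤ α) : clip α n * n ≤ α := by
  rw [clip]; split_ifs with h
  · simpa using h
  · rw [div_mul_cancel₀ _ (hα.trans_lt (not_le.1 h)).ne']

/-- With `q = κ * clip α n * n ^ 2`, an unclipped width is exactly `√(q / κ)`. A clipped one has
weight `α / n`, so `q` is linear in `n` and the second term alone equals `n`. -/
theorem le_sqrt_add_clip {α κ n : ℝ} (hα : 0 < α) (hκ : 0 < κ) (hn : 0 ≤ n) :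
    n ≤ Real.sqrt (κ * clip α n * n ^ 2 / κ) + κ * clip α n * n ^ 2 / (κ * α) := by
  have h0 := clip_nonneg hα.le hn
  have e1 : κ * clip α n * n ^ 2 / κ = clip α n * n ^ 2 := by field_simp
  by_cases h : n ≤ α
  · have e2 : clip α n = 1 := if_pos h
    rw [e1, e2, one_mul, Real.sqrt_sq hn]
    have : 0 ≤ κ * 1 * n ^ 2 / (κ * α) := by positivity
    linarith
  · have e2 : clip α n = α / n := if_neg h
    have hn' : n ≠ 0 := (hα.trans (not_le.1 h)).ne'
    have e3 : κ * clip α n * n ^ 2 / (κ * α) = n := by rw [e2]; field_simp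
    rw [e3]
    have := Real.sqrt_nonneg (κ * clip α n * n ^ 2 / κ)
    linarith

/-! ### Design matrices and the elliptical potential -/

section Design

variable {ι : Type*} [Fintype ι] [DecidableEq ι]

/-- The weight `ω_s` of a round in the design matrices. -/
noncomputable def designWeight (lam κ α : ℝ) (Δ : ℕ → EuclideanSpace ℝ ι) (s : ℕ) : ℝ :=
  clip α (matNorm (designMatrix lam κ α Δ (s - 1))⁻¹ (Δ s))

/-- The relative increase of the determinant of the design matrix in a round. -/
noncomputable def designGain (lam κ α : ℝ) (Δ : ℕ → EuclideanSpace ℝ ι) (s : ℕ) : ℝ :=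
  κ * designWeight lam κ α Δ s * bil (designMatrix lam κ α Δ (s - 1))⁻¹ (Δ s) (Δ s)

variable {lam κ α : ℝ} {Δ : ℕ → EuclideanSpace ℝ ι}

theorem designMatrix_succ (t : ℕ) : designMatrix lam κ α Δ (t + 1) =
    rankOne (designMatrix lam κ α Δ t) (κ * designWeight lam κ α Δ (t + 1)) (Δ (t + 1)) := rfl

theorem designWeight_nonneg (hα : 0 < α) (s : ℕ) : 0 ≤ designWeight lam κ α Δ s :=
  clip_nonneg hα.le (matNorm_nonneg _ _)

theorem designWeight_le_one (hα : 0 < α) (s : ℕ) : designWeight lam κ α Δ s ≤ 1 :=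
  clip_le_one hα.le

theorem designMatrix_posDef (hl : 0 < lam) (hκ : 0 < κ) (hα : 0 < α) (t : ℕ) :
    (designMatrix lam κ α Δ t).PosDef := by
  induction t with
  | zero => exact Matrix.PosDef.smul Matrix.PosDef.one hl
  | succ t ih =>
    exact rankOne_posDef ih (mul_nonneg hκ.le (designWeight_nonneg hα _)) _

theorem designGain_nonneg (hl : 0 < lam) (hκ : 0 < κ) (hα : 0 < α) (s : ℕ) :
    0 ≤ designGain lam κ α Δ s :=
  mul_nonneg (mul_nonneg hκ.le (designWeight_nonneg hα _))
    (bil_inv_self_nonneg (designMatrix_posDef hl hκ hα _) _)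

/-- Adding observations only shrinks dual norms; hence the clipping in round `s`, done with
`V_{s-1}`, remains effective for every later `V_t`. -/
theorem matNorm_designMatrix_inv_anti (hl : 0 < lam) (hκ : 0 < κ) (hα : 0 < α)
    (u : EuclideanSpace ℝ ι) : Antitone fun t => matNorm (designMatrix lam κ α Δ t)⁻¹ u :=
  antitone_nat_of_succ_le fun t => matNorm_inv_rankOne_le (designMatrix_posDef hl hκ hα t)
    (mul_nonneg hκ.le (designWeight_nonneg hα _)) _ _

theorem matNorm_designMatrix_zero_inv (hl : 0 < lam) (u : EuclideanSpace ℝ ι) :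
    matNorm (designMatrix lam κ α Δ 0)⁻¹ u = ‖u‖ / Real.sqrt lam := by
  have h : (designMatrix lam κ α Δ 0)⁻¹ = lam⁻¹ • (1 : Matrix ι ι ℝ) := by
    refine Matrix.inv_eq_right_inv ?_
    simp [designMatrix, hl.ne']
  rw [matNorm_eq_sqrt_bil, h, bil, Matrix.smul_mulVec, Matrix.one_mulVec, dotProduct_smul,
    ← inner_eq_dotProduct, real_inner_self_eq_norm_sq, smul_eq_mul, Real.sqrt_mul (by positivity),
    Real.sqrt_sq (norm_nonneg _), Real.sqrt_inv]
  field_simp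

theorem matNorm_designMatrix_inv_le (hl : 0 < lam) (hκ : 0 < κ) (hα : 0 < α) (t : ℕ)
    (u : EuclideanSpace ℝ ι) : matNorm (designMatrix lam κ α Δ t)⁻¹ u ≤ ‖u‖ / Real.sqrt lam := by
  rw [← matNorm_designMatrix_zero_inv (κ := κ) (α := α) (Δ := Δ) hl]
  exact matNorm_designMatrix_inv_anti hl hκ hα u (Nat.zero_le t)

theorem bil_designMatrix (t : ℕ) (u : EuclideanSpace ℝ ι) :
    bil (designMatrix lam κ α Δ t) u u = lam * ‖u‖ ^ 2 +
      κ * ∑ s ∈ Finset.Icc 1 t, designWeight lam κ α Δ s * inner ℝ u (Δ s) ^ 2 := by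
  induction t with
  | zero =>
    simp [designMatrix, bil, Matrix.smul_mulVec, ← inner_eq_dotProduct]
  | succ t ih =>
    rw [designMatrix_succ, bil_rankOne, ih, Finset.sum_Icc_succ_top (by omega)]
    ring

theorem norm_le_matNorm_designMatrix (hl : 0 < lam) (hκ : 0 < κ) (hα : 0 < α) (t : ℕ)
    (u : EuclideanSpace ℝ ι) : Real.sqrt lam * ‖u‖ ≤ matNorm (designMatrix lam κ α Δ t) u := by
  rw [matNorm_eq_sqrt_bil, ← Real.sqrt_sq (norm_nonneg u), ← Real.sqrt_mul hl.le]
  refine Real.sqrt_le_sqrt ?_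
  rw [bil_designMatrix, le_add_iff_nonneg_right]
  exact mul_nonneg hκ.le (Finset.sum_nonneg fun s _ =>
    mul_nonneg (designWeight_nonneg hα s) (sq_nonneg _))

theorem sum_log_designGain (hl : 0 < lam) (hκ : 0 < κ) (hα : 0 < α) (t : ℕ) :
    ∑ s ∈ Finset.Icc 1 t, Real.log (1 + designGain lam κ α Δ s) =
      Real.log (designMatrix lam κ α Δ t).det - Fintype.card ι * Real.log lam := by
  induction t with
  | zero => simp [designMatrix, Real.log_pow]
  | succ t ih =>
    have h := designMatrix_posDef (Δ := Δ) hl hκ hα t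
    have hg := designGain_nonneg (Δ := Δ) hl hκ hα (t + 1)
    rw [Finset.sum_Icc_succ_top (by omega), ih, designMatrix_succ, det_rankOne h,
      Real.log_mul h.det_pos.ne' (by
        change 1 + designGain lam κ α Δ (t + 1) ≠ 0
        positivity)]
    change _ + Real.log (1 + κ * _ * _) = _
    simp only [Nat.add_sub_cancel]
    ring

/-- Each update adds at most `κ` to the trace, because weights and feature differences are at most
one. Through `log_det_le` this bounds the determinant. -/
theorem trace_designMatrix_le (hκ : 0 < κ) (hα : 0 < α) (t : ℕ)
    (hΔ : ∀ s ∈ Finset.Icc 1 t, ‖Δ s‖ ≤ 1) :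
    (designMatrix lam κ α Δ t).trace ≤ Fintype.card ι * lam + κ * t := by
  induction t with
  | zero => simp [designMatrix, Matrix.trace_smul, mul_comm]
  | succ t ih =>
    rw [designMatrix_succ, trace_rankOne]
    have h1 := ih fun s hs => hΔ s (by simp at hs ⊢; omega)
    have h2 : ‖Δ (t + 1)‖ ^ 2 ≤ 1 := pow_le_one₀ (norm_nonneg _) (hΔ _ (by simp))
    have h3 := designWeight_le_one (lam := lam) (κ := κ) (Δ := Δ) hα (t + 1)
    have h4 := designWeight_nonneg (lam := lam) (κ := κ) (Δ := Δ) hα (t + 1)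
    have h5 : designWeight lam κ α Δ (t + 1) * ‖Δ (t + 1)‖ ^ 2 ≤ 1 :=
      mul_le_one₀ h3 (sq_nonneg _) h2
    push_cast
    nlinarith

/-- The elliptical potential lemma. -/
theorem sum_log_designGain_le [Nonempty ι] (hl : 0 < lam) (hκ : 0 < κ) (hα : 0 < α) (t : ℕ)
    (hΔ : ∀ s ∈ Finset.Icc 1 t, ‖Δ s‖ ≤ 1) :
    ∑ s ∈ Finset.Icc 1 t, Real.log (1 + designGain lam κ α Δ s) ≤
      Fintype.card ι * Real.log (1 + κ * t / (Fintype.card ι * lam)) := by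
  have hd : (0 : ℝ) < Fintype.card ι := by exact_mod_cast Fintype.card_pos
  have hV := designMatrix_posDef (Δ := Δ) hl hκ hα t
  rw [sum_log_designGain hl hκ hα, sub_le_iff_le_add, ← mul_add, ← Real.log_mul (by positivity)
    hl.ne']
  refine (log_det_le hV).trans ?_
  have htr : 0 < (designMatrix lam κ α Δ t).trace := hV.trace_pos
  gcongr
  rw [div_le_iff₀ hd]
  refine (trace_designMatrix_le hκ hα t hΔ).trans (le_of_eq ?_)
  field_simp

theorem div_one_add_le_log {q : ℝ} (hq : 0 ≤ q) : q / (1 + q) ≤ Real.log (1 + q) := by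
  have h := Real.one_sub_inv_le_log_of_pos (show 0 < 1 + q by linarith)
  have e : 1 - (1 + q)⁻¹ = q / (1 + q) := by field_simp; ring
  linarith

/-- The ratios `q / (1 + q)` form the compensator of the self-normalized process. They are dominated
by `log (1 + q)` without a bound on `q`. -/
theorem sum_designGain_div_le [Nonempty ι] (hl : 0 < lam) (hκ : 0 < κ) (hα : 0 < α) (t : ℕ)
    (hΔ : ∀ s ∈ Finset.Icc 1 t, ‖Δ s‖ ≤ 1) :
    ∑ s ∈ Finset.Icc 1 t, designGain lam κ α Δ s / (1 + designGain lam κ α Δ s) ≤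
      Fintype.card ι * Real.log (1 + κ * t / (Fintype.card ι * lam)) :=
  (Finset.sum_le_sum fun s _ => div_one_add_le_log (designGain_nonneg hl hκ hα s)).trans
    (sum_log_designGain_le hl hκ hα t hΔ)

theorem designGain_le (hl : 0 < lam) (hκ : 0 < κ) (hα : 0 < α) {s : ℕ} (hs : ‖Δ s‖ ≤ 1) :
    designGain lam κ α Δ s ≤ κ / lam := by
  have hV := designMatrix_posDef (Δ := Δ) hl hκ hα (s - 1)
  have h1 := matNorm_designMatrix_inv_le (Δ := Δ) hl hκ hα (s - 1) (Δ s)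
  have h2 : bil (designMatrix lam κ α Δ (s - 1))⁻¹ (Δ s) (Δ s) ≤ 1 / lam := by
    rw [← sq_matNorm hV.inv.posSemidef]
    calc _ ≤ (‖Δ s‖ / Real.sqrt lam) ^ 2 := by
          gcongr
          exact matNorm_nonneg _ _
      _ = ‖Δ s‖ ^ 2 / lam := by rw [div_pow, Real.sq_sqrt hl.le]
      _ ≤ 1 / lam := by gcongr; exact pow_le_one₀ (norm_nonneg _) hs
  have h3 := designWeight_le_one (lam := lam) (κ := κ) (Δ := Δ) hα s
  have h4 := bil_inv_self_nonneg hV (Δ s)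
  calc designGain lam κ α Δ s ≤ κ * 1 * (1 / lam) := by
        rw [designGain]; gcongr
    _ = κ / lam := by ring

/-- From `q ≤ (1 + q) log (1 + q)` and `q ≤ κ / λ`; the latter is the price for summing the gains
themselves. -/
theorem sum_designGain_le [Nonempty ι] (hl : 0 < lam) (hκ : 0 < κ) (hα : 0 < α) (t : ℕ)
    (hΔ : ∀ s ∈ Finset.Icc 1 t, ‖Δ s‖ ≤ 1) :
    ∑ s ∈ Finset.Icc 1 t, designGain lam κ α Δ s ≤
      (1 + κ / lam) * (Fintype.card ι * Real.log (1 + κ * t / (Fintype.card ι * lam))) := by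
  refine le_trans ?_ (mul_le_mul_of_nonneg_left (sum_log_designGain_le hl hκ hα t hΔ)
    (by positivity))
  rw [Finset.mul_sum]
  refine Finset.sum_le_sum fun s hs => ?_
  have h0 := designGain_nonneg (Δ := Δ) hl hκ hα s
  have h1 := designGain_le hl hκ hα (hΔ s hs)
  have h2 := div_one_add_le_log h0
  rw [div_le_iff₀ (by linarith)] at h2
  refine h2.trans ?_
  rw [mul_comm]
  gcongr
  exact Real.log_nonneg (by linarith)

/-- Cauchy-Schwarz sums the square roots from `le_sqrt_add_clip`; the linear parts are summed
directly. The factor `1 / α` is where `C + 𝒟` enters the sum of the widths. -/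
theorem sum_matNorm_le (hl : 0 < lam) (hκ : 0 < κ) (hα : 0 < α) (t : ℕ) :
    ∑ s ∈ Finset.Icc 1 t, matNorm (designMatrix lam κ α Δ (s - 1))⁻¹ (Δ s) ≤
      Real.sqrt (t * ((∑ s ∈ Finset.Icc 1 t, designGain lam κ α Δ s) / κ)) +
        (∑ s ∈ Finset.Icc 1 t, designGain lam κ α Δ s) / (κ * α) := by
  have h : ∀ s, matNorm (designMatrix lam κ α Δ (s - 1))⁻¹ (Δ s) ≤
      Real.sqrt (designGain lam κ α Δ s / κ) + designGain lam κ α Δ s / (κ * α) := fun s => by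
    have hV := designMatrix_posDef (Δ := Δ) hl hκ hα (s - 1)
    rw [designGain, designWeight, ← sq_matNorm hV.inv.posSemidef]
    exact le_sqrt_add_clip hα hκ (matNorm_nonneg _ _)
  refine (Finset.sum_le_sum fun s _ => h s).trans ?_
  rw [Finset.sum_add_distrib, ← Finset.sum_div]
  gcongr
  refine Real.le_sqrt_of_sq_le ?_
  refine (sq_sum_le_card_mul_sum_sq).trans ?_
  rw [Nat.card_Icc, Nat.add_sub_cancel, Finset.sum_div]
  gcongr with s
  rw [Real.sq_sqrt (div_nonneg (designGain_nonneg hl hκ hα s) hκ.le)]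

end Design

/-! ### Deterministic error decomposition for the estimator -/

theorem hasDerivAt_expFamilyNLL {g : ℝ → ℝ} (hg : Continuous g) (o v : ℝ) :
    HasDerivAt (expFamilyNLL g o) (g v - o) v := by
  have h1 := intervalIntegral.integral_hasDerivAt_right (hg.intervalIntegrable 0 v)
    (hg.stronglyMeasurableAtFilter _ _) hg.continuousAt
  have h2 : HasDerivAt (fun v => o * v) o v := by simpa using (hasDerivAt_id v).const_mul o
  exact h1.sub h2

/-- A link with derivative at least `κ` is strongly monotone. -/
theorem mul_sq_le_of_le_deriv {g : ℝ → ℝ} {κ : ℝ} {J : Set ℝ} (hg : ContDiff ℝ 1 g)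
    (hJ : J.OrdConnected) (hd : ∀ u ∈ J, κ ≤ deriv g u) {x y : ℝ} (hx : x ∈ J) (hy : y ∈ J) :
    κ * (x - y) ^ 2 ≤ (g x - g y) * (x - y) := by
  have hdiff : Differentiable ℝ g := hg.differentiable (by norm_num)
  have key : ∀ {u v : ℝ}, u ∈ J → v ∈ J → u ≤ v → κ * (v - u) ≤ g v - g u := by
    intro u v hu hv huv
    refine hJ.convex.mul_sub_le_image_sub_of_le_deriv hdiff.continuous.continuousOn
      hdiff.differentiableOn (fun w hw => hd w (interior_subset hw)) u hu v hv huv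
  rcases le_total y x with h | h
  · have := key hy hx h
    nlinarith [sub_nonneg.2 h]
  · have := key hx hy h
    nlinarith [sub_nonneg.2 h]

namespace Run

variable {Ω : Type*} {dx dy K : ℕ} (R : Run Ω dx dy K)

/-- Rounds up to `t` whose outcome is not available when `Θ_t` is computed. -/
def pending (t : ℕ) (ω : Ω) : Finset ℕ := {s ∈ Finset.Icc 1 t | t ≤ s + R.τ s ω}

/-- The weighted noise vector `∑_{s ≤ t} ω_s (l_s - g ⟨Θ_*, Δz_s⟩) Δz_s`. -/
noncomputable def noiseSum (g : ℝ → ℝ) (θs : Feature dx dy) (lam κ α : ℝ) (t : ℕ) (ω : Ω) :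
    Feature dx dy :=
  ∑ s ∈ Finset.Icc 1 t,
    (R.weight lam κ α s ω * (R.l s ω - g (inner ℝ θs (R.dz s ω)))) • R.dz s ω

variable {R} {g : ℝ → ℝ} {lam κ α C : ℝ} {θs : Feature dx dy} {ω : Ω} {t : ℕ} {J : Set ℝ}

/-- The loss of round `t` uses `s + τ_s ≤ t - 1`, so the complement is `t ≤ s + τ_s`. In particular
round `t` itself is always pending, even with zero delay. -/
theorem sum_eq_hist_add_pending (ht : 1 ≤ t) (f : ℕ → ℝ) :
    ∑ s ∈ Finset.Icc 1 t, f s = ∑ s ∈ R.hist (t - 1) ω, f s + ∑ s ∈ R.pending t ω, f s := by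
  have h : R.hist (t - 1) ω = {s ∈ Finset.Icc 1 t | ¬ t ≤ s + R.τ s ω} := by
    ext s
    simp only [hist, Finset.mem_filter, Finset.mem_Icc]
    omega
  rw [h, pending, add_comm, Finset.sum_filter_add_sum_filter_not]

/-- The first order condition for the estimator. -/
theorem loss_stationary (hg : Continuous g) (hmin : IsMinOn (R.loss g lam κ α t ω) Set.univ
    (R.Θ t ω)) (v : Feature dx dy) :
    lam * inner ℝ v (R.Θ t ω) + ∑ s ∈ R.hist (t - 1) ω, R.weight lam κ α s ω *
      (g (inner ℝ (R.Θ t ω) (R.dz s ω)) - R.o s ω) * inner ℝ v (R.dz s ω) = 0 := by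
  set θ := R.Θ t ω
  have hline : HasDerivAt (fun ε : ℝ => θ + ε • v) v 0 := by
    simpa using ((hasDerivAt_id (0 : ℝ)).smul_const v).const_add θ
  have h1 : HasDerivAt (fun ε : ℝ => lam / 2 * ‖θ + ε • v‖ ^ 2) (lam * inner ℝ v θ) 0 := by
    have := (hline.norm_sq).const_mul (lam / 2)
    refine this.congr_deriv ?_
    rw [zero_smul, add_zero, real_inner_comm]
    ring
  have h2 : ∀ s ∈ R.hist (t - 1) ω, HasDerivAt (fun ε : ℝ => R.weight lam κ α s ω *
      expFamilyNLL g (R.o s ω) (inner ℝ (θ + ε • v) (R.dz s ω)))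
      (R.weight lam κ α s ω *
      (g (inner ℝ θ (R.dz s ω)) - R.o s ω) * inner ℝ v (R.dz s ω)) 0 := by
    intro s _
    have hi : HasDerivAt (fun ε : ℝ => (inner ℝ (θ + ε • v) (R.dz s ω) : ℝ))
        (inner ℝ v (R.dz s ω)) 0 := by
      simpa using hline.inner ℝ (hasDerivAt_const (0 : ℝ) (R.dz s ω))
    have hn := hasDerivAt_expFamilyNLL hg (R.o s ω) (inner ℝ (θ + (0 : ℝ) • v) (R.dz s ω))
    have := (hn.comp (0 : ℝ) hi).const_mul (R.weight lam κ α s ω)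
    refine this.congr_deriv ?_
    rw [zero_smul, add_zero]
    ring
  have h3 := h1.add (HasDerivAt.fun_sum h2)
  refine IsLocalMin.hasDerivAt_eq_zero (Filter.Eventually.of_forall fun ε => ?_) h3
  have := hmin (Set.mem_univ (θ + ε • v))
  simp only [Set.mem_ofPred_eq, loss] at this
  simpa [loss] using this

/-- Duality leaves the weight times the dual norm of `Δz_s`. Clipping bounds it by `α`, while weight
at most one and `V_t ≥ λ I` bound it by `1 / √λ`. -/
theorem weight_mul_abs_inner_le (hl : 0 < lam) (hκ : 0 < κ) (hα : 0 < α) {s : ℕ} (hs : s ≤ t)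
    (hΔ : ‖R.dz s ω‖ ≤ 1) (D : Feature dx dy) :
    R.weight lam κ α s ω * |(inner ℝ D (R.dz s ω) : ℝ)| ≤
      matNorm (R.V lam κ α t ω) D * min α (1 / Real.sqrt lam) := by
  have hV := designMatrix_posDef (Δ := fun s => R.dz s ω) hl hκ hα t
  have h1 := abs_inner_le_matNorm hV D (R.dz s ω)
  have h2 := matNorm_designMatrix_inv_anti (Δ := fun s => R.dz s ω) hl hκ hα (R.dz s ω)
    (show s - 1 ≤ t by omega)
  have h3 := matNorm_designMatrix_inv_le (Δ := fun s => R.dz s ω) hl hκ hα t (R.dz s ω)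
  have hw0 := designWeight_nonneg (lam := lam) (κ := κ) (Δ := fun s => R.dz s ω) hα s
  have hw1 := designWeight_le_one (lam := lam) (κ := κ) (Δ := fun s => R.dz s ω) hα s
  have hw2 : designWeight lam κ α (fun s => R.dz s ω) s *
      matNorm (designMatrix lam κ α (fun s => R.dz s ω) (s - 1))⁻¹ (R.dz s ω) ≤ α :=
    clip_mul_le hα.le
  change designWeight lam κ α (fun s => R.dz s ω) s * _ ≤ matNorm (designMatrix _ _ _ _ t) D * _
  set w := designWeight lam κ α (fun s => R.dz s ω) s
  set N := matNorm (designMatrix lam κ α (fun s => R.dz s ω) t) D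
  have hN : 0 ≤ N := matNorm_nonneg _ _
  calc w * |(inner ℝ D (R.dz s ω) : ℝ)| ≤ w * (N * matNorm (designMatrix lam κ α (fun s => R.dz s ω) t)⁻¹ (R.dz s ω)) := mul_le_mul_of_nonneg_left h1 hw0
    _ = N * (w * matNorm (designMatrix lam κ α (fun s => R.dz s ω) t)⁻¹ (R.dz s ω)) := by ring
    _ ≤ N * min α (1 / Real.sqrt lam) := by
        refine mul_le_mul_of_nonneg_left (le_min ?_ ?_) hN
        · exact (mul_le_mul_of_nonneg_left h2 hw0).trans hw2
        · refine (mul_le_of_le_one_left (matNorm_nonneg _ _) hw1).trans (h3.trans ?_)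
          gcongr

/-- The estimation error in terms of the noise, the corruption and the number of missing
outcomes. -/
theorem matNorm_estimate_sub_le (hl : 0 < lam) (hκ : 0 < κ) (hα : 0 < α)
    (hg : ContDiff ℝ 1 g) (hrange : ∀ u, g u ∈ Set.Icc (0 : ℝ) 1) (hJ : J.OrdConnected)
    (hd : ∀ u ∈ J, κ ≤ deriv g u) (ht : 1 ≤ t)
    (hmin : IsMinOn (R.loss g lam κ α t ω) Set.univ (R.Θ t ω))
    (htrue : ∀ s ∈ Finset.Icc 1 t, (inner ℝ θs (R.dz s ω) : ℝ) ∈ J)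
    (hest : ∀ s ∈ Finset.Icc 1 t, (inner ℝ (R.Θ t ω) (R.dz s ω) : ℝ) ∈ J)
    (hΔ : ∀ s ∈ Finset.Icc 1 t, ‖R.dz s ω‖ ≤ 1)
    (hbin : ∀ s ∈ Finset.Icc 1 t, R.l s ω = 0 ∨ R.l s ω = 1)
    (hC : ∑ s ∈ Finset.Icc 1 t, |R.l s ω - R.o s ω| ≤ C) :
    matNorm (R.V lam κ α t ω) (R.Θ t ω - θs) ≤ Real.sqrt lam * ‖θs‖ +
      matNorm (R.V lam κ α t ω)⁻¹ (R.noiseSum g θs lam κ α t ω) + α * C +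
      (R.pending t ω).card * min α (1 / Real.sqrt lam) := by
  have hV : (R.V lam κ α t ω).PosDef := designMatrix_posDef hl hκ hα t
  set θ := R.Θ t ω with hθ
  set D := θ - θs with hD
  set N := matNorm (R.V lam κ α t ω) D with hN
  have hN0 : 0 ≤ N := matNorm_nonneg _ _
  set w := fun s => R.weight lam κ α s ω with hw
  set A := fun s => g (inner ℝ θ (R.dz s ω)) with hA
  set B := fun s => g (inner ℝ θs (R.dz s ω)) with hB
  set e := fun s => (inner ℝ D (R.dz s ω) : ℝ) with he
  have hw0 : ∀ s, 0 ≤ w s := fun s => designWeight_nonneg hα s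
  have hfoc := loss_stationary hg.continuous hmin D
  -- Strong monotonicity of `g` pays for the factor `κ` in the design matrix.
  have hsq : N ^ 2 ≤ lam * inner ℝ D D + ∑ s ∈ Finset.Icc 1 t, w s * (A s - B s) * e s := by
    rw [hN, sq_matNorm hV.posSemidef, Run.V, bil_designMatrix, real_inner_self_eq_norm_sq,
      Finset.mul_sum]
    refine add_le_add le_rfl (Finset.sum_le_sum fun s hs => ?_)
    have h1 := mul_sq_le_of_le_deriv hg hJ hd (hest s hs) (htrue s hs)
    have h2 : (inner ℝ θ (R.dz s ω) : ℝ) - inner ℝ θs (R.dz s ω) = e s := by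
      simp only [he, hD, inner_sub_left]
    rw [h2] at h1
    calc κ * (w s * e s ^ 2) = w s * (κ * e s ^ 2) := by ring
      _ ≤ w s * ((A s - B s) * e s) := mul_le_mul_of_nonneg_left h1 (hw0 s)
      _ = w s * (A s - B s) * e s := by ring
  -- Stationarity in the direction `D` removes the fitted residuals of the arrived rounds. For
  -- pending rounds the true outcome `l s` is inserted, which completes the noise sum to all rounds
  -- up to `t`.
  have hsplit : lam * inner ℝ D D + ∑ s ∈ Finset.Icc 1 t, w s * (A s - B s) * e s =
      -(lam * inner ℝ D θs) + ∑ s ∈ R.hist (t - 1) ω, w s * (R.o s ω - R.l s ω) * e s +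
      ∑ s ∈ Finset.Icc 1 t, w s * (R.l s ω - B s) * e s +
      ∑ s ∈ R.pending t ω, w s * (A s - R.l s ω) * e s := by
    have h1 : (inner ℝ D D : ℝ) = inner ℝ D θ - inner ℝ D θs := by rw [← inner_sub_right]
    have h2 : ∑ s ∈ R.hist (t - 1) ω, w s * (A s - R.o s ω) * e s = -(lam * inner ℝ D θ) := by
      linarith
    rw [sum_eq_hist_add_pending (R := R) (ω := ω) ht,
      sum_eq_hist_add_pending (R := R) (ω := ω) ht (fun s => w s * (R.l s ω - B s) * e s), h1]
    have h3 : ∑ s ∈ R.hist (t - 1) ω, w s * (A s - B s) * e s =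
        ∑ s ∈ R.hist (t - 1) ω, w s * (A s - R.o s ω) * e s +
        ∑ s ∈ R.hist (t - 1) ω, w s * (R.o s ω - R.l s ω) * e s +
        ∑ s ∈ R.hist (t - 1) ω, w s * (R.l s ω - B s) * e s := by
      rw [← Finset.sum_add_distrib, ← Finset.sum_add_distrib]
      exact Finset.sum_congr rfl fun s _ => by ring
    have h4 : ∑ s ∈ R.pending t ω, w s * (A s - B s) * e s =
        ∑ s ∈ R.pending t ω, w s * (A s - R.l s ω) * e s +
        ∑ s ∈ R.pending t ω, w s * (R.l s ω - B s) * e s := by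
      rw [← Finset.sum_add_distrib]
      exact Finset.sum_congr rfl fun s _ => by ring
    rw [h3, h4, h2]
    ring
  have hmem : ∀ s ∈ R.hist (t - 1) ω, s ∈ Finset.Icc 1 t := fun s hs => by
    simp only [hist, Finset.mem_filter, Finset.mem_Icc] at hs ⊢
    omega
  have hwe : ∀ s ∈ Finset.Icc 1 t, w s * |e s| ≤ N * min α (1 / Real.sqrt lam) := fun s hs =>
    weight_mul_abs_inner_le hl hκ hα (Finset.mem_Icc.1 hs).2 (hΔ s hs) D
  have hterm : ∀ s ∈ Finset.Icc 1 t, ∀ c : ℝ,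
      w s * c * e s ≤ |c| * (N * min α (1 / Real.sqrt lam)) := by
    intro s hs c
    calc w s * c * e s ≤ |w s * c * e s| := le_abs_self _
      _ = |c| * (w s * |e s|) := by rw [abs_mul, abs_mul, abs_of_nonneg (hw0 s)]; ring
      _ ≤ _ := mul_le_mul_of_nonneg_left (hwe s hs) (abs_nonneg c)
  have b1 : -(lam * inner ℝ D θs) ≤ N * (Real.sqrt lam * ‖θs‖) := by
    have h1 : -(inner ℝ D θs : ℝ) ≤ ‖D‖ * ‖θs‖ :=
      (neg_le_abs _).trans (abs_real_inner_le_norm _ _)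
    have h2 : Real.sqrt lam * ‖D‖ ≤ N := norm_le_matNorm_designMatrix hl hκ hα t D
    calc -(lam * inner ℝ D θs) = lam * -(inner ℝ D θs : ℝ) := by ring
      _ ≤ lam * (‖D‖ * ‖θs‖) := mul_le_mul_of_nonneg_left h1 hl.le
      _ = (Real.sqrt lam * ‖D‖) * (Real.sqrt lam * ‖θs‖) := by
          nth_rewrite 1 [← Real.mul_self_sqrt hl.le]; ring
      _ ≤ _ := by gcongr
  have b2 : ∑ s ∈ R.hist (t - 1) ω, w s * (R.o s ω - R.l s ω) * e s ≤ N * (α * C) := by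
    calc _ ≤ ∑ s ∈ R.hist (t - 1) ω, |R.l s ω - R.o s ω| * (N * α) := by
          refine Finset.sum_le_sum fun s hs => (hterm s (hmem s hs) _).trans ?_
          rw [abs_sub_comm]
          gcongr
          exact min_le_left _ _
      _ ≤ ∑ s ∈ Finset.Icc 1 t, |R.l s ω - R.o s ω| * (N * α) :=
          Finset.sum_le_sum_of_subset_of_nonneg hmem fun s _ _ => by positivity
      _ = (∑ s ∈ Finset.Icc 1 t, |R.l s ω - R.o s ω|) * (N * α) := by rw [Finset.sum_mul]
      _ ≤ C * (N * α) := by gcongr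
      _ = _ := by ring
  have b3 : ∑ s ∈ Finset.Icc 1 t, w s * (R.l s ω - B s) * e s ≤
      N * matNorm (R.V lam κ α t ω)⁻¹ (R.noiseSum g θs lam κ α t ω) := by
    refine le_trans (le_of_eq ?_) (inner_le_matNorm hV D (R.noiseSum g θs lam κ α t ω))
    rw [noiseSum, inner_sum]
    exact Finset.sum_congr rfl fun s _ => by rw [real_inner_smul_right]
  have b4 : ∑ s ∈ R.pending t ω, w s * (A s - R.l s ω) * e s ≤
      N * ((R.pending t ω).card * min α (1 / Real.sqrt lam)) := by
    calc _ ≤ ∑ s ∈ R.pending t ω, N * min α (1 / Real.sqrt lam) := by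
          refine Finset.sum_le_sum fun s hs => ?_
          have hs' := (Finset.mem_filter.1 hs).1
          refine (hterm s hs' _).trans (mul_le_of_le_one_left (by positivity) ?_)
          obtain ⟨h0, h1⟩ := hrange (inner ℝ θ (R.dz s ω))
          rw [abs_le]
          rcases hbin s hs' with h | h <;> rw [h, hA] <;> constructor <;> dsimp only <;> linarith
      _ = _ := by rw [Finset.sum_const, nsmul_eq_mul]; ring
  -- All four bounds carry a factor `N`, which can be cancelled unless it vanishes.
  by_cases h0 : N = 0
  · rw [h0]
    have := matNorm_nonneg (R.V lam κ α t ω)⁻¹ (R.noiseSum g θs lam κ α t ω)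
    have hC0 : 0 ≤ C := (Finset.sum_nonneg fun s _ => abs_nonneg _).trans hC
    positivity
  · have hNpos : 0 < N := lt_of_le_of_ne hN0 (Ne.symm h0)
    refine le_of_mul_le_mul_left ?_ hNpos
    rw [hsplit] at hsq
    nlinarith

end Run

/-! ### Measurability of design matrices, weights and gains -/

section Measurability

variable {Ω : Type*} {mΩ : MeasurableSpace Ω} {ι : Type*}

theorem measurable_coord {v : Ω → EuclideanSpace ℝ ι} (hv : Measurable v) (i : ι) :
    Measurable fun ω => v ω i :=
  (measurable_pi_apply i).comp ((WithLp.measurable_ofLp 2 _).comp hv)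

theorem measurable_joint {dx dy : ℕ} {x : Ω → Vec dx} {y : Ω → Vec dy} (hx : Measurable x)
    (hy : Measurable y) : Measurable fun ω => joint (x ω) (y ω) := by
  refine (WithLp.measurable_toLp 2 _).comp (measurable_pi_lambda _ fun i => ?_)
  cases i with
  | inl i => exact (measurable_pi_apply i).comp ((WithLp.measurable_ofLp 2 _).comp hx)
  | inr j => exact (measurable_pi_apply j).comp ((WithLp.measurable_ofLp 2 _).comp hy)

theorem measurable_select {K : ℕ} {E : Type*} [MeasurableSpace E] {f : Fin K → Ω → E}
    (hf : ∀ k, Measurable (f k)) {a : Ω → Fin K} (ha : Measurable a) :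
    Measurable fun ω => f (a ω) ω := by
  have h : Measurable fun p : Fin K × Ω => f p.1 p.2 := measurable_from_prod_countable_right hf
  exact h.comp (ha.prodMk measurable_id)

variable [Fintype ι]

theorem measurable_bil {M : Ω → Matrix ι ι ℝ} (hM : ∀ i j, Measurable fun ω => M ω i j)
    {u v : Ω → EuclideanSpace ℝ ι} (hu : Measurable u) (hv : Measurable v) :
    Measurable fun ω => bil (M ω) (u ω) (v ω) := by
  simp only [bil, dotProduct, Matrix.mulVec]
  exact Finset.measurable_sum _ fun i _ => (measurable_coord hu i).mul
    (Finset.measurable_sum _ fun j _ => (hM i j).mul (measurable_coord hv j))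

theorem measurable_act {M : Ω → Matrix ι ι ℝ} (hM : ∀ i j, Measurable fun ω => M ω i j)
    {v : Ω → EuclideanSpace ℝ ι} (hv : Measurable v) :
    Measurable fun ω => act (M ω) (v ω) := by
  refine (WithLp.measurable_toLp 2 _).comp (measurable_pi_lambda _ fun i => ?_)
  simp only [dotProduct, Matrix.mulVec]
  exact Finset.measurable_sum _ fun j _ => (hM i j).mul (measurable_coord hv j)

theorem measurable_matNorm {M : Ω → Matrix ι ι ℝ} (hM : ∀ i j, Measurable fun ω => M ω i j)
    {u : Ω → EuclideanSpace ℝ ι} (hu : Measurable u) :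
    Measurable fun ω => matNorm (M ω) (u ω) := (measurable_bil hM hu hu).sqrt

variable [DecidableEq ι]

theorem measurable_matrix_det {M : Ω → Matrix ι ι ℝ} (hM : ∀ i j, Measurable fun ω => M ω i j) :
    Measurable fun ω => (M ω).det := by
  simp only [Matrix.det_apply']
  exact Finset.measurable_sum _ fun σ _ => measurable_const.mul
    (Finset.measurable_prod _ fun i _ => hM _ _)

theorem measurable_matrix_inv {M : Ω → Matrix ι ι ℝ} (hM : ∀ i j, Measurable fun ω => M ω i j)
    (i j : ι) : Measurable fun ω => (M ω)⁻¹ i j := by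
  simp only [Matrix.inv_def, Matrix.smul_apply, smul_eq_mul, Ring.inverse_eq_inv',
    Matrix.adjugate_apply]
  refine (measurable_matrix_det hM).inv.mul (measurable_matrix_det fun i' j' => ?_)
  simp only [Matrix.updateRow_apply]
  split_ifs
  · exact measurable_const
  · exact hM i' j'

theorem measurable_clip (α : ℝ) : Measurable (clip α) :=
  Measurable.ite measurableSet_Iic measurable_const (measurable_const.div measurable_id)

theorem measurable_designMatrix (lam κ α : ℝ) {Δ : ℕ → Ω → EuclideanSpace ℝ ι} (t : ℕ)
    (hΔ : ∀ s ∈ Finset.Icc 1 t, Measurable (Δ s)) (i j : ι) :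
    Measurable fun ω => designMatrix lam κ α (fun s => Δ s ω) t i j := by
  induction t generalizing i j with
  | zero => exact measurable_const
  | succ t ih =>
    have ih' := ih fun s hs => hΔ s (by simp at hs ⊢; omega)
    have hΔ' := hΔ (t + 1) (by simp)
    refine (ih' i j).add ((measurable_const.mul ((measurable_clip α).comp
      (measurable_matNorm (measurable_matrix_inv ih') hΔ'))).mul ?_)
    simp only [Matrix.vecMulVec_apply]
    exact (measurable_coord hΔ' i).mul (measurable_coord hΔ' j)

theorem measurable_designWeight (lam κ α : ℝ) {Δ : ℕ → Ω → EuclideanSpace ℝ ι} (t : ℕ)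
    (hΔ : ∀ s ∈ Finset.Icc 1 t, Measurable (Δ s)) {s : ℕ} (hs : s ∈ Finset.Icc 1 t) :
    Measurable fun ω => designWeight lam κ α (fun s => Δ s ω) s :=
  (measurable_clip α).comp (measurable_matNorm (measurable_matrix_inv
    (measurable_designMatrix lam κ α (s - 1) fun r hr => hΔ r (by
      simp at hs hr ⊢; omega))) (hΔ s hs))

theorem measurable_designGain (lam κ α : ℝ) {Δ : ℕ → Ω → EuclideanSpace ℝ ι} (t : ℕ)
    (hΔ : ∀ s ∈ Finset.Icc 1 t, Measurable (Δ s)) {s : ℕ} (hs : s ∈ Finset.Icc 1 t) :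
    Measurable fun ω => designGain lam κ α (fun s => Δ s ω) s :=
  (measurable_const.mul (measurable_designWeight lam κ α t hΔ hs)).mul
    (measurable_bil (measurable_matrix_inv (measurable_designMatrix lam κ α (s - 1) fun r hr =>
      hΔ r (by simp at hs hr ⊢; omega))) (hΔ s hs) (hΔ s hs))

end Measurability

/-! ### Exponential moments of bounded conditionally centred noise -/

section ExpMoment

variable {Ω : Type*} {m mΩ : MeasurableSpace Ω} {P : Measure Ω} [IsProbabilityMeasure P]

/-- Convexity of the exponential function on `[-1, 1]`. -/
theorem exp_mul_le_cosh_add {u η : ℝ} (hη : |η| ≤ 1) :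
    Real.exp (u * η) ≤ Real.cosh u + Real.sinh u * η := by
  obtain ⟨h1, h2⟩ := abs_le.1 hη
  have h := convexOn_exp.2 (Set.mem_univ u) (Set.mem_univ (-u))
    (show 0 ≤ (1 + η) / 2 by linarith) (show 0 ≤ (1 - η) / 2 by linarith) (by ring)
  simp only [smul_eq_mul] at h
  have e : (1 + η) / 2 * u + (1 - η) / 2 * -u = u * η := by ring
  rw [e] at h
  rw [Real.cosh_eq, Real.sinh_eq]
  linarith

theorem integrable_of_ae_bound {f : Ω → ℝ} (hf : Measurable f) {B : ℝ}
    (hB : ∀ᵐ ω ∂P, |f ω| ≤ B) : Integrable f P :=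
  Integrable.of_bound hf.aestronglyMeasurable B hB

/-- Conditionally centred noise with values in `[-1, 1]` is conditionally sub-Gaussian. -/
theorem integral_mul_exp_le (hm : m ≤ mΩ) {F u η : Ω → ℝ} (hF : Measurable[m] F)
    (hu : Measurable[m] u) (hη : Measurable η) (hF0 : ∀ ω, 0 ≤ F ω) {B b : ℝ}
    (hFB : ∀ᵐ ω ∂P, F ω ≤ B) (hub : ∀ᵐ ω ∂P, |u ω| ≤ b) (hη1 : ∀ᵐ ω ∂P, |η ω| ≤ 1)
    (hcond : P[η | m] =ᵐ[P] 0) :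
    ∫ ω, F ω * Real.exp (u ω * η ω) ∂P ≤ ∫ ω, F ω * Real.exp (u ω ^ 2 / 2) ∂P := by
  have hF' := hF.mono hm le_rfl
  have hu' := hu.mono hm le_rfl
  have hFsinh : Measurable[m] fun ω => F ω * Real.sinh (u ω) :=
    hF.mul (Real.measurable_sinh.comp hu)
  have hcoshb : ∀ᵐ ω ∂P, |F ω * Real.cosh (u ω)| ≤ B * Real.cosh b := by
    filter_upwards [hFB, hub] with ω h1 h2
    rw [abs_mul, abs_of_nonneg (hF0 ω), abs_of_pos (Real.cosh_pos _)]
    gcongr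
    · exact (hF0 ω).trans h1
    · rw [Real.cosh_le_cosh]; exact h2.trans (le_abs_self b)
  have hsinhb : ∀ᵐ ω ∂P, |F ω * Real.sinh (u ω)| ≤ B * Real.cosh b := by
    filter_upwards [hcoshb] with ω h1
    refine le_trans ?_ h1
    rw [abs_mul, abs_mul]
    refine mul_le_mul_of_nonneg_left ?_ (abs_nonneg _)
    rw [Real.abs_sinh, abs_of_pos (Real.cosh_pos _), ← Real.cosh_abs]
    exact (Real.sinh_lt_cosh _).le
  have hη_int : Integrable η P := integrable_of_ae_bound hη hη1
  have hcosh_int : Integrable (fun ω => F ω * Real.cosh (u ω)) P :=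
    integrable_of_ae_bound (hF'.mul (Real.measurable_cosh.comp hu')) hcoshb
  have hprod_int : Integrable (fun ω => F ω * Real.sinh (u ω) * η ω) P := by
    refine integrable_of_ae_bound ((hFsinh.mono hm le_rfl).mul hη) (B := B * Real.cosh b) ?_
    filter_upwards [hsinhb, hη1] with ω h1 h2
    rw [abs_mul]
    exact (mul_le_of_le_one_right (abs_nonneg _) h2).trans h1
  -- `F * sinh u` is known given `m`, so it can be pulled out of the conditional expectation of `η`.
  -- What remains is `cosh u ≤ exp (u ^ 2 / 2)`.
  have hzero : ∫ ω, F ω * Real.sinh (u ω) * η ω ∂P = 0 := by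
    have h := condExp_mul_of_stronglyMeasurable_left (μ := P) hFsinh.stronglyMeasurable hprod_int
      hη_int
    rw [← integral_condExp hm]
    refine (integral_congr_ae h).trans ?_
    rw [integral_eq_zero_of_ae]
    filter_upwards [hcond] with ω h1
    simp [h1]
  calc ∫ ω, F ω * Real.exp (u ω * η ω) ∂P
      ≤ ∫ ω, (F ω * Real.cosh (u ω) + F ω * Real.sinh (u ω) * η ω) ∂P := by
        refine integral_mono_of_nonneg (Filter.Eventually.of_forall fun ω =>
          mul_nonneg (hF0 ω) (Real.exp_pos _).le) (hcosh_int.add hprod_int) ?_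
        filter_upwards [hη1] with ω h1
        have := mul_le_mul_of_nonneg_left (exp_mul_le_cosh_add (u := u ω) h1) (hF0 ω)
        linarith
    _ = ∫ ω, F ω * Real.cosh (u ω) ∂P := by
        rw [integral_add hcosh_int hprod_int, hzero, add_zero]
    _ ≤ _ := by
        refine integral_mono_of_nonneg (Filter.Eventually.of_forall fun ω =>
          mul_nonneg (hF0 ω) (Real.cosh_pos _).le) ?_ (Filter.Eventually.of_forall fun ω =>
          mul_le_mul_of_nonneg_left (Real.cosh_le_exp_half_sq _) (hF0 ω))
        refine integrable_of_ae_bound (hF'.mul (Real.measurable_exp.comp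
          ((hu'.pow_const 2).div_const 2))) (B := B * Real.exp (b ^ 2 / 2)) ?_
        filter_upwards [hFB, hub] with ω h1 h2
        rw [abs_mul, abs_of_nonneg (hF0 ω), Real.abs_exp]
        refine mul_le_mul h1 (Real.exp_le_exp.2 ?_) (Real.exp_pos _).le ((hF0 ω).trans h1)
        have := sq_le_sq' (abs_le.1 h2).1 (abs_le.1 h2).2
        linarith

/-- Markov's inequality for an exponential moment. -/
theorem measure_lt_le_of_integral_exp {f : Ω → ℝ} {b x ε : ℝ}
    (hint : Integrable (fun ω => Real.exp (f ω)) P) (h : ∫ ω, Real.exp (f ω) ∂P ≤ Real.exp b)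
    (hε : 0 < ε) (hx : b + Real.log (1 / ε) ≤ x) :
    P {ω | x < f ω} ≤ ENNReal.ofReal ε := by
  have hsub : {ω | x < f ω} ⊆ {ω | Real.exp x ≤ Real.exp (f ω)} := fun ω hω =>
    Real.exp_le_exp.2 (le_of_lt hω)
  have hM := mul_meas_ge_le_integral_of_nonneg (μ := P)
    (Filter.Eventually.of_forall fun ω => (Real.exp_pos (f ω)).le) hint (Real.exp x)
  refine (measure_mono hsub).trans ?_
  rw [← ofReal_measureReal]
  refine ENNReal.ofReal_le_ofReal ?_
  have h1 : Real.exp b * (1 / ε) ≤ Real.exp x := by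
    rw [← Real.exp_log (show 0 < 1 / ε by positivity), ← Real.exp_add]
    exact Real.exp_le_exp.2 hx
  have h2 : Real.exp x * P.real {ω | Real.exp x ≤ Real.exp (f ω)} ≤ Real.exp b := hM.trans h
  have h3 : Real.exp b ≤ ε * Real.exp x := by
    rw [mul_one_div, div_le_iff₀ hε] at h1; linarith
  exact le_of_mul_le_mul_left (by linarith) (Real.exp_pos x)

end ExpMoment

/-! ### Conditional expectations of the features -/

theorem joint_add {dx dy : ℕ} (x x' : Vec dx) (y y' : Vec dy) :
    joint (x + x') (y + y') = joint x y + joint x' y' := by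
  ext i; cases i <;> simp [joint]

theorem joint_smul {dx dy : ℕ} (c : ℝ) (x : Vec dx) (y : Vec dy) :
    joint (c • x) (c • y) = c • joint x y := by
  ext i; cases i <;> simp [joint]

theorem norm_joint_sq {dx dy : ℕ} (x : Vec dx) (y : Vec dy) :
    ‖joint x y‖ ^ 2 = ‖x‖ ^ 2 + ‖y‖ ^ 2 := by
  simp [EuclideanSpace.norm_sq_eq, joint]

theorem norm_joint_zero {dx dy : ℕ} (y : Vec dy) : ‖joint (0 : Vec dx) y‖ = ‖y‖ := by
  have h := norm_joint_sq (0 : Vec dx) y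
  rw [norm_zero, zero_pow two_ne_zero, zero_add] at h
  exact (sq_eq_sq₀ (norm_nonneg _) (norm_nonneg _)).1 h

/-- The embedding `y ↦ (0, y)`. -/
noncomputable def embedPost (dx dy : ℕ) : Vec dy →L[ℝ] Feature dx dy :=
  LinearMap.mkContinuous
    { toFun := fun y => joint 0 y
      map_add' := fun y y' => by rw [← joint_add, add_zero]
      map_smul' := fun c y => by rw [RingHom.id_apply, ← joint_smul, smul_zero] } 1
    fun y => by
      rw [one_mul]
      exact (norm_joint_zero y).le

namespace Run

variable {Ω : Type*} {dx dy K : ℕ} {R : Run Ω dx dy K}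

/-- Noise-free feature differences of the arms played. -/
noncomputable def dzstar (R : Run Ω dx dy K) (φ : Vec dx → Vec dy) (t : ℕ) (ω : Ω) :
    Feature dx dy := R.zstar φ t (R.a t ω) ω - R.zstar φ t (R.b t ω) ω

variable [mΩ : MeasurableSpace Ω] {P : Measure Ω} {g : ℝ → ℝ} {φ : Vec dx → Vec dy}
  {θs : Feature dx dy} {T t : ℕ} {pre mid : ℕ → MeasurableSpace Ω}

theorem BoundedFeatures.ae_norm_dz_le (hB : R.BoundedFeatures P T) :
    ∀ᵐ ω ∂P, ∀ t ∈ Finset.Icc 1 T, ‖R.dz t ω‖ ≤ 1 := by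
  filter_upwards [hB] with ω h t ht
  refine (norm_sub_le _ _).trans ?_
  linarith [h t ht (R.a t ω), h t ht (R.b t ω)]

namespace IsEnvironment

variable (hE : R.IsEnvironment P g φ θs T pre mid)

include hE

theorem pre_mono : Monotone pre :=
  monotone_nat_of_le_succ fun t => (hE.pre_le_mid t).trans (hE.mid_le_pre t)

theorem mid_le_of_lt {s : ℕ} (h : s < t) : mid s ≤ pre t :=
  (hE.mid_le_pre s).trans (hE.pre_mono h)

theorem mid_le (t : ℕ) : mid t ≤ mΩ := (hE.mid_le_pre t).trans (hE.pre_le _)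

theorem measurable_z (ht : t ∈ Finset.Icc 1 T) (k : Fin K) : Measurable[mid t] (R.z t k) :=
  measurable_joint ((hE.measurable_x t ht k).mono (hE.pre_le_mid t) le_rfl)
    (hE.measurable_y t ht k)

theorem measurable_dz (ht : t ∈ Finset.Icc 1 T) : Measurable[mid t] (R.dz t) :=
  (measurable_select (hE.measurable_z ht)
    ((hE.measurable_a t ht).mono (hE.pre_le_mid t) le_rfl)).sub
  (measurable_select (hE.measurable_z ht)
    ((hE.measurable_b t ht).mono (hE.pre_le_mid t) le_rfl))

theorem measurable_zstar (hφ : Measurable φ) (ht : t ∈ Finset.Icc 1 T) (k : Fin K) :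
    Measurable[pre t] (R.zstar φ t k) :=
  measurable_joint (hE.measurable_x t ht k) (hφ.comp (hE.measurable_x t ht k))

theorem measurable_dzstar (hφ : Measurable φ) (ht : t ∈ Finset.Icc 1 T) :
    Measurable[pre t] (R.dzstar φ t) :=
  (measurable_select (hE.measurable_zstar hφ ht) (hE.measurable_a t ht)).sub
  (measurable_select (hE.measurable_zstar hφ ht) (hE.measurable_b t ht))

variable [IsProbabilityMeasure P]

theorem condExp_noise (hg : Continuous g) (hrange : ∀ u, g u ∈ Set.Icc (0 : ℝ) 1)
    (ht : t ∈ Finset.Icc 1 T) :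
    P[fun ω => R.l t ω - g (inner ℝ θs (R.dz t ω)) | mid t] =ᵐ[P] 0 := by
  have hgm : Measurable[mid t] fun ω => g (inner ℝ θs (R.dz t ω)) :=
    hg.measurable.comp (Measurable.inner measurable_const (hE.measurable_dz ht))
  have hl : Measurable (R.l t) := (hE.measurable_l t ht).mono (hE.pre_le _) le_rfl
  have h1 : Integrable (R.l t) P := Integrable.of_bound hl.aestronglyMeasurable 1
    (Filter.Eventually.of_forall fun ω => by
      rcases hE.binary_l t ht ω with h | h <;> simp [h])
  have h2 : Integrable (fun ω => g (inner ℝ θs (R.dz t ω))) P :=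
    Integrable.of_bound (hgm.mono (hE.mid_le t) le_rfl).aestronglyMeasurable 1
    (Filter.Eventually.of_forall fun ω => by
      rw [Real.norm_eq_abs, abs_of_nonneg (hrange _).1]; exact (hrange _).2)
  refine (condExp_sub h1 h2 _).trans ?_
  have h3 := condExp_of_stronglyMeasurable (hE.mid_le t) hgm.stronglyMeasurable h2
  filter_upwards [hE.condExp_l t ht] with ω h4
  rw [Pi.sub_apply, h3, h4, sub_self]
  rfl

variable (hB : R.BoundedFeatures P T)

include hB

theorem integrable_z (ht : t ∈ Finset.Icc 1 T) (k : Fin K) : Integrable (R.z t k) P :=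
  Integrable.of_bound ((hE.measurable_z ht k).mono (hE.mid_le t) le_rfl).aestronglyMeasurable
    (1 / 2) (by filter_upwards [hB] with ω h using h t ht k)

/-- Write `z = (x, 0) + (0, y)`. The first summand is known before the round, and the continuous
linear map `embedPost` commutes with conditional expectation on the second. -/
theorem condExp_z (ht : t ∈ Finset.Icc 1 T) (k : Fin K) :
    P[R.z t k | pre t] =ᵐ[P] R.zstar φ t k := by
  have hy : Measurable (R.y t k) := (hE.measurable_y t ht k).mono (hE.mid_le t) le_rfl
  have hy_int : Integrable (R.y t k) P := by
    refine Integrable.of_bound hy.aestronglyMeasurable (1 / 2) ?_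
    filter_upwards [hB] with ω h
    refine le_trans ?_ (h t ht k)
    refine abs_le_of_sq_le_sq' ?_ (norm_nonneg _) |>.2
    rw [z, norm_joint_sq]
    exact le_add_of_nonneg_left (sq_nonneg _)
  have hx : Measurable[pre t] fun ω => joint (R.x t k ω) (0 : Vec dy) :=
    measurable_joint (hE.measurable_x t ht k) measurable_const
  have hzsum : R.z t k = (fun ω => joint (R.x t k ω) (0 : Vec dy)) +
      fun ω => embedPost dx dy (R.y t k ω) := by
    funext ω
    change joint _ _ = joint _ _ + joint _ _
    rw [← joint_add, add_zero, zero_add]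
  have hy'_int : Integrable (fun ω => embedPost dx dy (R.y t k ω)) P :=
    (embedPost dx dy).integrable_comp hy_int
  have hx_int : Integrable (fun ω => joint (R.x t k ω) (0 : Vec dy)) P := by
    have := (hE.integrable_z hB ht k).sub hy'_int
    rwa [hzsum, add_sub_cancel_right] at this
  rw [hzsum]
  refine (condExp_add hx_int hy'_int _).trans ?_
  have h1 := (embedPost dx dy).comp_condExp_comm (m := pre t) hy_int
  have h2 := condExp_of_stronglyMeasurable (hE.pre_le t) hx.stronglyMeasurable hx_int
  filter_upwards [h1, hE.condExp_y t ht k] with ω h3 h4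
  rw [Pi.add_apply, h2]
  rw [show P[fun ω => embedPost dx dy (R.y t k ω) | pre t] ω =
    embedPost dx dy (P[R.y t k | pre t] ω) from h3.symm, h4]
  change joint _ _ + joint _ _ = joint _ _
  rw [← joint_add, add_zero, zero_add]

/-- `z*` is a conditional expectation of `z` and so inherits its almost sure bound; the boundedness
assumption concerns only `z`. -/
theorem ae_norm_zstar_le :
    ∀ᵐ ω ∂P, ∀ t ∈ Finset.Icc 1 T, ∀ k, ‖R.zstar φ t k ω‖ ≤ 1 / 2 := by
  refine (Filter.eventually_all_finset _).2 fun t ht => ae_all_iff.2 fun k => ?_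
  have h := ae_bdd_norm_condExp_of_ae_bdd_norm (m := pre t) (μ := P) (f := R.z t k) (R := 1 / 2)
    (by filter_upwards [hB] with ω h using h t ht k)
  filter_upwards [h, hE.condExp_z hB ht k] with ω h1 h2
  rwa [h2] at h1

/-- The chosen arm is known before the round, so the selection splits into finitely many indicators
that pass through the conditional expectation. -/
theorem condExp_select (ht : t ∈ Finset.Icc 1 T) {c : Ω → Fin K}
    (hc : Measurable[pre t] c) :
    P[fun ω => R.z t (c ω) ω | pre t] =ᵐ[P] fun ω => R.zstar φ t (c ω) ω := by
  have hS : ∀ k, MeasurableSet[pre t] (c ⁻¹' {k}) := fun k => hc (measurableSet_singleton k)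
  have hdecomp : ∀ f : Fin K → Ω → Feature dx dy,
      (fun ω => f (c ω) ω) = ∑ k, (c ⁻¹' {k}).indicator (f k) := by
    intro f
    funext ω
    rw [Finset.sum_apply, Finset.sum_eq_single (c ω)]
    · simp
    · intro k _ hk
      exact Set.indicator_of_notMem (by simpa using hk.symm) _
    · simp
  rw [hdecomp (R.z t), hdecomp (R.zstar φ t)]
  refine (condExp_finsetSum (fun k _ => (hE.integrable_z hB ht k).indicator
    (hE.pre_le t _ (hS k))) _).trans ?_
  have h1 : ∀ᵐ ω ∂P, ∀ k, P[(c ⁻¹' {k}).indicator (R.z t k) | pre t] ω =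
      (c ⁻¹' {k}).indicator (R.zstar φ t k) ω := by
    refine ae_all_iff.2 fun k => ?_
    filter_upwards [condExp_indicator (hE.integrable_z hB ht k) (hS k),
      hE.condExp_z hB ht k] with ω h1 h2
    rw [h1]
    by_cases h : ω ∈ c ⁻¹' {k}
    · rw [Set.indicator_of_mem h, Set.indicator_of_mem h, h2]
    · rw [Set.indicator_of_notMem h, Set.indicator_of_notMem h]
  filter_upwards [h1] with ω h
  simp only [Finset.sum_apply, h]

theorem ae_norm_dzstar_le :
    ∀ᵐ ω ∂P, ∀ t ∈ Finset.Icc 1 T, ‖R.dzstar φ t ω‖ ≤ 1 := by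
  filter_upwards [hE.ae_norm_zstar_le hB] with ω h t ht
  refine (norm_sub_le _ _).trans ?_
  linarith [h t ht (R.a t ω), h t ht (R.b t ω)]

theorem integrable_select (ht : t ∈ Finset.Icc 1 T) {c : Ω → Fin K} (hc : Measurable[pre t] c) :
    Integrable (fun ω => R.z t (c ω) ω) P :=
  Integrable.of_bound ((measurable_select (fun k => (hE.measurable_z ht k).mono (hE.mid_le t)
    le_rfl) (hc.mono (hE.pre_le t) le_rfl)).aestronglyMeasurable) (1 / 2)
    (by filter_upwards [hB] with ω h using h t ht _)

theorem condExp_dz (ht : t ∈ Finset.Icc 1 T) :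
    P[R.dz t | pre t] =ᵐ[P] R.dzstar φ t := by
  have ha := hE.measurable_a t ht
  have hb := hE.measurable_b t ht
  refine (condExp_sub (hE.integrable_select hB ht ha) (hE.integrable_select hB ht hb) _).trans ?_
  filter_upwards [hE.condExp_select hB ht ha, hE.condExp_select hB ht hb] with ω h1 h2
  rw [Pi.sub_apply, h1, h2]
  rfl

/-- A predictable bounded direction, paired with the post-serving noise, gives a martingale
difference; it is applied to `dualDir`. -/
theorem condExp_inner_dzstar_sub (hφ : Measurable φ) (ht : t ∈ Finset.Icc 1 T)
    {u : Ω → Feature dx dy} (hu : Measurable[pre t] u) {B : ℝ} (huB : ∀ᵐ ω ∂P, ‖u ω‖ ≤ B) :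
    P[fun ω => (inner ℝ (u ω) (R.dzstar φ t ω - R.dz t ω) : ℝ) | pre t] =ᵐ[P] 0 := by
  have hm1 := hE.measurable_dzstar hφ ht
  have hm2 := (hE.measurable_dz ht).mono (hE.mid_le t) le_rfl
  have hu' := hu.mono (hE.pre_le t) le_rfl
  have hdz : Integrable (R.dz t) P := Integrable.of_bound hm2.aestronglyMeasurable 1
    (by filter_upwards [hB.ae_norm_dz_le] with ω h using h t ht)
  have hdzs : Integrable (R.dzstar φ t) P := Integrable.of_bound
    (hm1.mono (hE.pre_le t) le_rfl).aestronglyMeasurable 1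
    (by filter_upwards [hE.ae_norm_dzstar_le hB] with ω h using h t ht)
  have hint : Integrable (fun ω => innerSL ℝ (u ω) (R.dzstar φ t ω - R.dz t ω)) P := by
    refine Integrable.of_bound (hu'.inner
      ((hm1.mono (hE.pre_le t) le_rfl).sub hm2)).aestronglyMeasurable (B * 2) ?_
    filter_upwards [huB, hB.ae_norm_dz_le, hE.ae_norm_dzstar_le hB] with ω h1 h2 h3
    refine (norm_inner_le_norm (𝕜 := ℝ) (u ω) (R.dzstar φ t ω - R.dz t ω)).trans ?_
    have := (norm_sub_le (R.dzstar φ t ω) (R.dz t ω)).trans (add_le_add (h3 t ht) (h2 t ht))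
    have : ‖R.dzstar φ t ω - R.dz t ω‖ ≤ 2 := by linarith
    exact mul_le_mul h1 this (norm_nonneg _) ((norm_nonneg _).trans h1)
  have h := condExp_bilin_of_stronglyMeasurable_left
    (innerSL ℝ : Feature dx dy →L[ℝ] Feature dx dy →L[ℝ] ℝ) hu.stronglyMeasurable hint
    (hdzs.sub hdz)
  refine h.trans ?_
  have h2 := condExp_of_stronglyMeasurable (hE.pre_le t) hm1.stronglyMeasurable hdzs
  filter_upwards [condExp_sub hdzs hdz (pre t), hE.condExp_dz hB ht] with ω h3 h4
  rw [show P[fun ω => R.dzstar φ t ω - R.dz t ω | pre t] ω =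
    P[R.dzstar φ t - R.dz t | pre t] ω from rfl, h3, Pi.sub_apply, h2, h4, sub_self]
  simp

end IsEnvironment

end Run

/-! ### The self-normalized supermartingale -/

/-- One step of the self-normalized process. -/
theorem selfNormalized_step {ι : Type*} [Fintype ι] [DecidableEq ι] {V : Matrix ι ι ℝ}
    (hV : V.PosDef) {κ w η : ℝ} (hκ : 0 < κ) (hw0 : 0 ≤ w) (hw1 : w ≤ 1) (hη : |η| ≤ 1)
    (x S : EuclideanSpace ℝ ι) :
    κ / 2 * bil (rankOne V (κ * w) x)⁻¹ (S + (w * η) • x) (S + (w * η) • x) -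
      1 / 2 * (κ * w * bil V⁻¹ x x / (1 + κ * w * bil V⁻¹ x x)) ≤
    κ / 2 * bil V⁻¹ S S - (κ * w * bil V⁻¹ S x / (1 + κ * w * bil V⁻¹ x x)) ^ 2 / 2 +
      κ * w * bil V⁻¹ S x / (1 + κ * w * bil V⁻¹ x x) * η := by
  rw [bil_inv_rankOne hV (mul_nonneg hκ.le hw0)]
  simp only [bil_add_left, bil_add_right, bil_smul_left, bil_smul_right]
  rw [bil_comm hV.inv.isHermitian x S]
  have hQ := bil_inv_self_nonneg hV x
  set Q := bil V⁻¹ x x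
  set A := bil V⁻¹ S S
  set p := bil V⁻¹ S x
  have hq : 0 ≤ κ * w * Q := by positivity
  have h1 : 0 < 1 + κ * w * Q := by linarith
  have hη2 : η ^ 2 ≤ 1 := by rw [← sq_abs]; exact pow_le_one₀ (abs_nonneg _) hη
  -- After Sherman-Morrison the slack in the claim is an explicit sum of two terms. They are
  -- nonnegative because `0 ≤ w ≤ 1` and `η ^ 2 ≤ 1`.
  have key : κ / 2 * A - (κ * w * p / (1 + κ * w * Q)) ^ 2 / 2 + κ * w * p / (1 + κ * w * Q) * η -
      (κ / 2 * (A + w * η * p + (w * η * p + w * η * (w * η * Q)) -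
        κ * w * ((p + w * η * Q) * (p + w * η * Q)) / (1 + κ * w * Q)) -
        1 / 2 * (κ * w * Q / (1 + κ * w * Q))) =
      κ ^ 2 * w * p ^ 2 / (2 * (1 + κ * w * Q) ^ 2) * ((1 - w) + κ * w * Q) +
      κ * w * Q / (2 * (1 + κ * w * Q)) * (1 - w * η ^ 2) := by
    field_simp
    ring
  have h2 : 0 ≤ 1 - w * η ^ 2 := by nlinarith [sq_nonneg η]
  have h3 : 0 ≤ 1 - w + κ * w * Q := by linarith
  have h4 : 0 ≤ κ ^ 2 * w * p ^ 2 / (2 * (1 + κ * w * Q) ^ 2) * ((1 - w) + κ * w * Q) +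
      κ * w * Q / (2 * (1 + κ * w * Q)) * (1 - w * η ^ 2) := by positivity
  linarith

namespace Run

variable {Ω : Type*} {dx dy K : ℕ} {R : Run Ω dx dy K}

/-- The exponent of the self-normalized supermartingale. -/
noncomputable def potential (R : Run Ω dx dy K) (g : ℝ → ℝ) (θs : Feature dx dy) (lam κ α : ℝ)
    (t : ℕ) (ω : Ω) : ℝ :=
  κ / 2 * bil (R.V lam κ α t ω)⁻¹ (R.noiseSum g θs lam κ α t ω) (R.noiseSum g θs lam κ α t ω) -
    1 / 2 * ∑ s ∈ Finset.Icc 1 t, designGain lam κ α (fun s => R.dz s ω) s /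
      (1 + designGain lam κ α (fun s => R.dz s ω) s)

theorem noiseSum_succ (g : ℝ → ℝ) (θs : Feature dx dy) (lam κ α : ℝ) (t : ℕ) (ω : Ω) :
    R.noiseSum g θs lam κ α (t + 1) ω = R.noiseSum g θs lam κ α t ω +
      (R.weight lam κ α (t + 1) ω * (R.l (t + 1) ω - g (inner ℝ θs (R.dz (t + 1) ω)))) •
        R.dz (t + 1) ω := by
  rw [noiseSum, Finset.sum_Icc_succ_top (by omega)]
  rfl

variable [mΩ : MeasurableSpace Ω] {P : Measure Ω} {g : ℝ → ℝ} {φ : Vec dx → Vec dy}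
  {θs : Feature dx dy} {T t : ℕ} {pre mid : ℕ → MeasurableSpace Ω} {lam κ α : ℝ}

namespace IsEnvironment

variable (hE : R.IsEnvironment P g φ θs T pre mid)

include hE

theorem abs_noise_le (hrange : ∀ u, g u ∈ Set.Icc (0 : ℝ) 1) (ht : t ∈ Finset.Icc 1 T) (ω : Ω) :
    |R.l t ω - g (inner ℝ θs (R.dz t ω))| ≤ 1 := by
  obtain ⟨h0, h1⟩ := hrange (inner ℝ θs (R.dz t ω))
  rw [abs_le]
  rcases hE.binary_l t ht ω with h | h <;> rw [h] <;> constructor <;> linarith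

theorem norm_noiseSum_le (hrange : ∀ u, g u ∈ Set.Icc (0 : ℝ) 1) (hα : 0 < α) (ht : t ≤ T) {ω : Ω}
    (hω : ∀ t ∈ Finset.Icc 1 T, ‖R.dz t ω‖ ≤ 1) : ‖R.noiseSum g θs lam κ α t ω‖ ≤ t := by
  refine (norm_sum_le _ _).trans ?_
  have h : ∀ s ∈ Finset.Icc 1 t, ‖(R.weight lam κ α s ω *
      (R.l s ω - g (inner ℝ θs (R.dz s ω)))) • R.dz s ω‖ ≤ 1 := by
    intro s hs
    have hs' : s ∈ Finset.Icc 1 T := by simp at hs ⊢; omega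
    have hw0 : 0 ≤ R.weight lam κ α s ω := designWeight_nonneg hα s
    have hw1 : R.weight lam κ α s ω ≤ 1 := designWeight_le_one hα s
    rw [norm_smul, Real.norm_eq_abs, abs_mul, abs_of_nonneg hw0]
    exact mul_le_one₀ (mul_le_one₀ hw1 (abs_nonneg _) (hE.abs_noise_le hrange hs' ω))
      (norm_nonneg _) (hω s hs')
  simpa using Finset.sum_le_sum h

theorem mid_mono : Monotone mid :=
  monotone_nat_of_le_succ fun t => (hE.mid_le_pre t).trans (hE.pre_le_mid _)

theorem measurable_dz_le (ht : t ≤ T) : ∀ s ∈ Finset.Icc 1 t, Measurable[mid t] (R.dz s) :=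
  fun s hs => (hE.measurable_dz (by simp at hs ⊢; omega)).mono
    (hE.mid_mono (Finset.mem_Icc.1 hs).2) le_rfl

theorem measurable_noise (hg : Continuous g) (ht : t ∈ Finset.Icc 1 T) :
    Measurable[pre (t + 1)] fun ω => R.l t ω - g (inner ℝ θs (R.dz t ω)) :=
  (hE.measurable_l t ht).sub (hg.measurable.comp (Measurable.inner measurable_const
    ((hE.measurable_dz ht).mono (hE.mid_le_pre t) le_rfl)))

theorem measurable_noiseSum (hg : Continuous g) (ht : t ≤ T) :
    Measurable[pre (t + 1)] (R.noiseSum g θs lam κ α t) := by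
  refine Finset.measurable_sum _ fun s hs => ?_
  have hs' : s ∈ Finset.Icc 1 T := by simp at hs ⊢; omega
  have h1 : Measurable[pre (t + 1)] fun ω => R.weight lam κ α s ω :=
    (measurable_designWeight lam κ α t (hE.measurable_dz_le ht) hs).mono
      (hE.mid_le_pre t) le_rfl
  have h2 := (hE.measurable_noise hg hs').mono
      (hE.pre_mono (show s + 1 ≤ t + 1 by simp at hs; omega)) le_rfl
  have h3 := (hE.measurable_dz_le ht s hs).mono (hE.mid_le_pre t) le_rfl
  exact (h1.mul h2).smul h3

theorem measurable_V_inv (ht : t ≤ T) (i j : Fin dx ⊕ Fin dy) :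
    Measurable[mid t] fun ω => (R.V lam κ α t ω)⁻¹ i j :=
  measurable_matrix_inv (measurable_designMatrix lam κ α t (hE.measurable_dz_le ht)) i j

theorem measurable_potential (hg : Continuous g) (ht : t ≤ T) :
    Measurable[pre (t + 1)] (R.potential g θs lam κ α t) := by
  have hS := hE.measurable_noiseSum (lam := lam) (κ := κ) (α := α) hg ht
  refine Measurable.sub (measurable_const.mul (measurable_bil (fun i j =>
    (hE.measurable_V_inv ht i j).mono (hE.mid_le_pre t) le_rfl) hS hS))
    (measurable_const.mul (Finset.measurable_sum _ fun s hs => ?_))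
  have hq := (measurable_designGain lam κ α t (hE.measurable_dz_le ht) hs).mono
    (hE.mid_le_pre t) le_rfl
  exact hq.div (measurable_const.add hq)

/-- A crude bound that grows with `t`; it serves integrability only. The compensator is nonnegative
and can be dropped. -/
theorem potential_le (hrange : ∀ u, g u ∈ Set.Icc (0 : ℝ) 1) (hl : 0 < lam) (hκ : 0 < κ)
    (hα : 0 < α) (ht : t ≤ T) {ω : Ω} (hω : ∀ t ∈ Finset.Icc 1 T, ‖R.dz t ω‖ ≤ 1) :
    R.potential g θs lam κ α t ω ≤ κ / 2 * (t / Real.sqrt lam) ^ 2 := by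
  have hV : (R.V lam κ α t ω).PosDef := designMatrix_posDef hl hκ hα t
  have h1 : matNorm (R.V lam κ α t ω)⁻¹ (R.noiseSum g θs lam κ α t ω) ≤ t / Real.sqrt lam :=
    (matNorm_designMatrix_inv_le hl hκ hα t _).trans
      (div_le_div_of_nonneg_right (hE.norm_noiseSum_le hrange hα ht hω) (Real.sqrt_nonneg _))
  have h2 : 0 ≤ ∑ s ∈ Finset.Icc 1 t, designGain lam κ α (fun s => R.dz s ω) s /
      (1 + designGain lam κ α (fun s => R.dz s ω) s) := by
    refine Finset.sum_nonneg fun s _ => ?_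
    have := designGain_nonneg (Δ := fun s => R.dz s ω) hl hκ hα s
    positivity
  rw [potential, ← sq_matNorm hV.inv.posSemidef]
  have h3 := pow_le_pow_left₀ (matNorm_nonneg _ _) h1 2
  have h4 := mul_le_mul_of_nonneg_left h3 (show 0 ≤ κ / 2 by positivity)
  linarith

variable [IsProbabilityMeasure P] (hB : R.BoundedFeatures P T)

include hB

theorem integrable_exp_potential (hg : Continuous g) (hrange : ∀ u, g u ∈ Set.Icc (0 : ℝ) 1)
    (hl : 0 < lam) (hκ : 0 < κ) (hα : 0 < α) (ht : t ≤ T) :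
    Integrable (fun ω => Real.exp (R.potential g θs lam κ α t ω)) P := by
  refine integrable_of_ae_bound (Real.measurable_exp.comp
    ((hE.measurable_potential hg ht).mono (hE.pre_le _) le_rfl))
    (B := Real.exp (κ / 2 * (t / Real.sqrt lam) ^ 2)) ?_
  filter_upwards [hB.ae_norm_dz_le] with ω hω
  rw [Real.abs_exp]
  exact Real.exp_le_exp.2 (hE.potential_le hrange hl hκ hα ht hω)

/-- By `selfNormalized_step` the exponent grows by at most `u η - u ^ 2 / 2` with `u` known before
the outcome. Sub-Gaussianity of `η` given `mid (t + 1)` makes the conditional mean of the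
exponential of this increment at most one. -/
theorem integral_exp_potential_le (hg : Continuous g) (hrange : ∀ u, g u ∈ Set.Icc (0 : ℝ) 1)
    (hl : 0 < lam) (hκ : 0 < κ) (hα : 0 < α) (ht : t ≤ T) :
    ∫ ω, Real.exp (R.potential g θs lam κ α t ω) ∂P ≤ 1 := by
  induction t with
  | zero => simp [potential, noiseSum, bil]
  | succ t ih =>
    refine le_trans ?_ (ih (by omega))
    have hT : t + 1 ∈ Finset.Icc 1 T := by simp; omega
    have htT : t ≤ T := by omega
    set w := fun ω => designWeight lam κ α (fun s => R.dz s ω) (t + 1) with hw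
    set Q := fun ω => bil (R.V lam κ α t ω)⁻¹ (R.dz (t + 1) ω) (R.dz (t + 1) ω) with hQ
    set p := fun ω => bil (R.V lam κ α t ω)⁻¹ (R.noiseSum g θs lam κ α t ω) (R.dz (t + 1) ω) with hp
    -- The coefficient of the new noise in the one-step bound. It depends on `Δz_{t+1}`, hence the
    -- conditioning on `mid (t + 1)` and not on `pre (t + 1)`.
    set u := fun ω => κ * w ω * p ω / (1 + κ * w ω * Q ω) with hu
    set η := fun ω => R.l (t + 1) ω - g (inner ℝ θs (R.dz (t + 1) ω)) with hη
    set F := fun ω => Real.exp (R.potential g θs lam κ α t ω - u ω ^ 2 / 2) with hF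
    have hVpos : ∀ ω, (R.V lam κ α t ω).PosDef := fun ω => designMatrix_posDef hl hκ hα t
    have hw0 : ∀ ω, 0 ≤ w ω := fun ω => designWeight_nonneg hα _
    have hw1 : ∀ ω, w ω ≤ 1 := fun ω => designWeight_le_one hα _
    have hQ0 : ∀ ω, 0 ≤ Q ω := fun ω => bil_inv_self_nonneg (hVpos ω) _
    have hstep : ∀ ω, Real.exp (R.potential g θs lam κ α (t + 1) ω) ≤
        F ω * Real.exp (u ω * η ω) := by
      intro ω
      rw [hF, ← Real.exp_add]
      refine Real.exp_le_exp.2 ?_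
      have h := selfNormalized_step (hVpos ω) hκ (hw0 ω) (hw1 ω)
        (hE.abs_noise_le hrange hT ω) (R.dz (t + 1) ω) (R.noiseSum g θs lam κ α t ω)
      rw [potential, potential, noiseSum_succ, Finset.sum_Icc_succ_top (by omega)]
      change κ / 2 * bil (rankOne (R.V lam κ α t ω) (κ * w ω) (R.dz (t + 1) ω))⁻¹ _ _ -
        1 / 2 * (_ + κ * w ω * Q ω / (1 + κ * w ω * Q ω)) ≤ _
      change κ / 2 * bil (rankOne (R.V lam κ α t ω) (κ * w ω) (R.dz (t + 1) ω))⁻¹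
        (R.noiseSum g θs lam κ α t ω + (w ω * η ω) • R.dz (t + 1) ω)
        (R.noiseSum g θs lam κ α t ω + (w ω * η ω) • R.dz (t + 1) ω) - _ ≤ _
      change _ - 1 / 2 * (κ * w ω * Q ω / (1 + κ * w ω * Q ω)) ≤ _ - u ω ^ 2 / 2 + u ω * η ω at h
      linarith
    have hpot : Measurable[mid (t + 1)] (R.potential g θs lam κ α t) :=
      (hE.measurable_potential hg htT).mono (hE.pre_le_mid _) le_rfl
    have hVm : ∀ i j, Measurable[mid (t + 1)] fun ω => (R.V lam κ α t ω)⁻¹ i j := fun i j =>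
      (hE.measurable_V_inv htT i j).mono (hE.mid_mono (by omega)) le_rfl
    have hdz : Measurable[mid (t + 1)] (R.dz (t + 1)) := hE.measurable_dz hT
    have hwm : Measurable[mid (t + 1)] w :=
      measurable_designWeight lam κ α (t + 1) (hE.measurable_dz_le ht) (by simp)
    have hQm : Measurable[mid (t + 1)] Q := measurable_bil hVm hdz hdz
    have hpm : Measurable[mid (t + 1)] p := measurable_bil hVm
      ((hE.measurable_noiseSum hg htT).mono (hE.pre_le_mid _) le_rfl) hdz
    have hum : Measurable[mid (t + 1)] u := ((measurable_const.mul hwm).mul hpm).div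
      (measurable_const.add ((measurable_const.mul hwm).mul hQm))
    have hFm : Measurable[mid (t + 1)] F :=
      Real.measurable_exp.comp (hpot.sub ((hum.pow_const 2).div_const 2))
    have hFB : ∀ᵐ ω ∂P, F ω ≤ Real.exp (κ / 2 * (t / Real.sqrt lam) ^ 2) := by
      filter_upwards [hB.ae_norm_dz_le] with ω hω
      refine Real.exp_le_exp.2 ?_
      have := hE.potential_le hrange hl hκ hα htT hω
      have := sq_nonneg (u ω)
      linarith
    have huB : ∀ᵐ ω ∂P, |u ω| ≤ κ * ((t / Real.sqrt lam) * (1 / Real.sqrt lam)) := by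
      filter_upwards [hB.ae_norm_dz_le] with ω hω
      have h1 : |p ω| ≤ (t / Real.sqrt lam) * (1 / Real.sqrt lam) := by
        refine (abs_bil_le (hVpos ω).inv.posSemidef _ _).trans ?_
        refine mul_le_mul ((matNorm_designMatrix_inv_le hl hκ hα t _).trans
          (div_le_div_of_nonneg_right (hE.norm_noiseSum_le hrange hα htT hω)
          (Real.sqrt_nonneg _))) ((matNorm_designMatrix_inv_le hl hκ hα t _).trans
          (div_le_div_of_nonneg_right (hω _ hT) (Real.sqrt_nonneg _))) (matNorm_nonneg _ _)
          (by positivity)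
      have h2 : 1 ≤ 1 + κ * w ω * Q ω := by
        have := mul_nonneg (mul_nonneg hκ.le (hw0 ω)) (hQ0 ω); linarith
      rw [hu, abs_div, abs_mul, abs_mul, abs_of_pos hκ, abs_of_nonneg (hw0 ω),
        abs_of_pos (by linarith : 0 < 1 + κ * w ω * Q ω)]
      refine (div_le_self (by have := hw0 ω; positivity) h2).trans ?_
      rw [mul_assoc]
      refine mul_le_mul_of_nonneg_left ?_ hκ.le
      exact (mul_le_of_le_one_left (abs_nonneg _) (hw1 ω)).trans h1
    have hηm : Measurable η := (hE.measurable_noise hg hT).mono (hE.pre_le _) le_rfl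
    have hmain := integral_mul_exp_le (hE.mid_le (t + 1)) hFm hum hηm
      (fun ω => (Real.exp_pos _).le) hFB huB
      (Filter.Eventually.of_forall (hE.abs_noise_le hrange hT)) (hE.condExp_noise hg hrange hT)
    have hrw : ∀ ω, F ω * Real.exp (u ω ^ 2 / 2) = Real.exp (R.potential g θs lam κ α t ω) := by
      intro ω
      rw [hF, ← Real.exp_add]
      congr 1
      ring
    simp only [hrw] at hmain
    refine le_trans (integral_mono_of_nonneg (Filter.Eventually.of_forall fun ω =>
      (Real.exp_pos _).le) ?_ (Filter.Eventually.of_forall hstep)) hmain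
    refine integrable_of_ae_bound ((hFm.mono (hE.mid_le _) le_rfl).mul (Real.measurable_exp.comp
      ((hum.mono (hE.mid_le _) le_rfl).mul hηm)))
      (B := Real.exp (κ / 2 * (t / Real.sqrt lam) ^ 2) *
        Real.exp (κ * ((t / Real.sqrt lam) * (1 / Real.sqrt lam)))) ?_
    filter_upwards [hFB, huB] with ω h1 h2
    rw [abs_mul, Real.abs_exp, abs_of_pos (Real.exp_pos _)]
    refine mul_le_mul h1 (Real.exp_le_exp.2 ?_) (Real.exp_pos _).le (Real.exp_pos _).le
    refine (le_abs_self _).trans ?_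
    rw [abs_mul]
    exact (mul_le_of_le_one_right (abs_nonneg _) (hE.abs_noise_le hrange hT ω)).trans h2

/-- The self-normalized deviation bound for the noise. -/
theorem measure_noiseSum_le (hg : Continuous g) (hrange : ∀ u, g u ∈ Set.Icc (0 : ℝ) 1)
    (hl : 0 < lam) (hκ : 0 < κ) (hα : 0 < α) (ht : t ≤ T) {ε : ℝ} (hε : 0 < ε) :
    P {ω | Real.log (1 / ε) < R.potential g θs lam κ α t ω} ≤ ENNReal.ofReal ε :=
  measure_lt_le_of_integral_exp (b := 0) (hE.integrable_exp_potential hB hg hrange hl hκ hα ht)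
    (by rw [Real.exp_zero]; exact hE.integral_exp_potential_le hB hg hrange hl hκ hα ht) hε
    (by rw [zero_add])

end IsEnvironment

end Run

/-! ### An Azuma type inequality -/

section Azuma

variable {Ω : Type*} {mΩ : MeasurableSpace Ω} {P : Measure Ω} [IsProbabilityMeasure P]

/-- The exponential moment of a sum of bounded martingale differences. -/
theorem integral_exp_sum_le {pre : ℕ → MeasurableSpace Ω} (hmono : Monotone pre)
    (hle : ∀ t, pre t ≤ mΩ) {η : ℕ → Ω → ℝ} {T : ℕ}
    (hm : ∀ t ∈ Finset.Icc 1 T, Measurable[pre (t + 1)] (η t))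
    (hη1 : ∀ t ∈ Finset.Icc 1 T, ∀ᵐ ω ∂P, |η t ω| ≤ 1)
    (hc : ∀ t ∈ Finset.Icc 1 T, P[η t | pre t] =ᵐ[P] 0) (θ : ℝ) {t : ℕ} (ht : t ≤ T) :
    Integrable (fun ω => Real.exp (θ * ∑ s ∈ Finset.Icc 1 t, η s ω)) P ∧
    ∫ ω, Real.exp (θ * ∑ s ∈ Finset.Icc 1 t, η s ω) ∂P ≤ Real.exp (t * (θ ^ 2 / 2)) := by
  have hmeas : ∀ t ≤ T, Measurable[pre (t + 1)]
      fun ω => Real.exp (θ * ∑ s ∈ Finset.Icc 1 t, η s ω) := fun t ht =>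
    Real.measurable_exp.comp (measurable_const.mul (Finset.measurable_sum _ fun s hs =>
      (hm s (by simp at hs ⊢; omega)).mono (hmono (by simp at hs; omega)) le_rfl))
  have hbound : ∀ t ≤ T, ∀ᵐ ω ∂P,
      Real.exp (θ * ∑ s ∈ Finset.Icc 1 t, η s ω) ≤ Real.exp (|θ| * t) := by
    intro t ht
    have h := (Filter.eventually_all_finset _).2 hη1
    filter_upwards [h] with ω hω
    refine Real.exp_le_exp.2 ((le_abs_self _).trans ?_)
    rw [abs_mul]
    refine mul_le_mul_of_nonneg_left ((Finset.abs_sum_le_sum_abs _ _).trans ?_) (abs_nonneg _)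
    simpa using Finset.sum_le_sum fun s (hs : s ∈ Finset.Icc 1 t) =>
      hω s (by simp at hs ⊢; omega)
  have hint : ∀ t ≤ T,
      Integrable (fun ω => Real.exp (θ * ∑ s ∈ Finset.Icc 1 t, η s ω)) P := by
    intro t ht
    refine integrable_of_ae_bound ((hmeas t ht).mono (hle _) le_rfl) (B := Real.exp (|θ| * t)) ?_
    filter_upwards [hbound t ht] with ω hω
    rwa [Real.abs_exp]
  refine ⟨hint t ht, ?_⟩
  induction t with
  | zero => simp
  | succ t ih =>
    have hT : t + 1 ∈ Finset.Icc 1 T := by simp; omega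
    have hmain := integral_mul_exp_le (hle (t + 1)) (hmeas t (by omega))
      (u := fun _ => θ) measurable_const ((hm _ hT).mono (hle _) le_rfl)
      (fun ω => (Real.exp_pos _).le) (hbound t (by omega)) (Filter.Eventually.of_forall fun _ =>
      le_refl |θ|) (hη1 _ hT) (hc _ hT)
    rw [integral_mul_const] at hmain
    have e : ∀ ω, Real.exp (θ * ∑ s ∈ Finset.Icc 1 (t + 1), η s ω) =
        Real.exp (θ * ∑ s ∈ Finset.Icc 1 t, η s ω) * Real.exp (θ * η (t + 1) ω) := by
      intro ω
      rw [Finset.sum_Icc_succ_top (by omega), mul_add, Real.exp_add]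
    simp only [e]
    refine hmain.trans ((mul_le_mul_of_nonneg_right (ih (by omega)) (Real.exp_pos _).le).trans ?_)
    rw [← Real.exp_add]
    refine le_of_eq ?_
    congr 1
    push_cast
    ring

/-- A deviation bound for sums of bounded martingale differences. -/
theorem measure_sum_lt_le {pre : ℕ → MeasurableSpace Ω} (hmono : Monotone pre)
    (hle : ∀ t, pre t ≤ mΩ) {η : ℕ → Ω → ℝ} {T : ℕ} (hT : 1 ≤ T)
    (hm : ∀ t ∈ Finset.Icc 1 T, Measurable[pre (t + 1)] (η t))
    (hη1 : ∀ t ∈ Finset.Icc 1 T, ∀ᵐ ω ∂P, |η t ω| ≤ 1)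
    (hc : ∀ t ∈ Finset.Icc 1 T, P[η t | pre t] =ᵐ[P] 0) {ε : ℝ} (hε : 0 < ε) :
    P {ω | Real.sqrt T * (1 / 2 + Real.log (1 / ε)) < ∑ s ∈ Finset.Icc 1 T, η s ω} ≤
      ENNReal.ofReal ε := by
  have hTpos : (0 : ℝ) < T := by exact_mod_cast hT
  have hs : 0 < Real.sqrt T := Real.sqrt_pos.2 hTpos
  -- With this fixed parameter the exponent `T θ ^ 2 / 2` equals `1 / 2`. The deviation is then
  -- linear in `log (1 / ε)`, which suffices up to logarithms.
  obtain ⟨h1, h2⟩ := integral_exp_sum_le (P := P) hmono hle hm hη1 hc (1 / Real.sqrt T) le_rfl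
  have h3 := measure_lt_le_of_integral_exp h1 h2 hε le_rfl
  convert h3 using 2
  ext ω
  have e : (T : ℝ) * ((1 / Real.sqrt T) ^ 2 / 2) = 1 / 2 := by
    rw [div_pow, Real.sq_sqrt hTpos.le]
    field_simp
  rw [Set.mem_ofPred_eq, Set.mem_ofPred_eq, e, one_div_mul_eq_div, lt_div_iff₀ hs, mul_comm]

end Azuma

/-! ### The number of missing outcomes -/

/-- Among `m` distinct naturals the sum is smallest for `0, …, m - 1`. In the induction the new
maximum is at least the number of elements below it. -/
theorem card_mul_pred_le_two_mul_sum (A : Finset ℕ) : A.card * (A.card - 1) ≤ 2 * ∑ j ∈ A, j := by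
  induction A using Finset.induction_on_max with
  | empty => simp
  | insert a A hA ih =>
    have ha : a ∉ A := fun h => lt_irrefl _ (hA a h)
    have hcard : A.card ≤ a := by
      have h : A ⊆ Finset.range a := fun j hj => Finset.mem_range.2 (hA j hj)
      simpa using Finset.card_le_card h
    rw [Finset.card_insert_of_notMem ha, Finset.sum_insert ha, Nat.add_sub_cancel]
    rcases Nat.eq_zero_or_pos A.card with h0 | h0
    · rw [h0]; simp
    · obtain ⟨c, hc⟩ : ∃ c, A.card = c + 1 := ⟨A.card - 1, by omega⟩
      rw [hc] at ih hcard ⊢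
      rw [Nat.add_sub_cancel] at ih
      nlinarith

theorem sum_one_div_sub_le (t : ℕ) :
    ∑ s ∈ Finset.Icc 1 (t - 1), 1 / ((t : ℝ) - s) ≤ 1 + Real.log t := by
  have h : ∑ s ∈ Finset.Icc 1 (t - 1), 1 / ((t : ℝ) - s) = ((harmonic (t - 1) : ℚ) : ℝ) := by
    rw [harmonic_eq_sum_Icc]
    push_cast
    refine Finset.sum_nbij' (fun s => t - s) (fun s => t - s) ?_ ?_ ?_ ?_ ?_
    · intro s hs; simp at hs ⊢; omega
    · intro s hs; simp at hs ⊢; omega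
    · intro s hs; simp at hs ⊢; omega
    · intro s hs; simp at hs ⊢; omega
    · intro s hs
      have hst : s ≤ t := by simp at hs; omega
      rw [Nat.cast_sub hst, one_div]
  rw [h]
  refine (harmonic_le_one_add_log _).trans ?_
  have : Real.log ((t - 1 : ℕ) : ℝ) ≤ Real.log t := by
    rcases Nat.eq_zero_or_pos (t - 1) with h0 | h0
    · rw [h0, Nat.cast_zero, Real.log_zero]
      exact Real.log_natCast_nonneg t
    · exact Real.log_le_log (by exact_mod_cast h0) (by exact_mod_cast Nat.sub_le t 1)
  linarith

namespace Run

variable {Ω : Type*} {dx dy K : ℕ} {R : Run Ω dx dy K}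

/-- The ages `t - s` of the `m` pending rounds are distinct and bounded by their delays, so `m (m -
1) ≤ 2 Λ`. -/
theorem card_pending_le_of_sum_le {t T : ℕ} (ht : t ≤ T) {ω : Ω} {Lam : ℝ}
    (h : ∑ s ∈ Finset.Icc 1 T, (R.τ s ω : ℝ) ≤ Lam) :
    ((R.pending t ω).card : ℝ) ≤ 1 + Real.sqrt (2 * Lam) := by
  set m := (R.pending t ω).card with hm
  have hmem : ∀ s ∈ R.pending t ω, 1 ≤ s ∧ s ≤ t ∧ t ≤ s + R.τ s ω := fun s hs => by
    simpa [pending, and_assoc] using hs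
  have hinj : Set.InjOn (fun s => t - s) (R.pending t ω : Set ℕ) := by
    intro s hs s' hs' heq
    have := hmem s hs; have := hmem s' hs'
    simp only at heq
    omega
  have h1 := card_mul_pred_le_two_mul_sum ((R.pending t ω).image fun s => t - s)
  rw [Finset.card_image_of_injOn hinj, Finset.sum_image hinj, ← hm] at h1
  have h2 : ((∑ s ∈ R.pending t ω, (t - s) : ℕ) : ℝ) ≤ Lam := by
    refine le_trans ?_ h
    rw [Nat.cast_sum]
    refine (Finset.sum_le_sum (g := fun s => (R.τ s ω : ℝ)) fun s hs => ?_).trans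
      (Finset.sum_le_sum_of_subset_of_nonneg (fun s hs => ?_) fun s _ _ => Nat.cast_nonneg _)
    · have := hmem s hs
      exact_mod_cast (by omega : t - s ≤ R.τ s ω)
    · have := hmem s hs
      simp; omega
  rcases Nat.eq_zero_or_pos m with h0 | h0
  · rw [h0, Nat.cast_zero]; positivity
  · have h3 : ((m * (m - 1) : ℕ) : ℝ) ≤ 2 * Lam := by
      have : ((m * (m - 1) : ℕ) : ℝ) ≤ ((2 * ∑ s ∈ R.pending t ω, (t - s) : ℕ) : ℝ) := by
        exact_mod_cast h1
      rw [Nat.cast_mul 2] at this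
      push_cast at this h2 ⊢
      linarith
    rw [Nat.cast_mul, Nat.cast_sub h0, Nat.cast_one] at h3
    have hm1 : (1 : ℝ) ≤ m := by exact_mod_cast h0
    have : (m : ℝ) - 1 ≤ Real.sqrt (2 * Lam) := Real.le_sqrt_of_sq_le (by nlinarith)
    linarith

variable [mΩ : MeasurableSpace Ω] {P : Measure Ω} [IsProbabilityMeasure P]

/-- The exponential moment of an indicator. -/
theorem mgf_indicator_le {A : Set Ω} (hA : MeasurableSet A) {q : ℝ} (hq : P.real A ≤ q) :
    mgf (A.indicator fun _ => (1 : ℝ)) P 1 ≤ Real.exp (2 * q) := by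
  have h : ∀ ω, Real.exp (1 * A.indicator (fun _ => (1 : ℝ)) ω) =
      1 + A.indicator (fun _ => Real.exp 1 - 1) ω := by
    intro ω
    by_cases hω : ω ∈ A
    · simp [hω]
    · simp [hω]
  rw [mgf]
  simp only [h]
  rw [integral_add (integrable_const _) ((integrable_const _).indicator hA),
    integral_indicator_const _ hA]
  -- The moment is `1 + (e - 1) P(A) ≤ 1 + 2 q ≤ exp (2 q)`.
  have h1 := Real.add_one_le_exp (2 * q)
  have h2 := Real.exp_one_lt_d9
  have h3 : 0 ≤ P.real A := measureReal_nonneg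
  simp only [integral_const, probReal_univ, smul_eq_mul, mul_one]
  nlinarith

/-- With independent delays of mean `μ_τ` the number of missing outcomes is of order `μ_τ`,
up to logarithms. -/
theorem measure_card_pending_le {T t : ℕ} {muτ : ℝ} {σ : ℝ≥0} (hμ : 0 ≤ muτ)
    (hτ : ∀ t ∈ Finset.Icc 1 T, Measurable (R.τ t))
    (hS : R.StochasticDelays P muτ σ T) (ht : t ∈ Finset.Icc 1 T) {ε : ℝ} (hε : 0 < ε) :
    P {ω | 1 + (2 * (muτ * (1 + Real.log t)) + Real.log (1 / ε)) < (R.pending t ω).card} ≤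
      ENNReal.ofReal ε := by
  obtain ⟨hind, hdel⟩ := hS
  have htT : t ≤ T := (Finset.mem_Icc.1 ht).2
  -- Round `t` is left out, since Markov's inequality says nothing at age `0`; it accounts for the
  -- additive `1` in the claim.
  set A : ℕ → Set Ω := fun s => {ω | s < t ∧ t ≤ s + R.τ s ω} with hA
  have hAm : ∀ s ∈ Finset.Icc 1 T, MeasurableSet (A s) := by
    intro s hs
    have : MeasurableSet {n : ℕ | s < t ∧ t ≤ s + n} := MeasurableSet.of_discrete
    exact hτ s hs this
  set X : Finset.Icc 1 T → Ω → ℝ := fun s => (A s.1).indicator fun _ => (1 : ℝ) with hX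
  have hXm : ∀ s, Measurable (X s) := fun s => measurable_const.indicator (hAm s.1 s.2)
  have hXind : iIndepFun X P := by
    have h := hind.comp (fun (s : Finset.Icc 1 T) (n : ℕ) =>
      ({n : ℕ | s.1 < t ∧ t ≤ s.1 + n}).indicator (fun _ => (1 : ℝ)) n)
      (fun s => measurable_of_countable _)
    exact h
  -- Markov's inequality needs only the mean of the delay. The sub-Gaussian assumption enters
  -- through integrability.
  have hprob : ∀ s ∈ Finset.Icc 1 T, P.real (A s) ≤
      if s < t then muτ * (1 / ((t : ℝ) - s)) else 0 := by
    intro s hs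
    split_ifs with hst
    · obtain ⟨hmean, hsub⟩ := hdel s hs
      have hint : Integrable (fun ω => (R.τ s ω : ℝ)) P := by
        refine (hsub.integrable.add (integrable_const muτ)).congr
          (Filter.Eventually.of_forall fun ω => ?_)
        simp
      have hM := mul_meas_ge_le_integral_of_nonneg (μ := P)
        (Filter.Eventually.of_forall fun ω => Nat.cast_nonneg (R.τ s ω)) hint ((t : ℝ) - s)
      have hpos : (0 : ℝ) < (t : ℝ) - s := sub_pos.2 (by exact_mod_cast hst)
      rw [hmean] at hM
      have hsubset : A s ⊆ {ω | (t : ℝ) - s ≤ (R.τ s ω : ℝ)} := by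
        intro ω hω
        have h2 : (t : ℝ) ≤ s + R.τ s ω := by exact_mod_cast hω.2
        change (t : ℝ) - s ≤ _
        linarith
      refine (measureReal_mono hsubset).trans ?_
      rw [mul_one_div, le_div_iff₀ hpos, mul_comm]
      exact hM
    · have : A s = ∅ := by
        ext ω
        simp [hA, hst]
      rw [this, measureReal_empty]
  have hsum : ∑ s ∈ Finset.Icc 1 T, (if s < t then muτ * (1 / ((t : ℝ) - s)) else 0) ≤
      muτ * (1 + Real.log t) := by
    rw [← Finset.sum_filter, ← Finset.mul_sum]
    refine mul_le_mul_of_nonneg_left ?_ hμ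
    have : Finset.filter (fun s => s < t) (Finset.Icc 1 T) = Finset.Icc 1 (t - 1) := by
      ext s; simp; omega
    rw [this]
    exact sum_one_div_sub_le t
  have hmgf : mgf (∑ s, X s) P 1 ≤ Real.exp (2 * (muτ * (1 + Real.log t))) := by
    rw [hXind.mgf_sum hXm]
    calc ∏ s, mgf (X s) P 1 ≤ ∏ s : Finset.Icc 1 T,
          Real.exp (2 * (if s.1 < t then muτ * (1 / ((t : ℝ) - s.1)) else 0)) :=
          Finset.prod_le_prod (fun s _ => mgf_nonneg) fun s _ =>
            mgf_indicator_le (hAm s.1 s.2) (hprob s.1 s.2)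
      _ = Real.exp (2 * ∑ s : Finset.Icc 1 T,
            (if s.1 < t then muτ * (1 / ((t : ℝ) - s.1)) else 0)) := by
          rw [← Real.exp_sum, Finset.mul_sum]
      _ ≤ _ := by
          rw [Finset.sum_coe_sort (Finset.Icc 1 T)
            (fun s => if s < t then muτ * (1 / ((t : ℝ) - s)) else 0)]
          exact Real.exp_le_exp.2 (by linarith)
  have hXsum : ∀ ω, (∑ s, X s) ω = ∑ s ∈ Finset.Icc 1 T, (A s).indicator (fun _ => (1 : ℝ)) ω := by
    intro ω
    rw [Finset.sum_apply]
    exact Finset.sum_coe_sort (Finset.Icc 1 T) (fun s => (A s).indicator (fun _ => (1 : ℝ)) ω)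
  have hcard : ∀ ω, ((R.pending t ω).card : ℝ) ≤ 1 + (∑ s, X s) ω := by
    intro ω
    have h1 : R.pending t ω ⊆ insert t ({s ∈ Finset.Icc 1 T | s < t ∧ t ≤ s + R.τ s ω}) := by
      intro s hs
      simp only [pending, Finset.mem_filter, Finset.mem_Icc, Finset.mem_insert] at hs ⊢
      omega
    have h2 := (Finset.card_le_card h1).trans (Finset.card_insert_le _ _)
    have h3 : (∑ s, X s) ω =
        (({s ∈ Finset.Icc 1 T | s < t ∧ t ≤ s + R.τ s ω} : Finset ℕ).card : ℝ) := by
      rw [hXsum, Finset.card_filter, Nat.cast_sum]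
      refine Finset.sum_congr rfl fun s _ => ?_
      by_cases h : s < t ∧ t ≤ s + R.τ s ω
      · rw [Set.indicator_of_mem (show ω ∈ A s from h), if_pos h, Nat.cast_one]
      · rw [Set.indicator_of_notMem (show ω ∉ A s from h), if_neg h, Nat.cast_zero]
    rw [h3]
    have : ((R.pending t ω).card : ℝ) ≤
        ((({s ∈ Finset.Icc 1 T | s < t ∧ t ≤ s + R.τ s ω} : Finset ℕ).card + 1 : ℕ) : ℝ) := by
      exact_mod_cast h2
    push_cast at this ⊢
    linarith
  have hint : Integrable (fun ω => Real.exp ((∑ s, X s) ω)) P := by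
    have hm : Measurable (∑ s, X s) := by
      have : (∑ s, X s) = fun ω => ∑ s, X s ω := funext fun ω => Finset.sum_apply _ _ _
      rw [this]
      exact Finset.measurable_sum _ fun s _ => hXm s
    refine integrable_of_ae_bound (Real.measurable_exp.comp hm) (B := Real.exp T) (Filter.Eventually.of_forall fun ω => ?_)
    rw [Real.abs_exp]
    refine Real.exp_le_exp.2 ?_
    rw [hXsum]
    refine (Finset.sum_le_sum (g := fun _ => (1 : ℝ)) fun s _ => ?_).trans (by simp)
    exact Set.indicator_le_self' (fun _ _ => zero_le_one) ω
  refine le_trans (measure_mono ?_) (measure_lt_le_of_integral_exp hint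
    (by simpa [mgf] using hmgf) hε le_rfl)
  intro ω hω
  have := hcard ω
  simp only [Set.mem_ofPred_eq] at hω ⊢
  linarith

end Run

/-! ### The regret of one round, and noise-free against observed widths -/

namespace Run

variable {Ω : Type*} {dx dy K : ℕ} {R : Run Ω dx dy K} {g : ℝ → ℝ} {φ : Vec dx → Vec dy}
  {θs : Feature dx dy} {T t : ℕ} {lam κ α : ℝ} {ω : Ω}

/-- The regret of a single round. -/
noncomputable def roundRegret (R : Run Ω dx dy K) (φ : Vec dx → Vec dy) (θs : Feature dx dy)
    (t : ℕ) (ω : Ω) : ℝ :=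
  (1 / 2 : ℝ) * (((⨆ k, inner ℝ θs (R.zstar φ t k ω)) - inner ℝ θs (R.zstar φ t (R.a t ω) ω)) +
      ((⨆ k, inner ℝ θs (R.zstar φ t k ω)) - inner ℝ θs (R.zstar φ t (R.b t ω) ω)))

theorem exists_best_arm (R : Run Ω dx dy K) (φ : Vec dx → Vec dy) (θs : Feature dx dy) (t : ℕ)
    (ω : Ω) : ∃ k, R.roundRegret φ θs t ω = (1 / 2 : ℝ) * (2 * inner ℝ θs (R.zstar φ t k ω) -
      inner ℝ θs (R.zstar φ t (R.a t ω) ω) - inner ℝ θs (R.zstar φ t (R.b t ω) ω)) := by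
  have : Nonempty (Fin K) := ⟨R.a t ω⟩
  obtain ⟨k, hk⟩ := exists_eq_ciSup_of_finite (f := fun k => (inner ℝ θs (R.zstar φ t k ω) : ℝ))
  exact ⟨k, by rw [roundRegret, ← hk]; ring⟩

/-- Used for the first round, in which the approximator has seen no data. -/
theorem roundRegret_le_norm (h : ∀ k, ‖R.zstar φ t k ω‖ ≤ 1 / 2) :
    R.roundRegret φ θs t ω ≤ ‖θs‖ := by
  obtain ⟨k, hk⟩ := R.exists_best_arm φ θs t ω
  have hb : ∀ k, |(inner ℝ θs (R.zstar φ t k ω) : ℝ)| ≤ ‖θs‖ * (1 / 2) := fun k =>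
    (abs_real_inner_le_norm _ _).trans (mul_le_mul_of_nonneg_left (h k) (norm_nonneg _))
  have h1 := abs_le.1 (hb k)
  have h2 := abs_le.1 (hb (R.a t ω))
  have h3 := abs_le.1 (hb (R.b t ω))
  rw [hk]
  linarith

/-- The regret of a round is controlled by the width of the confidence set in the direction
played. -/
theorem roundRegret_le_width (hl : 0 < lam) (hκ : 0 < κ) (hα : 0 < α) {β c e : ℝ}
    (hc : c = 2 * β)
    (ha : ∀ k, (inner ℝ (R.Θ (t - 1) ω) (R.zhat t k ω) : ℝ) ≤
      inner ℝ (R.Θ (t - 1) ω) (R.zhat t (R.a t ω) ω))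
    (hb : ∀ k, inner ℝ (R.Θ (t - 1) ω) (R.zhat t k ω) +
        c * matNorm (R.V lam κ α (t - 1) ω)⁻¹ (R.zhat t k ω - R.zhat t (R.a t ω) ω) ≤
      inner ℝ (R.Θ (t - 1) ω) (R.zhat t (R.b t ω) ω) +
        c * matNorm (R.V lam κ α (t - 1) ω)⁻¹
          (R.zhat t (R.b t ω) ω - R.zhat t (R.a t ω) ω))
    (hβ : matNorm (R.V lam κ α (t - 1) ω) (R.Θ (t - 1) ω - θs) ≤ β)
    (he : ∀ k, ‖R.zhat t k ω - R.zstar φ t k ω‖ ≤ e) :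
    R.roundRegret φ θs t ω ≤
      3 / 2 * β * (matNorm (R.V lam κ α (t - 1) ω)⁻¹ (R.dzstar φ t ω) + 2 * e / Real.sqrt lam) +
        2 * ‖θs‖ * e := by
  have hV : (R.V lam κ α (t - 1) ω).PosDef := designMatrix_posDef hl hκ hα (t - 1)
  obtain ⟨k, hk⟩ := R.exists_best_arm φ θs t ω
  set V := R.V lam κ α (t - 1) ω
  set θ := R.Θ (t - 1) ω
  set A := R.zhat t (R.a t ω) ω
  set B := R.zhat t (R.b t ω) ω
  set Z := R.zhat t k ω
  have hβ0 : 0 ≤ β := (matNorm_nonneg _ _).trans hβ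
  have hconf : ∀ v, (inner ℝ θs v : ℝ) ≤ inner ℝ θ v + β * matNorm V⁻¹ v := by
    intro v
    have h1 : (inner ℝ θs v : ℝ) = inner ℝ θ v + inner ℝ (θ - θs) (-v) := by
      rw [inner_neg_right, inner_sub_left]; ring
    rw [h1]
    have h2 := inner_le_matNorm hV (θ - θs) (-v)
    rw [matNorm_neg] at h2
    have h3 := mul_le_mul_of_nonneg_right hβ (matNorm_nonneg V⁻¹ v)
    linarith
  have hswap : ∀ k, |(inner ℝ θs (R.zhat t k ω) : ℝ) - inner ℝ θs (R.zstar φ t k ω)| ≤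
      ‖θs‖ * e := fun k => by
    rw [← inner_sub_right]
    exact (abs_real_inner_le_norm _ _).trans (mul_le_mul_of_nonneg_left (he k) (norm_nonneg _))
  have s1 := abs_le.1 (hswap k)
  have s2 := abs_le.1 (hswap (R.a t ω))
  have s3 := abs_le.1 (hswap (R.b t ω))
  have hZA := hconf (Z - A)
  have hZB := hconf (Z - B)
  have htri : matNorm V⁻¹ (Z - B) ≤ matNorm V⁻¹ (Z - A) + matNorm V⁻¹ (B - A) := by
    have : Z - B = (Z - A) - (B - A) := by abel
    rw [this]
    exact matNorm_sub_le hV.inv.posSemidef _ _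
  have htri' := mul_le_mul_of_nonneg_left htri hβ0
  -- `hZA` and `hZB` add up to an excess of `2 β ‖Z - A‖ + β ‖B - A‖`. The width `2 β` in the choice
  -- of the second arm absorbs the first term and returns `2 β ‖B - A‖`, in total `3 β ‖B - A‖` for
  -- twice the regret.
  have h1 := ha k
  have h2 := hb k
  rw [hc] at h2
  rw [inner_sub_right, inner_sub_right] at hZA hZB
  have hwidth : matNorm V⁻¹ (B - A) ≤ matNorm V⁻¹ (R.dzstar φ t ω) + 2 * e / Real.sqrt lam := by
    -- The estimated difference deviates from the noise-free one by two approximation errors, each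
    -- of norm at most `e`; dividing by `√λ` bounds their dual norm.
    have e1 : B - A = -(R.dzstar φ t ω) + ((B - R.zstar φ t (R.b t ω) ω) -
        (A - R.zstar φ t (R.a t ω) ω)) := by rw [dzstar]; abel
    rw [e1]
    refine (matNorm_add_le hV.inv.posSemidef _ _).trans ?_
    rw [matNorm_neg]
    refine add_le_add le_rfl ((matNorm_designMatrix_inv_le hl hκ hα _ _).trans ?_)
    refine div_le_div_of_nonneg_right ((norm_sub_le _ _).trans ?_) (Real.sqrt_nonneg _)
    have := he (R.a t ω)
    have := he (R.b t ω)
    linarith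
  have h3 := mul_le_mul_of_nonneg_left hwidth (show 0 ≤ 3 / 2 * β by positivity)
  rw [hk]
  change (inner ℝ θ Z : ℝ) ≤ inner ℝ θ A at h1
  change (inner ℝ θ Z : ℝ) + 2 * β * matNorm V⁻¹ (Z - A) ≤
    inner ℝ θ B + 2 * β * matNorm V⁻¹ (B - A) at h2
  change -(‖θs‖ * e) ≤ (inner ℝ θs Z : ℝ) - _ ∧ _ at s1
  change _ ∧ (inner ℝ θs A : ℝ) - _ ≤ _ at s2
  change _ ∧ (inner ℝ θs B : ℝ) - _ ≤ _ at s3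
  linarith [s1.1, s2.2, s3.2]

theorem norm_zhat_sub_zstar (t : ℕ) (k : Fin K) (ω : Ω) :
    ‖R.zhat t k ω - R.zstar φ t k ω‖ = ‖R.phiHat (t - 1) ω (R.x t k ω) - φ (R.x t k ω)‖ := by
  rw [← norm_joint_zero (dx := dx)]
  congr 1
  rw [zhat, zstar, sub_eq_iff_eq_add, ← joint_add, zero_add, sub_add_cancel]

/-- The unit vector of the norm `‖·‖_V` that is dual to `Δz*_t`. -/
noncomputable def dualDir (R : Run Ω dx dy K) (φ : Vec dx → Vec dy) (lam κ α : ℝ) (t : ℕ) (ω : Ω) :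
    Feature dx dy :=
  (matNorm (R.V lam κ α (t - 1) ω)⁻¹ (R.dzstar φ t ω))⁻¹ •
    act (R.V lam κ α (t - 1) ω)⁻¹ (R.dzstar φ t ω)

theorem matNorm_dualDir_le (hl : 0 < lam) (hκ : 0 < κ) (hα : 0 < α) :
    matNorm (R.V lam κ α (t - 1) ω) (R.dualDir φ lam κ α t ω) ≤ 1 := by
  have hV : (R.V lam κ α (t - 1) ω).PosDef := designMatrix_posDef hl hκ hα (t - 1)
  have h := matNorm_act_inv hV (R.dzstar φ t ω)
  set n := matNorm (R.V lam κ α (t - 1) ω)⁻¹ (R.dzstar φ t ω) with hn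
  have hn0 : 0 ≤ n := matNorm_nonneg _ _
  rw [dualDir, ← hn, matNorm_eq_sqrt_bil, bil_smul_left, bil_smul_right, ← sq_matNorm
    hV.posSemidef, h]
  refine Real.sqrt_le_iff.2 ⟨zero_le_one, ?_⟩
  -- In the degenerate case `0⁻¹ = 0`, so the direction is the zero vector.
  by_cases h0 : n = 0
  · rw [h0]; simp
  · refine le_of_eq ?_
    field_simp

theorem norm_dualDir_le (hl : 0 < lam) (hκ : 0 < κ) (hα : 0 < α) :
    ‖R.dualDir φ lam κ α t ω‖ ≤ 1 / Real.sqrt lam := by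
  rw [le_div_iff₀ (Real.sqrt_pos.2 hl), mul_comm]
  exact (norm_le_matNorm_designMatrix hl hκ hα (t - 1) _).trans (matNorm_dualDir_le hl hκ hα)

/-- The dual direction attains the norm of `Δz*` and has `V`-norm at most one, so its pairing with
`Δz` is at most the observed width. The rest is a martingale difference. -/
theorem matNorm_dzstar_le (hl : 0 < lam) (hκ : 0 < κ) (hα : 0 < α) :
    matNorm (R.V lam κ α (t - 1) ω)⁻¹ (R.dzstar φ t ω) ≤
      matNorm (R.V lam κ α (t - 1) ω)⁻¹ (R.dz t ω) +
        inner ℝ (R.dualDir φ lam κ α t ω) (R.dzstar φ t ω - R.dz t ω) := by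
  have hV : (R.V lam κ α (t - 1) ω).PosDef := designMatrix_posDef hl hκ hα (t - 1)
  have h1 : (inner ℝ (R.dualDir φ lam κ α t ω) (R.dzstar φ t ω) : ℝ) =
      matNorm (R.V lam κ α (t - 1) ω)⁻¹ (R.dzstar φ t ω) := by
    rw [dualDir, real_inner_smul_left, real_inner_comm, ← bil_eq_inner,
      ← sq_matNorm hV.inv.posSemidef]
    by_cases h0 : matNorm (R.V lam κ α (t - 1) ω)⁻¹ (R.dzstar φ t ω) = 0
    · rw [h0]; simp
    · field_simp
  have h2 := (inner_le_matNorm hV (R.dualDir φ lam κ α t ω) (R.dz t ω)).trans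
    (mul_le_of_le_one_left (matNorm_nonneg _ _) (matNorm_dualDir_le hl hκ hα))
  rw [inner_sub_right, h1]
  linarith

/-- The factor `√λ / 2` normalizes the differences to `[-1, 1]`, as `measure_sum_lt_le` requires. -/
theorem abs_inner_dualDir_le (hl : 0 < lam) (hκ : 0 < κ) (hα : 0 < α)
    (h1 : ‖R.dz t ω‖ ≤ 1) (h2 : ‖R.dzstar φ t ω‖ ≤ 1) :
    |Real.sqrt lam / 2 * inner ℝ (R.dualDir φ lam κ α t ω) (R.dzstar φ t ω - R.dz t ω)| ≤ 1 := by
  have hs := Real.sqrt_pos.2 hl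
  rw [abs_mul, abs_of_pos (by positivity)]
  have h3 := abs_real_inner_le_norm (R.dualDir φ lam κ α t ω) (R.dzstar φ t ω - R.dz t ω)
  have h4 : ‖R.dzstar φ t ω - R.dz t ω‖ ≤ 2 := (norm_sub_le _ _).trans (by linarith)
  calc _ ≤ Real.sqrt lam / 2 * (1 / Real.sqrt lam * 2) := by
        gcongr
        exact h3.trans (mul_le_mul (norm_dualDir_le hl hκ hα) h4 (norm_nonneg _) (by positivity))
    _ = 1 := by field_simp

variable [mΩ : MeasurableSpace Ω] {P : Measure Ω} {pre mid : ℕ → MeasurableSpace Ω}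

namespace IsEnvironment

/-- Predictability holds because `V_{t-1}` involves only earlier rounds, and `Δz*_t` only the
contexts and arms of round `t`. -/
theorem measurable_dualDir (hE : R.IsEnvironment P g φ θs T pre mid) (hφ : Measurable φ)
    (ht : t ∈ Finset.Icc 1 T) : Measurable[pre t] (R.dualDir φ lam κ α t) := by
  have ht' : 1 ≤ t ∧ t ≤ T := by simpa using ht
  have hV : ∀ i j, Measurable[pre t] fun ω => (R.V lam κ α (t - 1) ω)⁻¹ i j := fun i j =>
    (hE.measurable_V_inv (by omega) i j).mono (hE.mid_le_of_lt (by omega)) le_rfl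
  have hz := hE.measurable_dzstar hφ ht
  have h1 := measurable_matNorm hV hz
  have h2 := measurable_act hV hz
  exact h1.inv.smul h2

variable [IsProbabilityMeasure P]

/-- The sum of the noise-free widths exceeds the sum of the observed widths by at most `√T`,
up to logarithms. -/
theorem measure_sum_dzstar_le (hE : R.IsEnvironment P g φ θs T pre mid)
    (hB : R.BoundedFeatures P T) (hφ : Measurable φ) (hl : 0 < lam) (hκ : 0 < κ) (hα : 0 < α)
    (hT : 1 ≤ T) {ε : ℝ} (hε : 0 < ε) :
    P {ω | ∑ t ∈ Finset.Icc 1 T, matNorm (R.V lam κ α (t - 1) ω)⁻¹ (R.dz t ω) +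
        2 / Real.sqrt lam * (Real.sqrt T * (1 / 2 + Real.log (1 / ε))) <
      ∑ t ∈ Finset.Icc 1 T, matNorm (R.V lam κ α (t - 1) ω)⁻¹ (R.dzstar φ t ω)} ≤
      ENNReal.ofReal ε := by
  have hs := Real.sqrt_pos.2 hl
  set ξ : ℕ → Ω → ℝ := fun t ω =>
    inner ℝ (R.dualDir φ lam κ α t ω) (R.dzstar φ t ω - R.dz t ω) with hξ
  have hξm : ∀ t ∈ Finset.Icc 1 T, Measurable[pre (t + 1)] (ξ t) := by
    intro t ht
    have h1 := (hE.measurable_dualDir (lam := lam) (κ := κ) (α := α) hφ ht).mono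
      (hE.pre_mono (Nat.le_succ t)) le_rfl
    have h2 := (hE.measurable_dzstar hφ ht).mono (hE.pre_mono (Nat.le_succ t)) le_rfl
    have h3 := (hE.measurable_dz ht).mono (hE.mid_le_pre t) le_rfl
    exact Measurable.inner h1 (h2.sub h3)
  have hmain := measure_sum_lt_le (P := P) hE.pre_mono hE.pre_le
    (η := fun t ω => Real.sqrt lam / 2 * ξ t ω) hT
    (fun t ht => (hξm t ht).const_mul _)
    (fun t ht => by
      filter_upwards [hB.ae_norm_dz_le, hE.ae_norm_dzstar_le hB] with ω h1 h2
      exact abs_inner_dualDir_le hl hκ hα (h1 t ht) (h2 t ht))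
    (fun t ht => by
      have h1 := hE.condExp_inner_dzstar_sub hB hφ ht
        (hE.measurable_dualDir (lam := lam) (κ := κ) (α := α) hφ ht)
        (Filter.Eventually.of_forall fun ω => norm_dualDir_le hl hκ hα)
      have h2 := condExp_smul (μ := P) (Real.sqrt lam / 2) (ξ t) (pre t)
      refine (show P[fun ω => Real.sqrt lam / 2 * ξ t ω | pre t] =ᵐ[P] _ from h2).trans ?_
      filter_upwards [h1] with ω h3
      rw [Pi.smul_apply, h3]
      simp) hε
  refine (measure_mono fun ω hω => ?_).trans hmain
  simp only [Set.mem_ofPred_eq] at hω ⊢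
  have h1 : ∑ t ∈ Finset.Icc 1 T, matNorm (R.V lam κ α (t - 1) ω)⁻¹ (R.dzstar φ t ω) ≤
      ∑ t ∈ Finset.Icc 1 T, matNorm (R.V lam κ α (t - 1) ω)⁻¹ (R.dz t ω) +
        ∑ t ∈ Finset.Icc 1 T, ξ t ω := by
    rw [← Finset.sum_add_distrib]
    exact Finset.sum_le_sum fun t _ => matNorm_dzstar_le hl hκ hα
  rw [← Finset.mul_sum]
  have h2 : 2 / Real.sqrt lam * (Real.sqrt T * (1 / 2 + Real.log (1 / ε))) <
      ∑ t ∈ Finset.Icc 1 T, ξ t ω := by linarith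
  have h3 := mul_lt_mul_of_pos_left h2 (show 0 < Real.sqrt lam / 2 by positivity)
  have e : Real.sqrt lam / 2 * (2 / Real.sqrt lam * (Real.sqrt T * (1 / 2 + Real.log (1 / ε)))) =
      Real.sqrt T * (1 / 2 + Real.log (1 / ε)) := by field_simp
  rwa [e] at h3

end IsEnvironment

end Run

/-! ### Elementary inequalities for logarithms and sums -/

/-- Bernoulli's inequality. It removes the `κ` of the elliptical potential, which does not occur
inside the logarithm of `confRadius`. -/
theorem log_one_add_mul_le {κ y : ℝ} (hκ : 0 ≤ κ) (hy : 0 ≤ y) :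
    Real.log (1 + κ * y) ≤ (1 + κ) * Real.log (1 + y) := by
  rw [← Real.log_rpow (by linarith)]
  refine Real.log_le_log (by positivity) ?_
  have h := one_add_mul_self_le_rpow_one_add (s := y) (p := 1 + κ) (by linarith) (by linarith)
  nlinarith

/-- Bernoulli again: `d log (1 + y / d)` is bounded below independently of `d`, so that additive
constants can be absorbed into the confidence radius. -/
theorem log_one_add_le_mul_log_one_add_div {d : ℕ} (hd : 1 ≤ d) {y : ℝ} (hy : 0 ≤ y) :
    Real.log (1 + y) ≤ d * Real.log (1 + y / d) := by
  have hd' : (0 : ℝ) < d := by exact_mod_cast hd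
  rw [← Real.log_pow]
  refine Real.log_le_log (by positivity) ?_
  have h0 : 0 ≤ y / d := by positivity
  have h := one_add_mul_le_pow (a := y / d) (by linarith) d
  rwa [mul_div_cancel₀ _ hd'.ne'] at h

theorem sum_one_div_mul_succ_le (T : ℕ) :
    ∑ t ∈ Finset.Icc 1 T, 1 / ((t : ℝ) * (t + 1)) ≤ 1 := by
  have h : ∑ t ∈ Finset.Icc 1 T, 1 / ((t : ℝ) * (t + 1)) = 1 - 1 / ((T : ℝ) + 1) := by
    induction T with
    | zero => simp
    | succ T ih =>
      rw [Finset.sum_Icc_succ_top (by omega), ih]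
      push_cast
      field_simp
      ring
  rw [h]
  have : 0 ≤ 1 / ((T : ℝ) + 1) := by positivity
  linarith

/-- Bernoulli's inequality for the exponent `1 - a ≤ 1`, applied to `1 - 1 / (n + 1)`. The factor
`2` bounds `1 / (1 - a)`, as `a ≤ 1 / 2`. -/
theorem one_div_rpow_le {a : ℝ} (ha0 : 0 < a) (ha : a ≤ 1 / 2) (n : ℕ) :
    1 / ((n : ℝ) + 1) ^ a ≤ 2 * (((n : ℝ) + 1) ^ (1 - a) - (n : ℝ) ^ (1 - a)) := by
  set x : ℝ := (n : ℝ) + 1 with hx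
  have hx1 : 1 ≤ x := by rw [hx]; linarith [Nat.cast_nonneg (α := ℝ) n]
  have hxpos : 0 < x := by linarith
  have hb := rpow_one_add_le_one_add_mul_self (s := -(1 / x)) (p := 1 - a)
    (by
      have : 1 / x ≤ 1 := by rw [div_le_one hxpos]; exact hx1
      linarith) (by linarith) (by linarith)
  have e1 : 1 + -(1 / x) = n / x := by rw [hx]; field_simp; ring
  rw [e1, Real.div_rpow (Nat.cast_nonneg n) hxpos.le] at hb
  have hxp : 0 < x ^ (1 - a) := Real.rpow_pos_of_pos hxpos _
  rw [div_le_iff₀ hxp] at hb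
  have e2 : x ^ (1 - a) = x * (1 / x ^ a) := by
    rw [Real.rpow_sub hxpos, Real.rpow_one]; ring
  have h3 : 0 < 1 / x ^ a := by positivity
  have e3 : (1 - a) * -(1 / x) * x ^ (1 - a) = -((1 - a) * (1 / x ^ a)) := by
    rw [e2]; field_simp
  nlinarith

theorem sum_one_div_rpow_le {a : ℝ} (ha0 : 0 < a) (ha : a ≤ 1 / 2) (n : ℕ) :
    ∑ s ∈ Finset.Icc 1 n, 1 / (s : ℝ) ^ a ≤ 2 * (n : ℝ) ^ (1 - a) := by
  induction n with
  | zero =>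
    have : (0 : ℝ) ^ (1 - a) = 0 := Real.zero_rpow (by linarith)
    simp [this]
  | succ n ih =>
    rw [Finset.sum_Icc_succ_top (by omega)]
    have := one_div_rpow_le ha0 ha n
    push_cast
    linarith

section LogBounds

variable {t T δ : ℝ}

theorem log_div_nonneg (ht : 1 ≤ t) (hδ0 : 0 < δ) (hδ1 : δ < 1) : 0 ≤ Real.log (t / δ) := by
  refine Real.log_nonneg ?_
  rw [le_div_iff₀ hδ0]
  linarith

theorem log_le_log_div (ht : 1 ≤ t) (hδ0 : 0 < δ) (hδ1 : δ < 1) :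
    Real.log t ≤ Real.log (t / δ) := by
  refine Real.log_le_log (by linarith) ?_
  rw [le_div_iff₀ hδ0]
  nlinarith

theorem log_mul_sq_div_le {k : ℝ} (hk : 0 < k) (ht : 1 ≤ t) (hδ0 : 0 < δ) (hδ1 : δ < 1) :
    Real.log (k * t ^ 2 / δ) ≤ Real.log k + 2 * Real.log (t / δ) := by
  have ht0 : 0 < t := by linarith
  rw [show (2 : ℝ) * Real.log (t / δ) = Real.log ((t / δ) ^ 2) by rw [Real.log_pow]; norm_num,
    ← Real.log_mul hk.ne' (by positivity)]
  refine Real.log_le_log (by positivity) ?_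
  rw [div_pow, mul_div_assoc]
  refine mul_le_mul_of_nonneg_left ?_ hk.le
  refine div_le_div_of_nonneg_left (by positivity) (by positivity) ?_
  nlinarith

theorem log_four_lt_two : Real.log 4 < 2 := by
  rw [show (4 : ℝ) = 2 ^ 2 by norm_num, Real.log_pow]
  have := Real.log_two_lt_d9
  push_cast
  linarith

theorem log_eight_lt_three : Real.log 8 < 3 := by
  rw [show (8 : ℝ) = 2 ^ 3 by norm_num, Real.log_pow]
  have := Real.log_two_lt_d9
  push_cast
  linarith

theorem log_union_weight_le (ht : 1 ≤ t) (hδ0 : 0 < δ) (hδ1 : δ < 1) :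
    Real.log (1 / (δ / 4 * (1 / (t * (t + 1))))) ≤ 3 * (1 + Real.log (t / δ)) := by
  have h1 : 1 / (δ / 4 * (1 / (t * (t + 1)))) ≤ 8 * t ^ 2 / δ := by
    have : 0 < t := by linarith
    rw [show 1 / (δ / 4 * (1 / (t * (t + 1)))) = 4 * (t * (t + 1)) / δ by field_simp]
    refine div_le_div_of_nonneg_right ?_ hδ0.le
    nlinarith
  have h2 : 0 < 1 / (δ / 4 * (1 / (t * (t + 1)))) := by
    have : 0 < t := by linarith
    positivity
  have h3 := (Real.log_le_log h2 h1).trans (log_mul_sq_div_le (by norm_num) ht hδ0 hδ1)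
  have := log_eight_lt_three
  have := log_div_nonneg ht hδ0 hδ1
  linarith

theorem log_four_div_le (hT : 1 ≤ T) (hδ0 : 0 < δ) (hδ1 : δ < 1) :
    1 / 2 + Real.log (1 / (δ / 4)) ≤ 3 * (1 + Real.log (T / δ)) := by
  have h : 1 / (δ / 4) ≤ 4 * T ^ 2 / δ := by
    rw [show 1 / (δ / 4) = 4 / δ by field_simp]
    refine div_le_div_of_nonneg_right ?_ hδ0.le
    nlinarith
  have h3 := (Real.log_le_log (by positivity) h).trans (log_mul_sq_div_le (by norm_num) hT hδ0 hδ1)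
  have := log_four_lt_two
  have := log_div_nonneg hT hδ0 hδ1
  linarith

theorem log_one_add_div_le {k d : ℝ} (hk : 0 ≤ k) (hd : 1 ≤ d) (hT : 1 ≤ T) (hδ0 : 0 < δ)
    (hδ1 : δ < 1) : Real.log ((1 + k * T / d) / δ) ≤ (1 + k) * (1 + Real.log (T / δ)) := by
  have hT0 : 0 < T := by linarith
  have h1 : 1 + k * T / d ≤ (1 + k) * T := by
    have : k * T / d ≤ k * T := div_le_self (by positivity) hd
    linarith
  have h2 : (1 + k * T / d) / δ ≤ (1 + k) * (T / δ) := by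
    rw [← mul_div_assoc]
    exact div_le_div_of_nonneg_right h1 hδ0.le
  have hd0 : 0 < d := by linarith
  have h3 := Real.log_le_log (by positivity) h2
  rw [Real.log_mul (by positivity) (by positivity)] at h3
  have h4 := Real.log_le_sub_one_of_pos (show 0 < 1 + k by linarith)
  have h5 := log_div_nonneg hT hδ0 hδ1
  nlinarith

theorem log_one_add_div_le' {k d : ℝ} (hk : 0 ≤ k) (hd : 1 ≤ d) (hT : 1 ≤ T) (hδ0 : 0 < δ)
    (hδ1 : δ < 1) : Real.log (1 + k * T / d) ≤ (1 + k) * (1 + Real.log (T / δ)) := by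
  refine le_trans (Real.log_le_log ?_ ?_) (log_one_add_div_le hk hd hT hδ0 hδ1)
  · have hT0 : 0 < T := by linarith
    have hd0 : 0 < d := by linarith
    positivity
  · rw [le_div_iff₀ hδ0]
    have hT0 : 0 < T := by linarith
    have hd0 : 0 < d := by linarith
    have : 0 ≤ k * T / d := by positivity
    nlinarith

end LogBounds

/-! ### The confidence radius -/

/-- The calibration of `α`: corruption and delay together contribute only `√d` to the radius. -/
theorem threshold_mul_add {d : ℕ} {C D : ℝ} (h : 0 < C + D) :
    threshold d C D * C + threshold d C D * D = Real.sqrt d := by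
  rw [← mul_add, threshold, div_mul_cancel₀ _ h.ne']

section ConfRadius

variable {ν lam M δ C D : ℝ} {d t T : ℕ}

theorem confRadius_mono (hν : 0 ≤ ν) (hl : 0 < lam) (hM : 0 ≤ M) (hδ0 : 0 < δ) (hδ1 : δ < 1)
    (hCD : 0 < C + D) (ht : 1 ≤ t) (htT : t ≤ T) :
    confRadius ν lam M δ d C D t ≤ confRadius ν lam M δ d C D T := by
  have ht' : (1 : ℝ) ≤ t := by exact_mod_cast ht
  have htT' : (t : ℝ) ≤ T := by exact_mod_cast htT
  have h0 := log_div_nonneg ht' hδ0 hδ1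
  have h1 : Real.log (t / δ) ≤ Real.log (T / δ) := Real.log_le_log (by positivity) (by gcongr)
  rw [confRadius, confRadius, add_assoc _ (_ * C), add_assoc _ (_ * C), threshold_mul_add hCD]
  have h2 : Real.log ((1 + t / (d * lam)) / δ) ≤ Real.log ((1 + T / (d * lam)) / δ) :=
    Real.log_le_log (by positivity) (by gcongr)
  have h3 : 0 ≤ ν * (1 + Real.log (T / δ)) := mul_nonneg hν (by linarith)
  gcongr

theorem confRadius_le (hν : 0 ≤ ν) (hl : 0 < lam) (hM : 0 ≤ M) (hδ0 : 0 < δ) (hδ1 : δ < 1)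
    (hCD : 0 < C + D) (hd : 1 ≤ d) (hT : 1 ≤ T) :
    confRadius ν lam M δ d C D T ≤ ν * (1 / 2 * (1 + 1 / lam) + Real.sqrt lam * M + 1) *
      ((1 + Real.log (T / δ)) ^ 2 * Real.sqrt d) := by
  have hT' : (1 : ℝ) ≤ T := by exact_mod_cast hT
  have hd' : (1 : ℝ) ≤ d := by exact_mod_cast hd
  have h0 := log_div_nonneg hT' hδ0 hδ1
  have h1 := log_one_add_div_le (k := 1 / lam) (by positivity) hd' hT' hδ0 hδ1
  rw [show 1 / lam * (T : ℝ) / d = T / (d * lam) by field_simp] at h1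
  set Lg := 1 + Real.log (T / δ) with hL
  have hL1 : 1 ≤ Lg := by linarith
  have hsd : 1 ≤ Real.sqrt d := Real.one_le_sqrt.2 hd'
  have hk : 1 ≤ (1 + 1 / lam) * Lg := by
    have : 0 ≤ 1 / lam := by positivity
    nlinarith
  have h2 : Real.sqrt (d * Real.log ((1 + T / (d * lam)) / δ)) ≤
      Real.sqrt d * ((1 + 1 / lam) * Lg) := by
    rw [Real.sqrt_mul (by positivity)]
    gcongr
    refine (Real.sqrt_le_sqrt h1).trans ?_
    rw [Real.sqrt_le_left (by linarith)]
    nlinarith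
  rw [confRadius, add_assoc _ (_ * C), threshold_mul_add hCD]
  have hsl := Real.sqrt_nonneg lam
  have hsM : 0 ≤ Real.sqrt lam * M := by positivity
  calc ν * Lg * (1 / 2 * Real.sqrt (d * Real.log ((1 + T / (d * lam)) / δ)) + Real.sqrt lam * M +
        Real.sqrt d)
      ≤ ν * Lg * (1 / 2 * (Real.sqrt d * ((1 + 1 / lam) * Lg)) +
          Real.sqrt lam * M * (Real.sqrt d * Lg) + Real.sqrt d * Lg) := by
        have e1 : 1 ≤ Real.sqrt d * Lg := one_le_mul_of_one_le_of_one_le hsd hL1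
        have e2 := le_mul_of_one_le_right hsM e1
        have e3 : Real.sqrt d ≤ Real.sqrt d * Lg := le_mul_of_one_le_right (by linarith) hL1
        refine mul_le_mul_of_nonneg_left ?_ (by positivity)
        linarith
    _ = _ := by ring

/-- The constant that makes the confidence radius large enough. -/
noncomputable def radiusConst (κ lam : ℝ) : ℝ :=
  2 * Real.sqrt ((1 + κ + 6 / Real.log (1 + 1 / lam)) / κ) +
    8 / (Real.sqrt lam * Real.sqrt (Real.log (1 + 1 / lam))) + 2

theorem log_one_add_inv_pos {lam : ℝ} (hl : 0 < lam) : 0 < Real.log (1 + 1 / lam) :=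
  Real.log_pos (by have : 0 < 1 / lam := by positivity
                   linarith)

theorem radiusConst_pos {κ lam : ℝ} (hκ : 0 < κ) (hl : 0 < lam) : 0 < radiusConst κ lam := by
  have := log_one_add_inv_pos hl
  rw [radiusConst]
  positivity

theorem two_le_radiusConst {κ lam : ℝ} : 2 ≤ radiusConst κ lam := by
  rw [radiusConst]
  have h1 := Real.sqrt_nonneg ((1 + κ + 6 / Real.log (1 + 1 / lam)) / κ)
  have h2 : 0 ≤ 8 / (Real.sqrt lam * Real.sqrt (Real.log (1 + 1 / lam))) := by positivity
  linarith

set_option maxHeartbeats 1000000 in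
/-- The error terms fit into the confidence radius. -/
theorem error_le_confRadius {κ Sn m G : ℝ} (hκ : 0 < κ) (hl : 0 < lam) (hν : radiusConst κ lam ≤ ν)
    (hM : 0 ≤ M) (hδ0 : 0 < δ) (hδ1 : δ < 1) (hC : 0 ≤ C) (hD : 0 ≤ D) (hCD : 0 < C + D)
    (hd : 1 ≤ d) (ht : 1 ≤ t)
    (hG : G ≤ d * Real.log (1 + κ * t / (d * lam)))
    (hS : κ / 2 * Sn ^ 2 - 1 / 2 * G ≤ 3 * (1 + Real.log (t / δ)))
    (hm : m ≤ (1 + Real.log (t / δ)) * (4 + 2 * D)) :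
    Real.sqrt lam * M + Sn + threshold d C D * C + m * min (threshold d C D) (1 / Real.sqrt lam) ≤
      confRadius ν lam M δ d C D t := by
  have ht' : (1 : ℝ) ≤ t := by exact_mod_cast ht
  have hd' : (1 : ℝ) ≤ d := by exact_mod_cast hd
  have hα : 0 ≤ threshold d C D := div_nonneg (Real.sqrt_nonneg _) hCD.le
  have hL0 := log_div_nonneg ht' hδ0 hδ1
  rw [confRadius]
  set α := threshold d C D
  set Lg := 1 + Real.log (t / δ) with hLg
  have hL1 : 1 ≤ Lg := by linarith
  set ρ := Real.log (1 + 1 / lam) with hρ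
  have hρ0 : 0 < ρ := log_one_add_inv_pos hl
  set E := (d : ℝ) * Real.log ((1 + t / (d * lam)) / δ) with hE
  have hsl : 0 < Real.sqrt lam := Real.sqrt_pos.2 hl
  set y := (t : ℝ) / (d * lam) with hy
  have hy0 : 0 ≤ y := by positivity
  have hE1 : d * Real.log (1 + y) ≤ E := by
    refine mul_le_mul_of_nonneg_left (Real.log_le_log (by positivity) ?_) (by positivity)
    rw [le_div_iff₀ hδ0]
    nlinarith
  -- A positive lower bound for `E` that depends on `λ` alone; it lets terms without a factor `d` be
  -- charged to `√E`.
  have hρE : ρ ≤ E := by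
    refine le_trans ?_ hE1
    have h1 := log_one_add_le_mul_log_one_add_div hd (y := t / lam) (by positivity)
    rw [div_div, mul_comm lam, ← hy] at h1
    refine le_trans (Real.log_le_log (by positivity) ?_) h1
    gcongr
  have hE0 : 0 < E := hρ0.trans_le hρE
  have hGE : G ≤ (1 + κ) * E := by
    refine hG.trans ?_
    have h1 := log_one_add_mul_le hκ.le hy0
    rw [hy, ← mul_div_assoc, ← hy] at h1
    calc (d : ℝ) * Real.log (1 + κ * t / (d * lam)) ≤ d * ((1 + κ) * Real.log (1 + y)) := by gcongr
      _ = (1 + κ) * (d * Real.log (1 + y)) := by ring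
      _ ≤ _ := by gcongr
  -- `1 + κ` comes from the gains, and `6 / ρ` from twice the deviation `3 * Lg`, charged to `E` by
  -- `ρ ≤ E`.
  set k := (1 + κ + 6 / ρ) / κ with hk
  have hk0 : 0 < k := by positivity
  have hSsq : Sn ^ 2 ≤ k * E * Lg ^ 2 := by
    have h1 : κ * Sn ^ 2 ≤ (1 + κ) * E + 6 * Lg := by linarith
    have h2 : (1 + κ) * E ≤ (1 + κ) * E * Lg ^ 2 :=
      le_mul_of_one_le_right (by positivity) (one_le_pow₀ hL1)
    have h3 : 6 * Lg ≤ 6 / ρ * E * Lg ^ 2 := by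
      have e1 : 1 ≤ E / ρ := by rw [one_le_div hρ0]; exact hρE
      have e2 : Lg ≤ Lg ^ 2 := by nlinarith
      calc 6 * Lg ≤ 6 * (E / ρ * Lg ^ 2) := by
            have := mul_le_mul e1 e2 (by linarith) (by positivity)
            linarith
        _ = _ := by ring
    have h4 : κ * (k * E * Lg ^ 2) = ((1 + κ) * E + 6 / ρ * E) * Lg ^ 2 := by
      rw [hk]; field_simp
    refine le_of_mul_le_mul_left ?_ hκ
    rw [h4]
    nlinarith
  have hSle : Sn ≤ Lg * (2 * Real.sqrt k * (1 / 2 * Real.sqrt E)) := by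
    have e : (Lg * (2 * Real.sqrt k * (1 / 2 * Real.sqrt E))) ^ 2 = k * E * Lg ^ 2 := by
      have e1 := Real.sq_sqrt hk0.le
      have e2 := Real.sq_sqrt hE0.le
      calc _ = Lg ^ 2 * (Real.sqrt k ^ 2 * Real.sqrt E ^ 2) := by ring
        _ = _ := by rw [e1, e2]; ring
    rw [← e] at hSsq
    exact (abs_le_of_sq_le_sq' hSsq (by positivity)).2
  have hmin0 : 0 ≤ min α (1 / Real.sqrt lam) := le_min hα (by positivity)
  have hmle : m * min α (1 / Real.sqrt lam) ≤
      Lg * (8 / (Real.sqrt lam * Real.sqrt ρ) * (1 / 2 * Real.sqrt E) + 2 * (α * D)) := by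
    have h1 := mul_le_mul_of_nonneg_right hm hmin0
    refine h1.trans ?_
    -- The constant number of missing outcomes uses `1 / √λ`, since `α` may be large; the part
    -- proportional to `D` uses `α`.
    have h2 : min α (1 / Real.sqrt lam) * (4 + 2 * D) ≤ 4 / Real.sqrt lam + 2 * (α * D) := by
      have e1 := mul_le_mul_of_nonneg_right (min_le_left α (1 / Real.sqrt lam)) hD
      have e2 := min_le_right α (1 / Real.sqrt lam)
      have e3 : 4 / Real.sqrt lam = 4 * (1 / Real.sqrt lam) := by ring
      rw [e3]
      nlinarith
    have h3 : 4 / Real.sqrt lam ≤ 8 / (Real.sqrt lam * Real.sqrt ρ) * (1 / 2 * Real.sqrt E) := by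
      have hsρ : 0 < Real.sqrt ρ := Real.sqrt_pos.2 hρ0
      have e1 : Real.sqrt ρ ≤ Real.sqrt E := Real.sqrt_le_sqrt hρE
      calc 4 / Real.sqrt lam = 8 / (Real.sqrt lam * Real.sqrt ρ) * (1 / 2 * Real.sqrt ρ) := by
            field_simp; norm_num
        _ ≤ _ := by gcongr
    calc Lg * (4 + 2 * D) * min α (1 / Real.sqrt lam)
        = Lg * (min α (1 / Real.sqrt lam) * (4 + 2 * D)) := by ring
      _ ≤ Lg * (4 / Real.sqrt lam + 2 * (α * D)) := by gcongr
      _ ≤ _ := by gcongr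
  have hν' : 2 * Real.sqrt k + 8 / (Real.sqrt lam * Real.sqrt ρ) + 2 ≤ ν := hν
  have n1 : 0 ≤ 2 * Real.sqrt k := by positivity
  have n2 : 0 ≤ 8 / (Real.sqrt lam * Real.sqrt ρ) := by positivity
  set A1 := 2 * Real.sqrt k
  set A2 := 8 / (Real.sqrt lam * Real.sqrt ρ)
  set H := 1 / 2 * Real.sqrt E with hH
  have hH0 : 0 ≤ H := by positivity
  have hsM : 0 ≤ Real.sqrt lam * M := by positivity
  have hαC : 0 ≤ α * C := by positivity
  have hαD : 0 ≤ α * D := by positivity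
  have hν1 : 1 ≤ ν := by linarith
  have f1 : Real.sqrt lam * M ≤ Lg * (ν * (Real.sqrt lam * M)) := by
    have : 1 ≤ Lg * ν := one_le_mul_of_one_le_of_one_le hL1 hν1
    rw [← mul_assoc]
    exact le_mul_of_one_le_left hsM this
  have f2 : α * C ≤ Lg * (ν * (α * C)) := by
    have : 1 ≤ Lg * ν := one_le_mul_of_one_le_of_one_le hL1 hν1
    rw [← mul_assoc]
    exact le_mul_of_one_le_left hαC this
  have f3 : Lg * (A1 * H) + Lg * (A2 * H + 2 * (α * D)) ≤ Lg * (ν * H + ν * (α * D)) := by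
    rw [← mul_add]
    refine mul_le_mul_of_nonneg_left ?_ (by linarith)
    have g1 := mul_le_mul_of_nonneg_right (show A1 + A2 ≤ ν by linarith) hH0
    have g2 := mul_le_mul_of_nonneg_right (show 2 ≤ ν by linarith) hαD
    linarith
  have : ν * Lg * (H + Real.sqrt lam * M + α * C + α * D) =
      Lg * (ν * (Real.sqrt lam * M)) + Lg * (ν * (α * C)) + Lg * (ν * H + ν * (α * D)) := by ring
  rw [this]
  linarith

end ConfRadius

/-! ### Summing the regret and collecting constants -/

theorem sum_pred_add (f : ℕ → ℝ) (T : ℕ) :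
    ∑ t ∈ Finset.Icc 1 T, f (t - 1) + f T = f 0 + ∑ t ∈ Finset.Icc 1 T, f t := by
  induction T with
  | zero => simp
  | succ T ih =>
    rw [Finset.sum_Icc_succ_top (by omega), Finset.sum_Icc_succ_top (by omega),
      Nat.add_sub_cancel]
    linarith

theorem sum_ite_eq_one_le {T : ℕ} {M : ℝ} (hM : 0 ≤ M) :
    ∑ t ∈ Finset.Icc 1 T, (if t = 1 then M else 0) ≤ M := by
  rw [Finset.sum_ite_eq']
  split_ifs
  · exact le_rfl
  · exact hM

namespace Run

variable {Ω : Type*} {dx dy K : ℕ} {R : Run Ω dx dy K} {g : ℝ → ℝ} {φ : Vec dx → Vec dy}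
  {θs : Feature dx dy} {T : ℕ} {lam κ α M : ℝ} {ω : Ω}

/-- The regret in terms of the confidence radius, the widths and the approximation errors. -/
theorem regret_le_sum (hl : 0 < lam) (hκ : 0 < κ) (hα : 0 < α) {β : ℕ → ℝ} {b N E a : ℝ}
    (hR : R.IsRCDPUCB g lam κ α (fun t => 2 * β t) T) (hM : ‖θs‖ ≤ M)
    (hβ : ∀ t ∈ Finset.Icc 1 T,
      matNorm (R.V lam κ α (t - 1) ω) (R.Θ (t - 1) ω - θs) ≤ β t)
    (hβb : ∀ t ∈ Finset.Icc 1 T, β t ≤ b) (hb : 0 ≤ b)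
    (hz : ∀ t ∈ Finset.Icc 1 T, ∀ k, ‖R.zstar φ t k ω‖ ≤ 1 / 2)
    (ha0 : 0 < a) (ha : a ≤ 1 / 2) (hE : 0 ≤ E)
    (he : ∀ t ∈ Finset.Icc 1 T, t ≠ 1 → ∀ k,
      ‖R.zhat t k ω - R.zstar φ t k ω‖ ≤ E / ((t - 1 : ℕ) : ℝ) ^ a)
    (hN : ∑ t ∈ Finset.Icc 1 T, matNorm (R.V lam κ α (t - 1) ω)⁻¹ (R.dzstar φ t ω) ≤ N) :
    R.regret φ θs T ω ≤ M + 3 / 2 * b * N +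
      (3 * b / Real.sqrt lam + 2 * M) * (E * (2 * (T : ℝ) ^ (1 - a))) := by
  have hM0 : 0 ≤ M := (norm_nonneg _).trans hM
  set e : ℕ → ℝ := fun s => E * (1 / (s : ℝ) ^ a) with hedef
  have he0 : ∀ s, 0 ≤ e s := fun s => by positivity
  have hc0 : 0 ≤ 3 * b / Real.sqrt lam + 2 * M := by positivity
  -- Round `t` uses the approximator of round `t - 1`, whose accuracy is assumed only from round `1`
  -- on. The first round is therefore charged `M`.
  have hround : ∀ t ∈ Finset.Icc 1 T, R.roundRegret φ θs t ω ≤ (if t = 1 then M else 0) +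
      3 / 2 * b * matNorm (R.V lam κ α (t - 1) ω)⁻¹ (R.dzstar φ t ω) +
      (3 * b / Real.sqrt lam + 2 * M) * e (t - 1) := by
    intro t ht
    have hn0 := matNorm_nonneg (R.V lam κ α (t - 1) ω)⁻¹ (R.dzstar φ t ω)
    split_ifs with h1
    · have h2 := (roundRegret_le_norm (θs := θs) (hz t ht)).trans hM
      have h3 := mul_nonneg hc0 (he0 (t - 1))
      have h4 : 0 ≤ 3 / 2 * b * matNorm (R.V lam κ α (t - 1) ω)⁻¹ (R.dzstar φ t ω) := by
        positivity
      linarith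
    · have h2 := roundRegret_le_width (θs := θs) (φ := φ) hl hκ hα rfl (hR.first_arm t ht ω)
        (hR.second_arm t ht ω) (hβ t ht) (he t ht h1)
      have e1 : E / ((t - 1 : ℕ) : ℝ) ^ a = e (t - 1) := by rw [hedef]; ring
      rw [e1] at h2
      refine h2.trans ?_
      have h3 := he0 (t - 1)
      calc _ ≤ 3 / 2 * b * (matNorm (R.V lam κ α (t - 1) ω)⁻¹ (R.dzstar φ t ω) +
            2 * e (t - 1) / Real.sqrt lam) + 2 * M * e (t - 1) := by
            gcongr
            exact hβb t ht
        _ = _ := by ring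
  have hsum := Finset.sum_le_sum hround
  rw [Finset.sum_add_distrib, Finset.sum_add_distrib, ← Finset.mul_sum, ← Finset.mul_sum] at hsum
  have hes : ∑ t ∈ Finset.Icc 1 T, e (t - 1) ≤ E * (2 * (T : ℝ) ^ (1 - a)) := by
    have h1 := sum_pred_add e T
    -- `0 ^ a = 0` and `1 / 0 = 0`, so the shift of the index introduces no boundary term.
    have h2 : e 0 = 0 := by simp [hedef, Real.zero_rpow ha0.ne']
    have h3 : ∑ t ∈ Finset.Icc 1 T, e t ≤ E * (2 * (T : ℝ) ^ (1 - a)) := by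
      rw [hedef, ← Finset.mul_sum]
      exact mul_le_mul_of_nonneg_left (sum_one_div_rpow_le ha0 ha T) hE
    have := he0 T
    linarith
  have h1 := sum_ite_eq_one_le (T := T) hM0
  have h2 := mul_le_mul_of_nonneg_left hN (show 0 ≤ 3 / 2 * b by positivity)
  have h3 := mul_le_mul_of_nonneg_left hes hc0
  change ∑ t ∈ Finset.Icc 1 T, R.roundRegret φ θs t ω ≤ _
  linarith

end Run

/-- The constant in front of the sum of the widths. -/
noncomputable def widthConst (κ lam : ℝ) : ℝ :=
  Real.sqrt ((1 + κ / lam) ^ 2 / κ) + (1 + κ / lam) ^ 2 / κ + 6 / Real.sqrt lam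

theorem widthConst_nonneg {κ lam : ℝ} (hκ : 0 < κ) : 0 ≤ widthConst κ lam := by
  rw [widthConst]; positivity

theorem sum_width_le {κ lam G Lg C D x : ℝ} {d T : ℕ} (hκ : 0 < κ) (hl : 0 < lam)
    (hd : 1 ≤ d) (hCD : 0 < C + D) (hLg : 1 ≤ Lg)
    (hG : G ≤ (1 + κ / lam) * (d * ((1 + κ / lam) * Lg))) (hx : x ≤ 3 * Lg) :
    Real.sqrt (T * (G / κ)) + G / (κ * threshold d C D) +
      2 / Real.sqrt lam * (Real.sqrt T * x) ≤
      widthConst κ lam * (Lg * Real.sqrt d * (Real.sqrt T + C + D)) := by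
  have hd' : (1 : ℝ) ≤ d := by exact_mod_cast hd
  have hsd : 1 ≤ Real.sqrt d := Real.one_le_sqrt.2 hd'
  have hsq : Real.sqrt d * Real.sqrt d = d := Real.mul_self_sqrt (by linarith)
  set c := (1 + κ / lam) ^ 2 / κ with hc
  have hc0 : 0 ≤ c := by positivity
  have hGc : G / κ ≤ c * (d * Lg) := by
    rw [div_le_iff₀ hκ]
    refine hG.trans (le_of_eq ?_)
    rw [hc]; field_simp
  have h1 : Real.sqrt (T * (G / κ)) ≤ Real.sqrt c * (Lg * Real.sqrt d * Real.sqrt T) := by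
    calc Real.sqrt (T * (G / κ)) ≤ Real.sqrt (T * (c * (d * Lg))) := by gcongr
      _ = Real.sqrt c * (Real.sqrt Lg * Real.sqrt d * Real.sqrt T) := by
          rw [Real.sqrt_mul (by positivity), Real.sqrt_mul hc0, Real.sqrt_mul (by positivity)]
          ring
      _ ≤ _ := by
          gcongr
          rw [Real.sqrt_le_left (by linarith)]
          nlinarith
  have h2 : G / (κ * threshold d C D) ≤ c * (Lg * Real.sqrt d * (C + D)) := by
    have e1 : G / (κ * threshold d C D) = G / κ * ((C + D) / Real.sqrt d) := by
      rw [threshold]; field_simp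
    rw [e1]
    calc G / κ * ((C + D) / Real.sqrt d) ≤ c * (d * Lg) * ((C + D) / Real.sqrt d) := by gcongr
      _ = _ := by
          nth_rewrite 1 [← hsq]; field_simp
  have h3 : 2 / Real.sqrt lam * (Real.sqrt T * x) ≤
      6 / Real.sqrt lam * (Lg * Real.sqrt d * Real.sqrt T) := by
    calc 2 / Real.sqrt lam * (Real.sqrt T * x) ≤ 2 / Real.sqrt lam * (Real.sqrt T * (3 * Lg)) := by
          gcongr
      _ = 6 / Real.sqrt lam * (Lg * 1 * Real.sqrt T) := by ring
      _ ≤ _ := by gcongr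
  have n1 : 0 ≤ Real.sqrt c * (Lg * Real.sqrt d * (C + D)) := by positivity
  have n2 : 0 ≤ c * (Lg * Real.sqrt d * Real.sqrt T) := by positivity
  have n3 : 0 ≤ 6 / Real.sqrt lam * (Lg * Real.sqrt d * (C + D)) := by positivity
  have e : widthConst κ lam * (Lg * Real.sqrt d * (Real.sqrt T + C + D)) =
      Real.sqrt c * (Lg * Real.sqrt d * Real.sqrt T) + Real.sqrt c * (Lg * Real.sqrt d * (C + D)) +
      (c * (Lg * Real.sqrt d * Real.sqrt T) + c * (Lg * Real.sqrt d * (C + D))) +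
      (6 / Real.sqrt lam * (Lg * Real.sqrt d * Real.sqrt T) +
      6 / Real.sqrt lam * (Lg * Real.sqrt d * (C + D))) := by
    rw [widthConst]; ring
  rw [e]
  linarith

/-- The constant in front of the confidence radius. -/
noncomputable def confConst (ν lam M : ℝ) : ℝ :=
  ν * (1 / 2 * (1 + 1 / lam) + Real.sqrt lam * M + 1)

/-- The constant of the regret bound. -/
noncomputable def regretConst (κ lam ν M C₀ : ℝ) : ℝ :=
  M + 3 / 2 * (confConst ν lam M * widthConst κ lam) +
    (3 * confConst ν lam M / Real.sqrt lam + 2 * M) * (4 * C₀)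

theorem confConst_nonneg {ν lam M : ℝ} (hν : 0 ≤ ν) (hl : 0 < lam) (hM : 0 ≤ M) :
    0 ≤ confConst ν lam M := by
  rw [confConst]; positivity

theorem regretConst_pos {κ lam ν M C₀ : ℝ} (hκ : 0 < κ) (hl : 0 < lam) (hν : 0 ≤ ν) (hM : 0 < M)
    (hC₀ : 0 ≤ C₀) : 0 < regretConst κ lam ν M C₀ := by
  have h1 := confConst_nonneg hν hl hM.le
  have h2 := widthConst_nonneg (lam := lam) hκ
  rw [regretConst]
  positivity

/-- The radius is of order `Lg ^ 2 * √d` and the widths of order `Lg * √d`; their product gives `Lg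
^ 3` and the full factor `d`. -/
theorem total_le {κ lam ν M C₀ Lg C D b N X : ℝ} {d T : ℕ} (hκ : 0 < κ) (hl : 0 < lam)
    (hν : 0 ≤ ν) (hM : 0 ≤ M) (hC₀ : 0 ≤ C₀) (hC : 0 ≤ C) (hD : 0 ≤ D) (hd : 1 ≤ d) (hT : 1 ≤ T)
    (hLg : 1 ≤ Lg) (hX : 0 ≤ X) (hb : b ≤ confConst ν lam M * (Lg ^ 2 * Real.sqrt d))
    (hb0 : 0 ≤ b) (hN : N ≤ widthConst κ lam * (Lg * Real.sqrt d * (Real.sqrt T + C + D))) :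
    M + 3 / 2 * b * N + (3 * b / Real.sqrt lam + 2 * M) * (C₀ * (2 * Lg) * (2 * X)) ≤
      regretConst κ lam ν M C₀ * Lg ^ 3 *
        (d * (Real.sqrt T + C + D) + X * (1 + Real.sqrt d)) := by
  have hd' : (1 : ℝ) ≤ d := by exact_mod_cast hd
  have hT' : (1 : ℝ) ≤ T := by exact_mod_cast hT
  have hsd : 1 ≤ Real.sqrt d := Real.one_le_sqrt.2 hd'
  have hsT : 1 ≤ Real.sqrt T := Real.one_le_sqrt.2 hT'
  have hsq : Real.sqrt d * Real.sqrt d = d := Real.mul_self_sqrt (by linarith)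
  have hw := widthConst_nonneg (lam := lam) hκ
  have hc := confConst_nonneg (ν := ν) hν hl hM
  set w := widthConst κ lam
  set c := confConst ν lam M
  set Y := (d : ℝ) * (Real.sqrt T + C + D) with hY
  set Z := X * (1 + Real.sqrt d) with hZ
  have hY1 : 1 ≤ Y := one_le_mul_of_one_le_of_one_le hd' (by linarith)
  have hZ0 : 0 ≤ Z := by positivity
  have hL3 : 1 ≤ Lg ^ 3 := one_le_pow₀ hLg
  have t1 : M ≤ M * (Lg ^ 3 * Y) :=
    le_mul_of_one_le_right hM (one_le_mul_of_one_le_of_one_le hL3 hY1)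
  have t2 : 3 / 2 * b * N ≤ 3 / 2 * (c * w) * (Lg ^ 3 * Y) := by
    calc 3 / 2 * b * N ≤ 3 / 2 * b * (w * (Lg * Real.sqrt d * (Real.sqrt T + C + D))) := by gcongr
      _ ≤ 3 / 2 * (c * (Lg ^ 2 * Real.sqrt d)) *
          (w * (Lg * Real.sqrt d * (Real.sqrt T + C + D))) := by gcongr
      _ = 3 / 2 * (c * w) * (Lg ^ 3 * ((Real.sqrt d * Real.sqrt d) * (Real.sqrt T + C + D))) := by
          ring
      _ = _ := by rw [hsq]
  have t3 : (3 * b / Real.sqrt lam + 2 * M) * (C₀ * (2 * Lg) * (2 * X)) ≤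
      (3 * c / Real.sqrt lam + 2 * M) * (4 * C₀) * (Lg ^ 3 * Z) := by
    have e1 : 3 * b / Real.sqrt lam + 2 * M ≤
        (3 * c / Real.sqrt lam + 2 * M) * (Lg ^ 2 * (1 + Real.sqrt d)) := by
      have f1 : b ≤ c * (Lg ^ 2 * (1 + Real.sqrt d)) := by
        refine hb.trans ?_
        gcongr
        linarith
      have f2 : 2 * M ≤ 2 * M * (Lg ^ 2 * (1 + Real.sqrt d)) :=
        le_mul_of_one_le_right (by linarith)
          (one_le_mul_of_one_le_of_one_le (one_le_pow₀ hLg) (by linarith))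
      calc 3 * b / Real.sqrt lam + 2 * M ≤ 3 * (c * (Lg ^ 2 * (1 + Real.sqrt d))) / Real.sqrt lam +
            2 * M * (Lg ^ 2 * (1 + Real.sqrt d)) := by gcongr
        _ = _ := by ring
    calc _ ≤ (3 * c / Real.sqrt lam + 2 * M) * (Lg ^ 2 * (1 + Real.sqrt d)) *
          (C₀ * (2 * Lg) * (2 * X)) := by gcongr
      _ = _ := by rw [hZ]; ring
  have n1 : 0 ≤ M * (Lg ^ 3 * Z) := by positivity
  have n2 : 0 ≤ 3 / 2 * (c * w) * (Lg ^ 3 * Z) := by positivity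
  have n3 : 0 ≤ (3 * c / Real.sqrt lam + 2 * M) * (4 * C₀) * (Lg ^ 3 * Y) := by positivity
  have e : regretConst κ lam ν M C₀ * Lg ^ 3 * (Y + Z) =
      M * (Lg ^ 3 * Y) + M * (Lg ^ 3 * Z) +
      (3 / 2 * (c * w) * (Lg ^ 3 * Y) + 3 / 2 * (c * w) * (Lg ^ 3 * Z)) +
      ((3 * c / Real.sqrt lam + 2 * M) * (4 * C₀) * (Lg ^ 3 * Y) +
      (3 * c / Real.sqrt lam + 2 * M) * (4 * C₀) * (Lg ^ 3 * Z)) := by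
    rw [regretConst]; ring
  rw [e]
  linarith

/-! ### Union bounds and the high probability regret bound -/

theorem measure_exists_le {Ω : Type*} [MeasurableSpace Ω] {P : Measure Ω} {B : ℕ → Set Ω}
    {ε : ℕ → ℝ} {x : ℝ} {T : ℕ} (hε : ∀ t ∈ Finset.Icc 1 T, 0 ≤ ε t)
    (h : ∀ t ∈ Finset.Icc 1 T, P (B t) ≤ ENNReal.ofReal (ε t))
    (hx : ∑ t ∈ Finset.Icc 1 T, ε t ≤ x) :
    P {ω | ∃ t ∈ Finset.Icc 1 T, ω ∈ B t} ≤ ENNReal.ofReal x := by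
  have e : {ω | ∃ t ∈ Finset.Icc 1 T, ω ∈ B t} = ⋃ t ∈ Finset.Icc 1 T, B t := by
    ext ω; simp
  rw [e]
  refine (measure_biUnion_finset_le _ _).trans ((Finset.sum_le_sum h).trans ?_)
  rw [← ENNReal.ofReal_sum_of_nonneg hε]
  exact ENNReal.ofReal_le_ofReal hx

theorem delayComplexity_nonneg (Lam muτ : ℝ) : 0 ≤ delayComplexity Lam muτ :=
  (Real.sqrt_nonneg _).trans (le_max_left _ _)

/-- The share of the failure probability that round `t` receives in a union bound. -/
noncomputable def roundShare (δ : ℝ) (t : ℕ) : ℝ := δ / 4 * (1 / ((t : ℝ) * (t + 1)))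

theorem roundShare_pos {δ : ℝ} (hδ : 0 < δ) {t T : ℕ} (ht : t ∈ Finset.Icc 1 T) :
    0 < roundShare δ t := by
  have : (1 : ℝ) ≤ t := by exact_mod_cast (Finset.mem_Icc.1 ht).1
  rw [roundShare]
  positivity

theorem sum_roundShare_le {δ : ℝ} (hδ : 0 < δ) (T : ℕ) :
    ∑ t ∈ Finset.Icc 1 T, roundShare δ t ≤ δ / 4 := by
  simp only [roundShare]
  rw [← Finset.mul_sum]
  exact mul_le_of_le_one_right (by positivity) (sum_one_div_mul_succ_le T)

namespace Run

variable {Ω : Type*} {dx dy K : ℕ} {R : Run Ω dx dy K} [mΩ : MeasurableSpace Ω] {P : Measure Ω}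
  {g : ℝ → ℝ} {φ : Vec dx → Vec dy} {θs : Feature dx dy} {T : ℕ}
  {pre mid : ℕ → MeasurableSpace Ω} {lam κ α δ : ℝ}

/-- The number of missing outcomes in either delay regime. -/
theorem measure_many_pending_le [IsProbabilityMeasure P] {Lam muτ : ℝ} (hμ : 0 ≤ muτ)
    (hτ : ∀ t ∈ Finset.Icc 1 T, Measurable (R.τ t))
    (h : (∃ σ : ℝ≥0, R.StochasticDelays P muτ σ T) ∨ R.AdversarialDelays P Lam T)
    (hδ0 : 0 < δ) (hδ1 : δ < 1) :
    P {ω | ∃ t ∈ Finset.Icc 1 T, ω ∈ {ω | (1 + Real.log (t / δ)) *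
      (4 + 2 * delayComplexity Lam muτ) < (R.pending t ω).card}} ≤ ENNReal.ofReal (δ / 4) := by
  rcases h with ⟨σ, hS⟩ | hA
  · refine measure_exists_le (fun t ht => (roundShare_pos hδ0 ht).le) (fun t ht => ?_)
      (sum_roundShare_le hδ0 T)
    refine (measure_mono fun ω hω => ?_).trans
      (measure_card_pending_le hμ hτ hS ht (roundShare_pos hδ0 ht))
    have ht1 : (1 : ℝ) ≤ t := by exact_mod_cast (Finset.mem_Icc.1 ht).1
    have h1 := log_union_weight_le ht1 hδ0 hδ1
    have h2 := log_le_log_div ht1 hδ0 hδ1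
    have h3 := log_div_nonneg ht1 hδ0 hδ1
    have h4 : muτ ≤ delayComplexity Lam muτ := le_max_right _ _
    have h5 : muτ * (1 + Real.log t) ≤ delayComplexity Lam muτ * (1 + Real.log (t / δ)) := by
      have := Real.log_nonneg ht1
      gcongr
      exact hμ.trans h4
    simp only [Set.mem_ofPred_eq] at hω ⊢
    refine lt_of_le_of_lt ?_ hω
    rw [roundShare]
    linarith
  · have h0 : ∀ᵐ ω ∂P, ω ∉ {ω | ∃ t ∈ Finset.Icc 1 T, ω ∈ {ω | (1 + Real.log (t / δ)) *
        (4 + 2 * delayComplexity Lam muτ) < (R.pending t ω).card}} := by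
      filter_upwards [hA] with ω hω
      rintro ⟨t, ht, h⟩
      have ht1 : (1 : ℝ) ≤ t := by exact_mod_cast (Finset.mem_Icc.1 ht).1
      have h1 := card_pending_le_of_sum_le (R := R) (Finset.mem_Icc.1 ht).2 hω
      have h3 := log_div_nonneg ht1 hδ0 hδ1
      have h4 : Real.sqrt Lam ≤ delayComplexity Lam muτ := le_max_left _ _
      have h5 : Real.sqrt (2 * Lam) ≤ 2 * Real.sqrt Lam := by
        rw [Real.sqrt_mul (by norm_num)]
        have : Real.sqrt 2 ≤ 2 := by
          rw [Real.sqrt_le_left (by norm_num)]; norm_num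
        gcongr
      have h6 := delayComplexity_nonneg Lam muτ
      have h : _ < _ := h
      nlinarith [mul_nonneg h3 h6]
    rw [measure_eq_zero_iff_ae_notMem.2 h0]
    exact zero_le

/-- The approximation error in all rounds. -/
theorem measure_approximation_le {𝒳 : Set (Vec dx)} {C₀ a r : ℝ}
    (hL : R.Learnability P φ 𝒳 C₀ a r T) (hC₀ : 0 ≤ C₀) (hδ0 : 0 < δ) (hδ1 : δ < 1)
    (hT : 1 ≤ T) :
    P {ω | ∃ t ∈ Finset.Icc 1 T, ω ∈ {ω | ∃ x ∈ 𝒳, C₀ * (2 * (1 + Real.log (T / δ))) *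
      (dx : ℝ) ^ r / (t : ℝ) ^ a < ‖R.phiHat t ω x - φ x‖}} ≤ ENNReal.ofReal (δ / 4) := by
  have hT1 : (1 : ℝ) ≤ T := by exact_mod_cast hT
  -- Equal shares over the rounds; they only double the logarithm, up to a constant.
  have hε : δ / (4 * T) ∈ Set.Ioo (0 : ℝ) 1 := by
    refine ⟨by positivity, ?_⟩
    rw [div_lt_one (by positivity)]
    linarith
  refine measure_exists_le (ε := fun _ => δ / (4 * T)) (fun t _ => hε.1.le) (fun t ht => ?_) ?_
  · refine (measure_mono fun ω hω => ?_).trans (hL t ht _ hε)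
    obtain ⟨x, hx, h⟩ := hω
    refine ⟨x, hx, lt_of_le_of_lt ?_ h⟩
    have ht1 : (1 : ℝ) ≤ t := by exact_mod_cast (Finset.mem_Icc.1 ht).1
    have htT : (t : ℝ) ≤ T := by exact_mod_cast (Finset.mem_Icc.1 ht).2
    have h1 : (t : ℝ) / (δ / (4 * T)) ≤ 4 * T ^ 2 / δ := by
      rw [show (t : ℝ) / (δ / (4 * T)) = 4 * (t * T) / δ by field_simp]
      refine div_le_div_of_nonneg_right ?_ hδ0.le
      nlinarith
    have h2 := (Real.log_le_log (div_pos (by linarith) hε.1) h1).trans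
      (log_mul_sq_div_le (by norm_num) hT1 hδ0 hδ1)
    have h3 := log_four_lt_two
    have h4 : Real.log (t / (δ / (4 * T))) ≤ 2 * (1 + Real.log (T / δ)) := by linarith
    have h5 : 0 ≤ C₀ * (dx : ℝ) ^ r / (t : ℝ) ^ a := by positivity
    calc _ ≤ C₀ * (dx : ℝ) ^ r / (t : ℝ) ^ a * (2 * (1 + Real.log (T / δ))) := by gcongr
      _ = _ := by ring
  · rw [Finset.sum_const, Nat.card_Icc, Nat.add_sub_cancel, nsmul_eq_mul]
    refine le_of_eq ?_
    field_simp

/-- On the event of the self-normalized bound and of few missing outcomes the true parameter lies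
in all confidence sets. -/
theorem matNorm_estimate_sub_le_confRadius {ν M C D : ℝ} {J : Set ℝ} {ω : Ω} (hd : 1 ≤ dx + dy)
    (hl : 0 < lam) (hκ : 0 < κ) (hν : radiusConst κ lam ≤ ν) (hM : ‖θs‖ ≤ M) (hδ0 : 0 < δ)
    (hδ1 : δ < 1) (hC : 0 ≤ C) (hD : 0 ≤ D) (hCD : 0 < C + D) (hα : α = threshold (dx + dy) C D)
    (hE : R.IsEnvironment P g φ θs T pre mid) (hJ : R.LinkAssumption P g κ θs T J)
    {c : ℕ → ℝ} (hR : R.IsRCDPUCB g lam κ α c T)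
    (htrue : ∀ s ∈ Finset.Icc 1 T, (inner ℝ θs (R.dz s ω) : ℝ) ∈ J)
    (hest : ∀ t < T, ∀ s ∈ Finset.Icc 1 t, (inner ℝ (R.Θ t ω) (R.dz s ω) : ℝ) ∈ J)
    (hΔ : ∀ s ∈ Finset.Icc 1 T, ‖R.dz s ω‖ ≤ 1)
    (hbudget : ∑ t ∈ Finset.Icc 1 T, |R.l t ω - R.o t ω| ≤ C)
    (hpot : ∀ t ∈ Finset.Icc 1 T,
      R.potential g θs lam κ α t ω ≤ Real.log (1 / roundShare δ t))
    (hpend : ∀ t ∈ Finset.Icc 1 T, ((R.pending t ω).card : ℝ) ≤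
      (1 + Real.log (t / δ)) * (4 + 2 * D)) {t : ℕ} (ht : t ∈ Finset.Icc 1 T) :
    matNorm (R.V lam κ α (t - 1) ω) (R.Θ (t - 1) ω - θs) ≤
      confRadius ν lam M δ (dx + dy) C D t := by
  have hM0 : 0 ≤ M := (norm_nonneg _).trans hM
  have hν2 : 2 ≤ ν := two_le_radiusConst.trans hν
  have hdpos : (1 : ℝ) ≤ (dx + dy : ℕ) := by exact_mod_cast hd
  have hα0 : 0 < α := by
    rw [hα]; exact div_pos (Real.sqrt_pos.2 (by linarith)) hCD
  have hne : Nonempty (Fin dx ⊕ Fin dy) := by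
    rw [← Fintype.card_pos_iff, Fintype.card_sum, Fintype.card_fin, Fintype.card_fin]
    omega
  obtain ⟨ht1, htT⟩ := Finset.mem_Icc.1 ht
  have ht1' : (1 : ℝ) ≤ t := by exact_mod_cast ht1
  -- In round one `Θ_0 = 0` and `V_0 = λ I`, so the error is exactly `√λ ‖Θ_*‖`.
  rcases Nat.eq_zero_or_pos (t - 1) with h0 | h0
  · rw [h0, hR.theta_zero ω, zero_sub, matNorm_neg, matNorm_eq_sqrt_bil, Run.V, bil_designMatrix]
    simp only [Finset.Icc_eq_empty (show ¬ 1 ≤ 0 by omega), Finset.sum_empty, mul_zero, add_zero]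
    rw [Real.sqrt_mul hl.le, Real.sqrt_sq (norm_nonneg _), confRadius, add_assoc _ (_ * C),
      threshold_mul_add hCD]
    have h1 := log_div_nonneg ht1' hδ0 hδ1
    have h2 : 1 ≤ ν * (1 + Real.log (t / δ)) :=
      one_le_mul_of_one_le_of_one_le (by linarith) (by linarith)
    have h3 : 0 ≤ Real.sqrt lam * M := by positivity
    have h4 : Real.sqrt lam * ‖θs‖ ≤ Real.sqrt lam * M := by gcongr
    have h5 : 0 ≤ Real.sqrt ((dx + dy : ℕ) * Real.log ((1 + t / ((dx + dy : ℕ) * lam)) / δ)) :=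
      Real.sqrt_nonneg _
    have h6 := Real.sqrt_nonneg ((dx + dy : ℕ) : ℝ)
    refine h4.trans (le_trans ?_ (mul_le_mul_of_nonneg_right h2 (by positivity)))
    linarith
  · have hmem : t - 1 ∈ Finset.Icc 1 T := by simp; omega
    have hsub : ∀ s ∈ Finset.Icc 1 (t - 1), s ∈ Finset.Icc 1 T := fun s hs => by
      simp at hs ⊢; omega
    -- The estimate of round `t - 1` satisfies the bound with index `t - 1`, while round `t` plays
    -- with index `t`.
    refine le_trans ?_ (confRadius_mono (by linarith) hl hM0 hδ0 hδ1 hCD h0 (Nat.sub_le t 1))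
    have hmain := matNorm_estimate_sub_le (θs := θs) hl hκ hα0 hJ.contDiff hJ.range hJ.ordConnected
      hJ.deriv_ge h0 (hR.theta_min _ hmem ω) (fun s hs => htrue s (hsub s hs))
      (hest (t - 1) (by omega)) (fun s hs => hΔ s (hsub s hs))
      (fun s hs => hE.binary_l s (hsub s hs) ω)
      ((Finset.sum_le_sum_of_subset_of_nonneg hsub fun _ _ _ => abs_nonneg _).trans hbudget)
    refine hmain.trans ?_
    have hG := sum_designGain_div_le (Δ := fun s => R.dz s ω) hl hκ hα0 (t - 1)
      (fun s hs => hΔ s (hsub s hs))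
    rw [Fintype.card_sum, Fintype.card_fin, Fintype.card_fin] at hG
    have hp := (hpot _ hmem).trans
      (log_union_weight_le (by exact_mod_cast h0) hδ0 hδ1)
    have hV : (R.V lam κ α (t - 1) ω).PosDef := designMatrix_posDef hl hκ hα0 (t - 1)
    rw [potential, ← sq_matNorm hV.inv.posSemidef] at hp
    have hfin := error_le_confRadius hκ hl hν hM0 hδ0 hδ1 hC hD hCD hd h0 hG hp (hpend _ hmem)
    rw [← hα] at hfin
    refine le_trans ?_ hfin
    gcongr

/-- The high probability regret bound of RCDP-UCB. -/
theorem measure_regret_le [IsProbabilityMeasure P] {ν M C₀ a r C Lam muτ : ℝ} {J : Set ℝ} {𝒳 : Set (Vec dx)}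
    (hdx : 1 ≤ dx) (hT : 1 ≤ T) (hl : 0 < lam) (hκ : 0 < κ) (hν : radiusConst κ lam ≤ ν)
    (hC₀ : 0 ≤ C₀) (ha0 : 0 < a) (ha : a ≤ 1 / 2) (hC : 0 ≤ C)
    (hμ : 0 ≤ muτ) (hCD : 0 < C + delayComplexity Lam muτ) (hδ0 : 0 < δ) (hδ1 : δ < 1)
    (hφ : Measurable φ) (hE : R.IsEnvironment P g φ θs T pre mid)
    (hbudget : R.CorruptionBudget P C T)
    (hdelay : (∃ σ : ℝ≥0, R.StochasticDelays P muτ σ T) ∨ R.AdversarialDelays P Lam T)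
    (hJ : R.LinkAssumption P g κ θs T J) (hM : ‖θs‖ ≤ M)
    (hx : ∀ t ∈ Finset.Icc 1 T, ∀ k ω, R.x t k ω ∈ 𝒳)
    (hL : R.Learnability P φ 𝒳 C₀ a r T) (hB : R.BoundedFeatures P T)
    (hR : R.IsRCDPUCB g lam κ (threshold (dx + dy) C (delayComplexity Lam muτ))
      (fun t => 2 * confRadius ν lam M δ (dx + dy) C (delayComplexity Lam muτ) t) T) :
    P {ω | regretConst κ lam ν M C₀ * (1 + Real.log (T / δ)) ^ 3 *
      ((dx + dy : ℝ) * (Real.sqrt T + C + delayComplexity Lam muτ) +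
        (T : ℝ) ^ (1 - a) * (dx : ℝ) ^ r * (1 + Real.sqrt (dx + dy))) <
      R.regret φ θs T ω} ≤ ENNReal.ofReal δ := by
  set D := delayComplexity Lam muτ with hDdef
  have hD : 0 ≤ D := delayComplexity_nonneg Lam muτ
  have hd : 1 ≤ dx + dy := by omega
  have hdpos : (1 : ℝ) ≤ (dx + dy : ℕ) := by exact_mod_cast hd
  have hT1 : (1 : ℝ) ≤ T := by exact_mod_cast hT
  have hM0 : 0 ≤ M := (norm_nonneg _).trans hM
  have hν0 : 0 ≤ ν := (radiusConst_pos hκ hl).le.trans hν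
  set α := threshold (dx + dy) C D with hαdef
  have hα : 0 < α := div_pos (Real.sqrt_pos.2 (by linarith)) hCD
  have hne : Nonempty (Fin dx ⊕ Fin dy) := ⟨Sum.inl ⟨0, hdx⟩⟩
  have hlog := log_div_nonneg hT1 hδ0 hδ1
  set B₁ : Set Ω := {ω | ∃ t ∈ Finset.Icc 1 T, ω ∈ {ω | Real.log (1 / roundShare δ t) <
    R.potential g θs lam κ α t ω}} with hB₁
  set B₂ : Set Ω := {ω | ∃ t ∈ Finset.Icc 1 T, ω ∈ {ω | (1 + Real.log (t / δ)) *
      (4 + 2 * D) < (R.pending t ω).card}} with hB₂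
  set B₃ : Set Ω := {ω | ∃ t ∈ Finset.Icc 1 T, ω ∈ {ω | ∃ x ∈ 𝒳,
    C₀ * (2 * (1 + Real.log (T / δ))) * (dx : ℝ) ^ r / (t : ℝ) ^ a <
      ‖R.phiHat t ω x - φ x‖}} with hB₃
  set B₄ : Set Ω := {ω | ∑ t ∈ Finset.Icc 1 T, matNorm (R.V lam κ α (t - 1) ω)⁻¹ (R.dz t ω) +
        2 / Real.sqrt lam * (Real.sqrt T * (1 / 2 + Real.log (1 / (δ / 4)))) <
      ∑ t ∈ Finset.Icc 1 T, matNorm (R.V lam κ α (t - 1) ω)⁻¹ (R.dzstar φ t ω)} with hB₄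
  have hP₁ : P B₁ ≤ ENNReal.ofReal (δ / 4) :=
    measure_exists_le (fun t ht => (roundShare_pos hδ0 ht).le)
      (fun t ht => hE.measure_noiseSum_le hB hJ.contDiff.continuous hJ.range hl hκ hα
        (Finset.mem_Icc.1 ht).2 (roundShare_pos hδ0 ht)) (sum_roundShare_le hδ0 T)
  have hP₂ : P B₂ ≤ ENNReal.ofReal (δ / 4) :=
    measure_many_pending_le hμ hE.measurable_τ hdelay hδ0 hδ1
  have hP₃ : P B₃ ≤ ENNReal.ofReal (δ / 4) := measure_approximation_le hL hC₀ hδ0 hδ1 hT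
  have hP₄ : P B₄ ≤ ENNReal.ofReal (δ / 4) :=
    hE.measure_sum_dzstar_le hB hφ hl hκ hα hT (by positivity)
  have hunion : P (B₁ ∪ B₂ ∪ (B₃ ∪ B₄)) ≤ ENNReal.ofReal δ := by
    have h : ENNReal.ofReal δ = ENNReal.ofReal (δ / 4) + ENNReal.ofReal (δ / 4) +
        (ENNReal.ofReal (δ / 4) + ENNReal.ofReal (δ / 4)) := by
      have hp : 0 ≤ δ / 4 := by positivity
      rw [← ENNReal.ofReal_add hp hp, ← ENNReal.ofReal_add (by positivity) (by positivity)]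
      congr 1
      ring
    rw [h]
    exact (measure_union_le _ _).trans (add_le_add
      ((measure_union_le _ _).trans (add_le_add hP₁ hP₂))
      ((measure_union_le _ _).trans (add_le_add hP₃ hP₄)))
  -- The bad events need not be measurable, since training and estimates are unrestricted;
  -- monotonicity and subadditivity of the outer measure suffice.
  refine le_trans (measure_mono_ae ?_) hunion
  filter_upwards [hJ.true_mem, hJ.estimate_mem, hB.ae_norm_dz_le, hE.ae_norm_zstar_le hB,
    hbudget] with ω htrue hest hΔ hz hbud
  intro hbad
  by_contra hgood
  change ω ∉ B₁ ∪ B₂ ∪ (B₃ ∪ B₄) at hgood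
  simp only [Set.mem_union, not_or] at hgood
  obtain ⟨⟨g₁, g₂⟩, g₃, g₄⟩ := hgood
  simp only [hB₁, hB₂, hB₃, hB₄, Set.mem_ofPred_eq, not_exists, not_and, not_lt] at g₁ g₂ g₃ g₄
  refine absurd hbad (not_lt.2 ?_)
  have hconf := fun t ht => matNorm_estimate_sub_le_confRadius (t := t) hd hl hκ hν hM hδ0 hδ1
    hC hD hCD hαdef hE hJ hR htrue hest hΔ hbud g₁ g₂ ht
  have hTmem : T ∈ Finset.Icc 1 T := by simp [hT]
  set b := confRadius ν lam M δ (dx + dy) C D T with hb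
  have hb0 : 0 ≤ b := (matNorm_nonneg _ _).trans (hconf T hTmem)
  have hG := sum_designGain_le (Δ := fun s => R.dz s ω) hl hκ hα T hΔ
  rw [Fintype.card_sum, Fintype.card_fin, Fintype.card_fin] at hG
  have hlogG := log_one_add_div_le' (k := κ / lam) (by positivity) hdpos hT1 hδ0 hδ1
  rw [show κ / lam * (T : ℝ) / ((dx + dy : ℕ) : ℝ) = κ * T / ((dx + dy : ℕ) * lam) by
    field_simp] at hlogG
  have hG' : ∑ s ∈ Finset.Icc 1 T, designGain lam κ α (fun s => R.dz s ω) s ≤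
      (1 + κ / lam) * ((dx + dy : ℕ) * ((1 + κ / lam) * (1 + Real.log (T / δ)))) :=
    hG.trans (by gcongr)
  have hwidth := sum_width_le (C := C) (D := D) (T := T) hκ hl hd hCD
    (show 1 ≤ 1 + Real.log (T / δ) by linarith) hG' (log_four_div_le hT1 hδ0 hδ1)
  have hobs := sum_matNorm_le (Δ := fun s => R.dz s ω) hl hκ hα T
  have hN := g₄.trans (add_le_add hobs le_rfl)
  rw [← hαdef] at hwidth
  have hreg := regret_le_sum (φ := φ) hl hκ hα hR hM hconf
    (fun t ht => confRadius_mono hν0 hl hM0 hδ0 hδ1 hCD (Finset.mem_Icc.1 ht).1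
      (Finset.mem_Icc.1 ht).2) hb0 hz ha0 ha
    (E := C₀ * (2 * (1 + Real.log (T / δ))) * (dx : ℝ) ^ r) (by positivity)
    (fun t ht h1 k => by
      rw [norm_zhat_sub_zstar]
      have ht' := Finset.mem_Icc.1 ht
      exact g₃ (t - 1) (by simp; omega) _ (hx t ht k ω)) (hN.trans hwidth)
  have htot := total_le (X := (T : ℝ) ^ (1 - a) * (dx : ℝ) ^ r) hκ hl hν0 hM0 hC₀ hC hD hd hT
    (show 1 ≤ 1 + Real.log (T / δ) by linarith) (by positivity)
    (confRadius_le hν0 hl hM0 hδ0 hδ1 hCD hd hT) hb0 le_rfl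
  push_cast at htot
  refine le_trans (hreg.trans (le_of_eq ?_)) htot
  push_cast
  ring

end Run

end RCDP

/-! ### The theorem -/

theorem mainTheorem1 :
    ∃ p : ℕ, ∀ κ lam : ℝ, 0 < κ → 0 < lam → ∃ ν₀ : ℝ, 0 < ν₀ ∧ ∀ ν : ℝ, ν₀ ≤ ν →
    ∀ M C₀ a r : ℝ, 0 < M → 0 < C₀ → 0 < a → a ≤ 1 / 2 → (r = 1 / 2 ∨ r = a) →
    ∃ c : ℝ, 0 < c ∧
    ∀ (dx dy K T : ℕ), 1 ≤ dx → 1 ≤ T →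
    ∀ (C Lam muτ : ℝ), 0 ≤ C → 0 ≤ Lam → 0 ≤ muτ → 0 < C + RCDP.delayComplexity Lam muτ →
    ∀ δ ∈ Set.Ioo (0 : ℝ) 1,
    ∀ (Ω : Type*) [MeasurableSpace Ω] (P : Measure Ω) [IsProbabilityMeasure P]
      (R : RCDP.Run Ω dx dy K) (pre mid : ℕ → MeasurableSpace Ω)
      (g : ℝ → ℝ) (J : Set ℝ) (φ : RCDP.Vec dx → RCDP.Vec dy) (𝒳 : Set (RCDP.Vec dx))
      (θs : RCDP.Feature dx dy),
      Measurable φ →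
      R.IsEnvironment P g φ θs T pre mid →
      R.CorruptionBudget P C T →
      ((∃ σ : ℝ≥0, R.StochasticDelays P muτ σ T) ∨ R.AdversarialDelays P Lam T) →
      R.LinkAssumption P g κ θs T J →
      ‖θs‖ ≤ M →
      (∀ t ∈ Finset.Icc 1 T, ∀ k ω, R.x t k ω ∈ 𝒳) →
      R.Learnability P φ 𝒳 C₀ a r T →
      R.BoundedFeatures P T →
      R.IsRCDPUCB g lam κ (RCDP.threshold (dx + dy) C (RCDP.delayComplexity Lam muτ))
        (fun t => 2 * RCDP.confRadius ν lam M δ (dx + dy) C (RCDP.delayComplexity Lam muτ) t) T →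
      P {ω | c * (1 + Real.log (T / δ)) ^ p *
          ((dx + dy : ℝ) * (Real.sqrt T + C + RCDP.delayComplexity Lam muτ) +
            (T : ℝ) ^ (1 - a) * (dx : ℝ) ^ r * (1 + Real.sqrt (dx + dy))) <
          R.regret φ θs T ω} ≤ ENNReal.ofReal δ ∧
      (a = 1 / 2 →
        P {ω | c * (1 + Real.log (T / δ)) ^ p *
            ((dx + dy : ℝ) * (Real.sqrt T + C + RCDP.delayComplexity Lam muτ)) <
            R.regret φ θs T ω} ≤ ENNReal.ofReal δ) := by
  refine ⟨3, fun κ lam hκ hl => ⟨RCDP.radiusConst κ lam, RCDP.radiusConst_pos hκ hl,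
    fun ν hν M C₀ a r hM0 hC₀ ha0 ha hr => ?_⟩⟩
  have hν0 : 0 ≤ ν := (RCDP.radiusConst_pos hκ hl).le.trans hν
  have hc := RCDP.regretConst_pos (κ := κ) hκ hl hν0 hM0 hC₀.le
  -- The factor `3 = 1 + 2` serves the case `a = 1 / 2`, where the approximation term is at most
  -- twice the leading one.
  refine ⟨3 * RCDP.regretConst κ lam ν M C₀, by positivity, ?_⟩
  intro dx dy K T hdx hT C Lam muτ hC _ hμ hCD δ hδ Ω _ P _ R pre mid g J φ 𝒳 θs hφ hE hbudget
    hdelay hJ hM hx hL hB hR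
  have hmain := R.measure_regret_le hdx hT hl hκ hν hC₀.le ha0 ha hC hμ hCD hδ.1 hδ.2 hφ hE hbudget
    hdelay hJ hM hx hL hB hR
  have hT1 : (1 : ℝ) ≤ T := by exact_mod_cast hT
  have hdx1 : (1 : ℝ) ≤ dx := by exact_mod_cast hdx
  have hlog := RCDP.log_div_nonneg hT1 hδ.1 hδ.2
  have hD := RCDP.delayComplexity_nonneg Lam muτ
  set D := RCDP.delayComplexity Lam muτ
  set c := RCDP.regretConst κ lam ν M C₀
  set Lg := 1 + Real.log (T / δ)
  have hLg : 0 ≤ c * Lg ^ 3 := by positivity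
  have hY : 0 ≤ (dx + dy : ℝ) * (Real.sqrt T + C + D) := by positivity
  refine ⟨(measure_mono fun ω hω => ?_).trans hmain, fun ha2 =>
    (measure_mono fun ω hω => ?_).trans hmain⟩
  · rw [Set.mem_ofPred_eq] at hω ⊢
    refine lt_of_le_of_lt ?_ hω
    have : 0 ≤ c * Lg ^ 3 * ((dx + dy : ℝ) * (Real.sqrt T + C + D) +
        (T : ℝ) ^ (1 - a) * (dx : ℝ) ^ r * (1 + Real.sqrt (dx + dy))) := by positivity
    linarith
  · rw [Set.mem_ofPred_eq] at hω ⊢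
    refine lt_of_le_of_lt ?_ hω
    have hr2 : r = 1 / 2 := hr.elim id fun h => h.trans ha2
    have hd1 : (1 : ℝ) ≤ dx + dy := by
      have := Nat.cast_nonneg (α := ℝ) dy
      linarith
    -- For `a = 1 / 2` both choices of `r` equal `1 / 2`, and `√d_x (1 + √d) ≤ 2 d`.
    have h1 : (T : ℝ) ^ (1 - a) * (dx : ℝ) ^ r * (1 + Real.sqrt (dx + dy)) ≤
        2 * ((dx + dy : ℝ) * (Real.sqrt T + C + D)) := by
      rw [ha2, hr2, show (1 : ℝ) - 1 / 2 = 1 / 2 by norm_num, ← Real.sqrt_eq_rpow,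
        ← Real.sqrt_eq_rpow]
      have e1 : Real.sqrt dx ≤ Real.sqrt (dx + dy) := Real.sqrt_le_sqrt (by simp)
      have e2 : 1 ≤ Real.sqrt (dx + dy : ℝ) := Real.one_le_sqrt.2 hd1
      have e3 : Real.sqrt (dx + dy : ℝ) * Real.sqrt (dx + dy : ℝ) = dx + dy :=
        Real.mul_self_sqrt (by linarith)
      calc Real.sqrt T * Real.sqrt dx * (1 + Real.sqrt (dx + dy))
          ≤ Real.sqrt T * Real.sqrt (dx + dy) *
            (Real.sqrt (dx + dy) + Real.sqrt (dx + dy)) := by gcongr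
        _ = 2 * ((Real.sqrt (dx + dy) * Real.sqrt (dx + dy)) * Real.sqrt T) := by ring
        _ = 2 * ((dx + dy : ℝ) * Real.sqrt T) := by rw [e3]
        _ ≤ _ := by
            gcongr
            linarith
    have h2 := mul_le_mul_of_nonneg_left h1 hLg
    rw [mul_add]
    linarith
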